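/- **Model.** A 3-d mesh of edge length $s$ has the processors $\{0,\dots,s-1\}^3$, each connected to its (at most 6) neighbors at distance 1. All processors synchronously run one fixed program. Each processor has a fixed number of words: natural numbers of $\Theta(\log p)$ bits, where $p=s^3$ is the number of processors, and weights in $\mathbb{R}\cup\{\pm\infty\}$. In one time step each processor replaces each of its words by the value of a fixed finite expression in its own words and those of its neighbors, built from the constants, from $+,-,\cdot,\lfloor\cdot/\cdot\rfloor,\bmod$ on numbers (with subtraction truncated at $0$), from $+,\min,\max$ on weights, and from case distinctions by comparing two numbers or two weights. Initially each processor knows $n$, $s$ and its coordinates. An $n\times n$ input matrix is stored one entry per processor in row-major order in a corner subcube of edge length $\lceil n^{2/3}\rceil$. The computation ends when all processors have raised a halting flag; the output is then stored in the same places. A mesh of size $n^\alpha$ means one of edge length $\lceil n^{\alpha/3}\rceil$. **Problems.** Let $G$ be a directed graph on $n$ vertices with real edge weights; paths may repeat vertices. The length of a path is the sum of its edge weights, and its width is the smallest of them ($+\infty$ for the path without edges). *All-pairs shortest paths (APSP)*, for $G$ without cycles of negative length: for all $i,j$, determine the least length of a path from $i$ to $j$ ($+\infty$ if there is no path), and a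 shortest path. *All-pairs bottleneck paths (APBP)*: for all $i,j$, determine the largest width of a path from $i$ to $j$ ($-\infty$ if there is no path), and a widest path. The paths are given by a table: for $i\ne j$ such that $j$ can be reached from $i$, it records either that the path is the edge from $i$ to $j$, or a vertex $k$ such that the path consists of the recorded path from $i$ to $k$ followed by the recorded path from $k$ to $j$; the recorded path from a vertex to itself is the one without edges. The input is either the weight matrix (with $+\infty$ for missing edges for APSP, and $-\infty$ for APBP) or, for graphs all of whose edges have weight 1, the $0/1$ adjacency matrix. **Corollary 1.** For every real $\alpha$ with $2\le\alpha\le 9/4$, each of APSP and APBP on $n$-vertex directed graphs, given by the weight matrix or by the adjacency matrix, can be solved on a 3-d mesh of size $n^\alpha$ in $\Theta(n^{3-\alpha}\log n)$ time: there are a program and a function $T(n)=\Theta(n^{3-\alpha}\log n)$, with implied constants that may depend on $\alpha$, such that for every $n$ the program solves the problem on every $n$-vertex input in exactly $T(n)$ steps. In particular, for $\alpha=9/4$ the time is $\Theta(n^{3/4}\log n)$. -/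

import Mathlib

noncomputable section

/-! ### The three-dimensional mesh-connected computer -/

/-- The processors of a cubical mesh of edge length `s`: points of the grid `{0, …, s-1}³`. -/
abbrev Proc (s : ℕ) : Type := Fin 3 → Fin s

/-- One of the six directions: an axis, and `true` for increasing, `false` for decreasing. -/
abbrev Dir : Type := Fin 3 × Bool

/-- The adjacent processor in a given direction, `none` at the boundary of the mesh. -/
def neighbor {s : ℕ} (p : Proc s) (d : Dir) : Option (Proc s) :=
  if d.2 then
    if h : (p d.1 : ℕ) + 1 < s then some (Function.update p d.1 ⟨(p d.1 : ℕ) + 1, h⟩) else none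
  else
    if 0 < (p d.1 : ℕ) then some (Function.update p d.1 ⟨(p d.1 : ℕ) - 1, by omega⟩) else none

/-- The two kinds of words: bounded natural numbers (indices, coordinates, counters) and
weights (real numbers or `±∞`). -/
inductive Kind : Type
  | num
  | wt

/-- The values of a word of a given kind. -/
def Kind.Val : Kind → Type
  | .num => ℕ
  | .wt => EReal

/-- Elementary operations on natural-number words. -/
inductive NumOp : Type
  | add
  | sub
  | mul
  | div
  | mod

/-- Elementary operations on natural-number words; `sub` is truncated at `0`. -/
def NumOp.eval : NumOp → ℕ → ℕ → ℕ
  | .add, x, y => x + y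
  | .sub, x, y => x - y
  | .mul, x, y => x * y
  | .div, x, y => x / y
  | .mod, x, y => x % y

/-- Elementary operations on weights. -/
inductive WtOp : Type
  | add
  | min
  | max

/-- Elementary operations on weights. -/
def WtOp.eval : WtOp → EReal → EReal → EReal
  | .add, x, y => x + y
  | .min, x, y => x ⊓ y
  | .max, x, y => x ⊔ y

/-- The constants available for weights. -/
inductive WtConst : Type
  | zero
  | top
  | bot

/-- The constants available for weights. -/
def WtConst.eval : WtConst → EReal
  | .zero => 0
  | .top => ⊤
  | .bot => ⊥

/-- The memory of one processor: `a` natural-number words and `b` weights. -/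
structure LocalState (a b : ℕ) : Type where
  num : Fin a → ℕ
  wt : Fin b → EReal

/-- The memory all of whose words are `0`. -/
def LocalState.blank (a b : ℕ) : LocalState a b := ⟨fun _ => 0, fun _ => 0⟩

/-- Finite expressions in the registers of a processor (source `none`) and of its six neighbors
(source `some d`). `ifNum x y u v` is `u` if `x ≤ y` and `v` otherwise, and `ifWt` is the same
for a comparison of weights. There is no conversion between weights and numbers. -/
inductive Expr (a b : ℕ) : Kind → Type
  | numConst (c : ℕ) : Expr a b .num
  | numReg (src : Option Dir) (r : Fin a) : Expr a b .num
  | numOp (op : NumOp) (x y : Expr a b .num) : Expr a b .num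
  | wtConst (c : WtConst) : Expr a b .wt
  | wtReg (src : Option Dir) (r : Fin b) : Expr a b .wt
  | wtOp (op : WtOp) (x y : Expr a b .wt) : Expr a b .wt
  | ifNum {k : Kind} (x y : Expr a b .num) (u v : Expr a b k) : Expr a b k
  | ifWt {k : Kind} (x y : Expr a b .wt) (u v : Expr a b k) : Expr a b k

open Classical in
/-- The value of an expression, given the memories that a processor sees. -/
def Expr.eval {a b : ℕ} (view : Option Dir → LocalState a b) :
    {k : Kind} → Expr a b k → k.Val
  | _, .numConst c => c
  | _, .numReg src r => (view src).num r
  | _, .numOp op x y => op.eval (x.eval view) (y.eval view)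
  | _, .wtConst c => c.eval
  | _, .wtReg src r => (view src).wt r
  | _, .wtOp op x y => op.eval (x.eval view) (y.eval view)
  | _, .ifNum x y u v =>
      if (show ℕ from x.eval view) ≤ (show ℕ from y.eval view) then u.eval view else v.eval view
  | _, .ifWt x y u v =>
      if (show EReal from x.eval view) ≤ (show EReal from y.eval view)
        then u.eval view else v.eval view

/-- A program, the same for all processors and for all meshes: a fixed number of words per
processor, a word length factor, and for each register the expression by which it is replaced in
one time step. As the program is fixed, a time step consists of a bounded number of word
transfers between adjacent processors and of elementary operations.

Natural-number registers: `0` the order `n` of the input matrix, `1` the edge length of the mesh,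
`2`, `3`, `4` the coordinates of the processor, `5` the halting flag, `6` the intermediate vertex
in the output. Weight register `0` holds the matrix entry, both at input and at output. -/
structure MeshProgram : Type where
  numExtra : ℕ
  wtExtra : ℕ
  wordLen : ℕ
  numNext : Fin (numExtra + 7) → Expr (numExtra + 7) (wtExtra + 1) .num
  wtNext : Fin (wtExtra + 1) → Expr (numExtra + 7) (wtExtra + 1) .wt

/-- The memory of one processor of a mesh that runs `P`. -/
abbrev MeshProgram.State (P : MeshProgram) : Type :=
  LocalState (P.numExtra + 7) (P.wtExtra + 1)

/-- The number of values of a natural-number word on a mesh with `s³` processors: words have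
`wordLen * (⌊log₂ s³⌋ + 1)` bits. -/
def MeshProgram.wordSize (P : MeshProgram) (s : ℕ) : ℕ :=
  2 ^ (P.wordLen * (Nat.log 2 (s ^ 3) + 1))

/-- The memories that processor `p` sees: its own and those of its neighbors (blank where the
neighbor is missing). -/
def MeshProgram.view (P : MeshProgram) {s : ℕ} (σ : Proc s → P.State) (p : Proc s) :
    Option Dir → P.State
  | none => σ p
  | some d =>
    match neighbor p d with
    | none => LocalState.blank _ _
    | some q => σ q

/-- One synchronous time step of the whole mesh. -/
def MeshProgram.step (P : MeshProgram) {s : ℕ} (σ : Proc s → P.State) : Proc s → P.State :=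
  fun p =>
    { num := fun r => (show ℕ from (P.numNext r).eval (P.view σ p)) % P.wordSize s
      wt := fun r => (P.wtNext r).eval (P.view σ p) }

/-- The entry of an `n × n` matrix that is stored at a processor, if any. The matrix occupies a
corner subcube of edge length `m = ⌈n^(2/3)⌉`, one entry per processor, in row-major order. -/
def entryAt (n : ℕ) {s : ℕ} (p : Proc s) : Option (Fin n × Fin n) :=
  let m := ⌈(n : ℝ) ^ (2 / 3 : ℝ)⌉₊
  let q := ((p 0 : ℕ) * m + (p 1 : ℕ)) * m + (p 2 : ℕ)
  if h : ((p 0 : ℕ) < m ∧ (p 1 : ℕ) < m ∧ (p 2 : ℕ) < m) ∧ q < n * n then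
    some (⟨q / n, Nat.div_lt_of_lt_mul h.2⟩,
      ⟨q % n, Nat.mod_lt _ (Nat.pos_of_mul_pos_left (Nat.zero_lt_of_lt h.2))⟩)
  else none

/-- The initial memories, for the input matrix `A`. -/
def MeshProgram.init (P : MeshProgram) (s : ℕ) {n : ℕ} (A : Fin n → Fin n → EReal) :
    Proc s → P.State :=
  fun p =>
    { num := fun r =>
        match (r : ℕ) with
        | 0 => n
        | 1 => s
        | 2 => p 0
        | 3 => p 1
        | 4 => p 2
        | _ => 0
      wt := fun r =>
        if r = 0 then
          match entryAt n p with
          | some (i, j) => A i j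
          | none => 0
        else 0 }

/-- The memories after `t` time steps on input `A`, on a mesh of edge length `s`. -/
def MeshProgram.run (P : MeshProgram) (s : ℕ) {n : ℕ} (A : Fin n → Fin n → EReal) (t : ℕ) :
    Proc s → P.State :=
  P.step^[t] (P.init s A)

/-- All processors have raised their halting flag. -/
def MeshProgram.Halted (P : MeshProgram) {s : ℕ} (σ : Proc s → P.State) : Prop :=
  ∀ p, (σ p).num 5 ≠ 0

/-- The running time of `P` on input `A` is exactly `t`. -/
def MeshProgram.HaltsAt (P : MeshProgram) (s : ℕ) {n : ℕ} (A : Fin n → Fin n → EReal)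
    (t : ℕ) : Prop :=
  P.Halted (P.run s A t) ∧ ∀ t' < t, ¬ P.Halted (P.run s A t')

/-- On input `A` the program runs for exactly `t` time steps, and then the matrices `D` and `mid`
are stored in the mesh, in the same places as the entries of the input. -/
def MeshProgram.Outputs (P : MeshProgram) (s : ℕ) {n : ℕ} (A : Fin n → Fin n → EReal) (t : ℕ)
    (D : Fin n → Fin n → EReal) (mid : Fin n → Fin n → ℕ) : Prop :=
  P.HaltsAt s A t ∧
    ∀ i j, ∃ p : Proc s, entryAt n p = some (i, j) ∧
      (P.run s A t p).wt 0 = D i j ∧ (P.run s A t p).num 6 = mid i j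

/-- The edge length of a cubical mesh of size `n ^ α`, rounded up to an integer. -/
def meshSide (α : ℝ) (n : ℕ) : ℕ := ⌈(n : ℝ) ^ (α / 3)⌉₊

/-! ### Path problems on directed graphs -/

/-- A directed graph with vertices `0, …, n-1` and real edge weights: `G i j = some c` if there
is an edge from `i` to `j`, of weight `c`, and `none` if there is no such edge. -/
abbrev WDigraph (n : ℕ) : Type := Fin n → Fin n → Option ℝ

open Classical in
/-- An unweighted directed graph, with all edges of weight `1`. -/
def WDigraph.ofDigraph {n : ℕ} (G : Digraph (Fin n)) : WDigraph n :=
  fun i j => if G.Adj i j then some 1 else none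

/-- Directed paths (vertices may repeat) from one vertex to another. -/
inductive DiPath {n : ℕ} (G : WDigraph n) : Fin n → Fin n → Type
  | nil (i : Fin n) : DiPath G i i
  | cons {i k j : Fin n} (c : ℝ) (h : G i k = some c) (p : DiPath G k j) : DiPath G i j

namespace DiPath

variable {n : ℕ} {G : WDigraph n}

/-- The length of a path: the sum of the weights of its edges. -/
def length : {i j : Fin n} → DiPath G i j → ℝ
  | _, _, nil _ => 0
  | _, _, cons c _ p => c + p.length

/-- The width of a path: the smallest weight of an edge on it (`⊤` for the path without
edges). -/
def width : {i j : Fin n} → DiPath G i j → EReal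
  | _, _, nil _ => ⊤
  | _, _, cons c _ p => (c : EReal) ⊓ p.width

/-- Concatenation of paths. -/
def append : {i k j : Fin n} → DiPath G i k → DiPath G k j → DiPath G i j
  | _, _, _, nil _, q => q
  | _, _, _, cons c h p, q => cons c h (p.append q)

/-- `FromTable mid p` says that `p` is the path which the table `mid` describes. For `i ≠ j`, the
value `mid i j = 0` stands for the edge from `i` to `j`, and `mid i j = k + 1` for the path from
`i` to `k` followed by the path from `k` to `j`. -/
inductive FromTable (mid : Fin n → Fin n → ℕ) : {i j : Fin n} → DiPath G i j → Prop
  | nil (i : Fin n) : FromTable mid (DiPath.nil i)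
  | edge {i j : Fin n} (c : ℝ) (h : G i j = some c) (hij : i ≠ j) (hm : mid i j = 0) :
      FromTable mid (DiPath.cons c h (DiPath.nil j))
  | split {i k j : Fin n} {p : DiPath G i k} {q : DiPath G k j} (hij : i ≠ j)
      (hm : mid i j = (k : ℕ) + 1) (hp : FromTable mid p) (hq : FromTable mid q) :
      FromTable mid (p.append q)

end DiPath

/-- There is no closed path of negative length. -/
def WDigraph.NoNegativeCycle {n : ℕ} (G : WDigraph n) : Prop :=
  ∀ (i : Fin n) (p : DiPath G i i), 0 ≤ p.length

/-- `D` and `mid` solve the all-pairs shortest path problem: where there is a path from `i` to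
`j`, the table `mid` describes a shortest one and `D i j` is its length; otherwise `D i j = ⊤`. -/
def IsAPSP {n : ℕ} (G : WDigraph n) (D : Fin n → Fin n → EReal) (mid : Fin n → Fin n → ℕ) :
    Prop :=
  ∀ i j,
    (∃ p : DiPath G i j, DiPath.FromTable mid p ∧ (∀ q : DiPath G i j, p.length ≤ q.length) ∧
      D i j = (p.length : EReal)) ∨
    (IsEmpty (DiPath G i j) ∧ D i j = ⊤)

/-- `D` and `mid` solve the all-pairs bottleneck path problem: where there is a path from `i` to
`j`, the table `mid` describes a widest one and `D i j` is its width; otherwise `D i j = ⊥`. -/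
def IsAPBP {n : ℕ} (G : WDigraph n) (D : Fin n → Fin n → EReal) (mid : Fin n → Fin n → ℕ) :
    Prop :=
  ∀ i j,
    (∃ p : DiPath G i j, DiPath.FromTable mid p ∧ (∀ q : DiPath G i j, q.width ≤ p.width) ∧
      D i j = p.width) ∨
    (IsEmpty (DiPath G i j) ∧ D i j = ⊥)

/-- The weight matrix, with the entry `e` where there is no edge. -/
def WDigraph.weightMatrix {n : ℕ} (G : WDigraph n) (e : EReal) : Fin n → Fin n → EReal :=
  fun i j => (G i j).elim e (fun c => (c : EReal))

open Classical in
/-- The adjacency matrix, with entries `1` (edge) and `0` (no edge). -/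
def adjacencyMatrix {n : ℕ} (G : Digraph (Fin n)) : Fin n → Fin n → EReal :=
  fun i j => if G.Adj i j then 1 else 0

/-! ### Solving the path problems on meshes of size `n ^ α` -/

/-- Given the weight matrix (with `⊤` for missing edges) of a directed graph without negative
cycles, `P` solves the all-pairs shortest path problem in time `T n`. -/
def SolvesWeightedAPSP (α : ℝ) (P : MeshProgram) (T : ℕ → ℕ) : Prop :=
  ∀ (n : ℕ) (G : WDigraph n), G.NoNegativeCycle →
    ∃ D mid, P.Outputs (meshSide α n) (G.weightMatrix ⊤) (T n) D mid ∧ IsAPSP G D mid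

/-- Given the adjacency matrix of a directed graph, `P` solves the all-pairs shortest path
problem (for edges of weight `1`) in time `T n`. -/
def SolvesUnweightedAPSP (α : ℝ) (P : MeshProgram) (T : ℕ → ℕ) : Prop :=
  ∀ (n : ℕ) (G : Digraph (Fin n)),
    ∃ D mid, P.Outputs (meshSide α n) (adjacencyMatrix G) (T n) D mid ∧
      IsAPSP (WDigraph.ofDigraph G) D mid

/-- Given the weight matrix (with `⊥` for missing edges) of a directed graph, `P` solves the
all-pairs bottleneck path problem in time `T n`. -/
def SolvesWeightedAPBP (α : ℝ) (P : MeshProgram) (T : ℕ → ℕ) : Prop :=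
  ∀ (n : ℕ) (G : WDigraph n),
    ∃ D mid, P.Outputs (meshSide α n) (G.weightMatrix ⊥) (T n) D mid ∧ IsAPBP G D mid

/-- Given the adjacency matrix of a directed graph, `P` solves the all-pairs bottleneck path
problem (for edges of weight `1`) in time `T n`. -/
def SolvesUnweightedAPBP (α : ℝ) (P : MeshProgram) (T : ℕ → ℕ) : Prop :=
  ∀ (n : ℕ) (G : Digraph (Fin n)),
    ∃ D mid, P.Outputs (meshSide α n) (adjacencyMatrix G) (T n) D mid ∧
      IsAPBP (WDigraph.ofDigraph G) D mid

/-- Some program solves the problem in time of exact order `f`. -/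
def SolvableInTheta (Solves : MeshProgram → (ℕ → ℕ) → Prop) (f : ℕ → ℝ) : Prop :=
  ∃ (P : MeshProgram) (T : ℕ → ℕ), Solves P T ∧
    Asymptotics.IsTheta Filter.atTop (fun n => (T n : ℝ)) f

/-- Both path problems, from weight matrices and from adjacency matrices, can be solved on a mesh
of size `n ^ α` in time of exact order `f`. -/
def PathProblemsSolvableInTheta (α : ℝ) (f : ℕ → ℝ) : Prop :=
  SolvableInTheta (SolvesWeightedAPSP α) f ∧
  SolvableInTheta (SolvesUnweightedAPSP α) f ∧
  SolvableInTheta (SolvesWeightedAPBP α) f ∧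
  SolvableInTheta (SolvesUnweightedAPBP α) f

end

/-!
Optimal paths are found by repeated squaring: `⌈log₂ n⌉` products of matrices over `(min, +)` or
`(max, min)`. Dividing rows and columns into `d = ⌈n / s⌉` residue classes cuts a matrix into `d²`
blocks of side at most `s`, which are stacked in a grid of side `8 s`, each processor simulating
`8³` cells. In one sweep of `O(s)` steps every cell reads the whole axis-parallel lines through it,
so a sweep multiplies about `8 s` pairs of blocks, and a product, being `d³` block products, takes
`O(1 + d³ / s)` sweeps. With `s ≈ n ^ (α / 3)`, the logarithmically many products take time
`(s + n ^ (3 - α)) log n`, and `s ≤ n ^ (3 - α)` for `α ≤ 9 / 4`. Input and output positions are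
connected to the places of the entries in the blocks by boundedly many sweeps.

Each entry keeps the intermediate vertex of its last improvement. The table obtained in this way
describes an optimal path: if the improvement came from paths whose parts are optimal, then the
parts were last improved earlier. A part of a widest path that is not itself a widest path can be
replaced by a strictly wider path, which happens only finitely often along a recorded path.
-/

noncomputable section

/-! ### Functions that a processor can compute in one time step -/

/-- What a processor sees: its own memory, at `none`, and those of its neighbors. -/
abbrev View (a b : ℕ) : Type := Option Dir → LocalState a b

section Expressible

variable {a b : ℕ}

/-- A function of the view that is the value of an expression. -/
def IsExpressible {κ : Kind} (f : View a b → κ.Val) : Prop :=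
  ∃ e : Expr a b κ, ∀ v, e.eval v = f v

/-- `IsExpressible` for numbers, spelled with `ℕ` instead of `Kind.num.Val` for unification. -/
def IsNumExpr (f : View a b → ℕ) : Prop := IsExpressible (κ := .num) f

/-- `IsExpressible` for weights, spelled with `EReal` instead of `Kind.wt.Val` for unification. -/
def IsWtExpr (f : View a b → EReal) : Prop := IsExpressible (κ := .wt) f

open Classical in
/-- A condition on the view on which expressions can branch. -/
def IsTestable (p : View a b → Prop) : Prop :=
  ∀ ⦃κ : Kind⦄ ⦃f g : View a b → κ.Val⦄, IsExpressible f → IsExpressible g →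
    IsExpressible fun v => if p v then f v else g v

namespace IsTestable

variable {p q : View a b → Prop}

theorem le {x y : View a b → ℕ} (hx : IsNumExpr x) (hy : IsNumExpr y) :
    IsTestable fun v => x v ≤ y v := by
  rintro κ f g ⟨ef, hf⟩ ⟨eg, hg⟩
  obtain ⟨ex, hx⟩ := hx
  obtain ⟨ey, hy⟩ := hy
  exact ⟨.ifNum ex ey ef eg, fun v => by
    simp only [Expr.eval, hx, hy, hf, hg]
    congr⟩

theorem wt_le {x y : View a b → EReal} (hx : IsWtExpr x) (hy : IsWtExpr y) :
    IsTestable fun v => x v ≤ y v := by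
  rintro κ f g ⟨ef, hf⟩ ⟨eg, hg⟩
  obtain ⟨ex, hx⟩ := hx
  obtain ⟨ey, hy⟩ := hy
  exact ⟨.ifWt ex ey ef eg, fun v => by
    simp only [Expr.eval, hx, hy, hf, hg]
    congr⟩

theorem const (p : Prop) : IsTestable fun _ : View a b => p := fun κ f g hf hg => by
  by_cases hp : p <;> simpa only [hp, if_true, if_false]

theorem not (hp : IsTestable p) : IsTestable fun v => ¬ p v := fun κ f g hf hg => by
  convert hp hg hf using 2
  split_ifs <;> simp_all

theorem and (hp : IsTestable p) (hq : IsTestable q) : IsTestable fun v => p v ∧ q v :=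
  fun κ f g hf hg => by
    convert hp (hq hf hg) hg using 2
    split_ifs <;> tauto

theorem congr (hp : IsTestable p) (h : ∀ v, q v ↔ p v) : IsTestable q :=
  (funext fun v => propext (h v) : q = p) ▸ hp

theorem ite [∀ v, Decidable (p v)] (hp : IsTestable p) {κ : Kind} {f g : View a b → κ.Val}
    (hf : IsExpressible f) (hg : IsExpressible g) :
    IsExpressible fun v => if p v then f v else g v := by
  convert hp hf hg

theorem lt {x y : View a b → ℕ} (hx : IsNumExpr x) (hy : IsNumExpr y) :
    IsTestable fun v => x v < y v := (le hy hx).not.congr fun _ => not_le.symm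

theorem eq {x y : View a b → ℕ} (hx : IsNumExpr x) (hy : IsNumExpr y) :
    IsTestable fun v => x v = y v := ((le hx hy).and (le hy hx)).congr fun _ => le_antisymm_iff

theorem wt_lt {x y : View a b → EReal} (hx : IsWtExpr x) (hy : IsWtExpr y) :
    IsTestable fun v => x v < y v := (wt_le hy hx).not.congr fun _ => not_le.symm

end IsTestable

namespace IsNumExpr

variable {f g : View a b → ℕ}

theorem const (c : ℕ) : IsNumExpr fun _ : View a b => c := ⟨.numConst c, fun _ => rfl⟩

theorem reg (src : Option Dir) (r : Fin a) : IsNumExpr fun v : View a b => (v src).num r :=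
  ⟨.numReg src r, fun _ => rfl⟩

theorem op (o : NumOp) (hf : IsNumExpr f) (hg : IsNumExpr g) :
    IsNumExpr fun v => o.eval (f v) (g v) := by
  obtain ⟨e, he⟩ := hf
  obtain ⟨e', he'⟩ := hg
  exact ⟨.numOp o e e', fun v => by rw [Expr.eval, he, he']⟩

theorem add (hf : IsNumExpr f) (hg : IsNumExpr g) : IsNumExpr fun v => f v + g v := op .add hf hg

theorem sub (hf : IsNumExpr f) (hg : IsNumExpr g) : IsNumExpr fun v => f v - g v := op .sub hf hg

theorem mul (hf : IsNumExpr f) (hg : IsNumExpr g) : IsNumExpr fun v => f v * g v := op .mul hf hg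

theorem div (hf : IsNumExpr f) (hg : IsNumExpr g) : IsNumExpr fun v => f v / g v := op .div hf hg

theorem mod (hf : IsNumExpr f) (hg : IsNumExpr g) : IsNumExpr fun v => f v % g v := op .mod hf hg

theorem ite {p : View a b → Prop} [∀ v, Decidable (p v)] (hp : IsTestable p) (hf : IsNumExpr f)
    (hg : IsNumExpr g) : IsNumExpr fun v => if p v then f v else g v :=
  hp.ite hf hg

end IsNumExpr

namespace IsWtExpr

variable {f g : View a b → EReal}

theorem const (c : WtConst) : IsWtExpr fun _ : View a b => c.eval := ⟨.wtConst c, fun _ => rfl⟩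

theorem zero : IsWtExpr fun _ : View a b => (0 : EReal) := const .zero

theorem reg (src : Option Dir) (r : Fin b) : IsWtExpr fun v : View a b => (v src).wt r :=
  ⟨.wtReg src r, fun _ => rfl⟩

theorem op (o : WtOp) (hf : IsWtExpr f) (hg : IsWtExpr g) :
    IsWtExpr fun v => o.eval (f v) (g v) := by
  obtain ⟨e, he⟩ := hf
  obtain ⟨e', he'⟩ := hg
  exact ⟨.wtOp o e e', fun v => by rw [Expr.eval, he, he']⟩

theorem ite {p : View a b → Prop} [∀ v, Decidable (p v)] (hp : IsTestable p) (hf : IsWtExpr f)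
    (hg : IsWtExpr g) : IsWtExpr fun v => if p v then f v else g v :=
  hp.ite hf hg

end IsWtExpr

end Expressible

/-- The memories that a processor sees. -/
def meshView {a b s : ℕ} (σ : Proc s → LocalState a b) (p : Proc s) : View a b
  | none => σ p
  | some d => (neighbor p d).elim (LocalState.blank _ _) σ

section ProgramOf

variable {ne we : ℕ} {numFun : Fin (ne + 7) → View (ne + 7) (we + 1) → ℕ}
  {wtFun : Fin (we + 1) → View (ne + 7) (we + 1) → EReal}

/-- The program that replaces each register by the value of the given function of the view, up to
the reduction of numbers to the word length. -/
def programOf (wl : ℕ) (hnum : ∀ r, IsNumExpr (numFun r)) (hwt : ∀ r, IsWtExpr (wtFun r)) :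
    MeshProgram where
  numExtra := ne
  wtExtra := we
  wordLen := wl
  numNext r := (hnum r).choose
  wtNext r := (hwt r).choose

variable (wl : ℕ) (hnum : ∀ r, IsNumExpr (numFun r)) (hwt : ∀ r, IsWtExpr (wtFun r)) {s : ℕ}
  (σ : Proc s → LocalState (ne + 7) (we + 1)) (p : Proc s)

theorem programOf_view : (programOf wl hnum hwt).view σ p = meshView σ p := by
  funext d
  rcases d with _ | d
  · rfl
  · simp only [MeshProgram.view, meshView]
    cases neighbor p d <;> rfl

theorem programOf_step_num (r : Fin (ne + 7)) :
    ((programOf wl hnum hwt).step σ p).num r =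
      numFun r (meshView σ p) % (programOf wl hnum hwt).wordSize s :=
  congrArg (· % (programOf wl hnum hwt).wordSize s)
    (((hnum r).choose_spec _).trans (congrArg (numFun r) (programOf_view wl hnum hwt σ p)))

theorem programOf_step_wt (r : Fin (we + 1)) :
    ((programOf wl hnum hwt).step σ p).wt r = wtFun r (meshView σ p) :=
  ((hwt r).choose_spec _).trans (congrArg (wtFun r) (programOf_view wl hnum hwt σ p))

end ProgramOf

/-! ### Sweeps -/

/-- A weight together with a number. -/
@[ext]
structure Word : Type where
  wt : EReal
  num : ℕ

/-- The word both of whose components are `0`. -/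
def Word.blank : Word := ⟨0, 0⟩

/-- The words of a cell other than its streams: `io` for input and output, `transit` for words
under way, `entry` for the matrix, `fst` and `snd` for the factors and `prod` for the result of a
product. -/
structure Store : Type where
  io : Word
  transit : Word
  entry : Word
  fst : Word
  snd : Word
  prod : Word

/-- The memory of a cell: its store, and for each axis the words of the two streams that pass
through it, `left` towards coordinate `0` and `right` away from it. -/
structure Cell : Type where
  store : Store
  left : Fin 3 → Word
  right : Fin 3 → Word

/-- Positions of cells. -/
abbrev Pos : Type := Fin 3 → ℕ

/-- The sum of the coordinates, which determines when a cell takes part in a sweep. -/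
def Pos.sum (p : Pos) : ℕ := p 0 + p 1 + p 2

theorem Pos.sum_update (p : Pos) (a : Fin 3) (k : ℕ) :
    Pos.sum (Function.update p a k) + p a = Pos.sum p + k := by
  fin_cases a <;> simp [Pos.sum, Function.update] <;> omega

theorem Pos.le_sum (p : Pos) (a : Fin 3) : p a ≤ Pos.sum p := by
  fin_cases a <;> simp [Pos.sum] <;> omega

theorem Pos.update_lt {S : ℕ} {p : Pos} (hp : ∀ a, p a < S) {k : ℕ} (hk : k < S) (a b : Fin 3) :
    Function.update p a k b < S := by
  rcases eq_or_ne b a with rfl | hb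
  · rwa [Function.update_self]
  · rw [Function.update_of_ne hb]
    exact hp b

/-- The new memory of the cell `p` after the `τ`-th step of a sweep, given its memory `c` and the
words `up a` and `dn a` that arrive from the next higher and the next lower cells.

The words move towards coordinate `0`, are reflected there, and move back. A cell sends its word
along axis `a` at the time that is the sum of its two other coordinates; so the words of the cells
`p[a := k]` reach `p` in step with each other for the three axes `a`, in the order of `k`. -/
def sweepCell (S τ : ℕ) (load : Fin 3 → Store → Word)
    (consume : ℕ → (Fin 3 → Word) → Store → Store) (p : Pos) (c : Cell) (up dn : Fin 3 → Word) :
    Cell where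
  store := if p.sum + 2 ≤ τ ∧ τ < p.sum + 2 + S then consume (τ - (p.sum + 2)) c.right c.store
    else c.store
  left a := if τ + p a = p.sum then load a c.store else up a
  right a := if p a = 0 then c.left a else dn a

/-- The word that comes from the next higher cell of a grid of side `S`. -/
def upWord (S : ℕ) (σ : Pos → Cell) (p : Pos) (a : Fin 3) : Word :=
  if p a + 1 < S then (σ (Function.update p a (p a + 1))).left a else Word.blank

/-- The word that comes from the next lower cell. -/
def downWord (σ : Pos → Cell) (p : Pos) (a : Fin 3) : Word :=
  if 0 < p a then (σ (Function.update p a (p a - 1))).right a else Word.blank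

/-- The `τ`-th step of a sweep. -/
def sweepStep (S τ : ℕ) (load : Fin 3 → Store → Word)
    (consume : Pos → ℕ → (Fin 3 → Word) → Store → Store) (σ : Pos → Cell) (p : Pos) : Cell :=
  sweepCell S τ load (consume p) p (σ p) (upWord S σ p) (downWord σ p)

/-- The memories `σ 0`, …, `σ (4 * S)` of the cells of a grid of side `S` evolve by a sweep. -/
def IsSweep (S : ℕ) (load : Fin 3 → Store → Word)
    (consume : Pos → ℕ → (Fin 3 → Word) → Store → Store) (σ : ℕ → Pos → Cell) : Prop :=
  ∀ τ < 4 * S, ∀ p, (∀ a, p a < S) → σ (τ + 1) p = sweepStep S τ load consume (σ τ) p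

/-- Applying `f 0`, …, `f (k - 1)`, in this order. -/
def iter {β : Type*} (f : ℕ → β → β) : ℕ → β → β
  | 0, l => l
  | k + 1, l => f k (iter f k l)

namespace IsSweep

variable {S : ℕ} {load : Fin 3 → Store → Word}
  {consume : Pos → ℕ → (Fin 3 → Word) → Store → Store} {σ : ℕ → Pos → Cell} {p : Pos}

theorem store_eq_of_le (h : IsSweep S load consume σ) (hp : ∀ a, p a < S) {τ : ℕ}
    (hτ : τ ≤ p.sum + 2) (hτS : τ ≤ 4 * S) : (σ τ p).store = (σ 0 p).store := by
  induction τ with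
  | zero => rfl
  | succ τ ih =>
    rw [h τ (by omega) p hp, ← ih (by omega) (by omega)]
    simp only [sweepStep, sweepCell]
    rw [if_neg (by omega)]

theorem left_eq (h : IsSweep S load consume σ) (hp : ∀ a, p a < S) (a : Fin 3) {d τ : ℕ}
    (hd : p a + d < S) (hτ : τ + 1 + p a = p.sum + d + 1) (hτS : τ < 4 * S) :
    (σ (τ + 1) p).left a = load a (σ 0 (Function.update p a (p a + d))).store := by
  induction d generalizing p τ with
  | zero =>
    rw [h τ hτS p hp]
    simp only [sweepStep, sweepCell, add_zero, Function.update_eq_self]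
    rw [if_pos (by omega), h.store_eq_of_le hp (by omega) hτS.le]
  | succ d ih =>
    have hle := Pos.le_sum p a
    have hsum := Pos.sum_update p a (p a + 1)
    obtain ⟨τ, rfl⟩ : ∃ t, τ = t + 1 := ⟨τ - 1, by omega⟩
    rw [h _ hτS p hp]
    simp only [sweepStep, sweepCell, upWord]
    rw [if_neg (by omega), if_pos (by omega), ih (Pos.update_lt hp (by omega) a)]
    · rw [Function.update_self, Function.update_idem, add_assoc, add_comm 1 d]
    · rw [Function.update_self]
      omega
    · rw [Function.update_self]
      omega
    · omega

theorem right_eq (h : IsSweep S load consume σ) (hp : ∀ a, p a < S) (a : Fin 3) {k : ℕ}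
    (hk : k < S) (hkS : p.sum + 2 + k ≤ 4 * S) :
    (σ (p.sum + 2 + k) p).right a = load a (σ 0 (Function.update p a k)).store := by
  obtain ⟨c, hc⟩ : ∃ c, p a = c := ⟨_, rfl⟩
  induction c generalizing p with
  | zero =>
    rw [show p.sum + 2 + k = p.sum + k + 1 + 1 by omega, h _ (by omega) p hp]
    simp only [sweepStep, sweepCell, hc, if_true]
    rw [h.left_eq hp a (d := k) (by omega) (by omega) (by omega), hc, zero_add]
  | succ c ih =>
    have hsum := Pos.sum_update p a c
    rw [show p.sum + 2 + k = p.sum + 1 + k + 1 by omega, h _ (by omega) p hp]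
    simp only [sweepStep, sweepCell, downWord, hc, Nat.add_sub_cancel]
    have := ih (Pos.update_lt hp (by have := hp a; omega) a) (by omega) (Function.update_self ..)
    rw [Function.update_idem] at this
    rw [if_neg (by omega), if_pos (by omega), ← this]
    congr 2
    omega

theorem store_eq_of_lt (h : IsSweep S load consume σ) (hp : ∀ a, p a < S) {k : ℕ} (hk : k ≤ S)
    (hkS : p.sum + 2 + k ≤ 4 * S) :
    (σ (p.sum + 2 + k) p).store =
      iter (fun k => consume p k fun a => load a (σ 0 (Function.update p a k)).store) k
        (σ 0 p).store := by
  induction k with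
  | zero => exact h.store_eq_of_le hp le_rfl hkS
  | succ k ih =>
    rw [← add_assoc, h _ (by omega) p hp]
    simp only [sweepStep, sweepCell, iter]
    rw [if_pos (by omega), ih (by omega) (by omega), Nat.add_sub_cancel_left]
    congr 1
    exact funext fun a => h.right_eq hp a (by omega) (by omega)

theorem store_eq_of_ge (h : IsSweep S load consume σ) (hp : ∀ a, p a < S) {d : ℕ}
    (hd : p.sum + 2 + S + d ≤ 4 * S) :
    (σ (p.sum + 2 + S + d) p).store = (σ (p.sum + 2 + S) p).store := by
  induction d with
  | zero => rfl
  | succ d ih =>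
    rw [← add_assoc, h _ (by omega) p hp, ← ih (by omega)]
    simp only [sweepStep, sweepCell]
    rw [if_neg (by omega)]

theorem store_eq (h : IsSweep S load consume σ) (hp : ∀ a, p a < S) :
    (σ (4 * S) p).store =
      iter (fun k => consume p k fun a => load a (σ 0 (Function.update p a k)).store) S
        (σ 0 p).store := by
  have hsum : p.sum + 3 ≤ 3 * S := by
    have := hp 0
    have := hp 1
    have := hp 2
    rw [Pos.sum]
    omega
  obtain ⟨d, hd⟩ := Nat.exists_eq_add_of_le (show p.sum + 2 + S ≤ 4 * S by omega)
  rw [← h.store_eq_of_lt hp le_rfl (by omega), hd, h.store_eq_of_ge hp hd.ge]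

end IsSweep

section Iter

variable {β γ : Type*} {f : ℕ → β → β}

theorem iter_eq_ite {c : ℕ} (h : ∀ k l, k ≠ c → f k l = l) (S : ℕ) (l : β) :
    iter f S l = if c < S then f c l else l := by
  induction S with
  | zero => simp [iter]
  | succ S ih =>
    simp only [iter, ih]
    rcases lt_trichotomy c S with hc | rfl | hc
    · rw [if_pos hc, if_pos (by omega), h _ _ hc.ne']
    · rw [if_neg (lt_irrefl c), if_pos c.lt_succ_self]
    · rw [if_neg (by omega), if_neg (by omega), h _ _ hc.ne]

theorem iter_induction {C : ℕ → β → Prop} {S : ℕ} {l : β} (h0 : C 0 l)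
    (h : ∀ k < S, ∀ l, C k l → C (k + 1) (f k l)) : C S (iter f S l) := by
  induction S with
  | zero => exact h0
  | succ S ih => exact h S (by omega) _ (ih fun k hk => h k (by omega))

theorem map_iter {g : ℕ → γ → γ} (π : β → γ) (h : ∀ k l, π (f k l) = g k (π l)) (S : ℕ) (l : β) :
    π (iter f S l) = iter g S (π l) := by
  induction S with
  | zero => rfl
  | succ S ih => simp only [iter, h, ih]

theorem map_iter_of_forall_eq (π : β → γ) (h : ∀ k l, π (f k l) = π l) (S : ℕ) (l : β) :
    π (iter f S l) = π l :=
  iter_induction (C := fun _ l' => π l' = π l) rfl fun k _ l' hl => (h k l').trans hl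

end Iter

theorem mul_add_div_of_lt {a b c : ℕ} (hc : c < b) : (a * b + c) / b = a := by
  rw [mul_comm, Nat.mul_add_div (by omega), Nat.div_eq_of_lt hc, add_zero]

theorem mul_add_lt_of_mul_le {i a c d N : ℕ} (hi : i < a) (hc : c < d) (hN : a * d ≤ N) :
    i * d + c < N := by
  have : (i + 1) * d ≤ a * d := Nat.mul_le_mul_right _ hi
  rw [Nat.succ_mul] at this
  omega

theorem le_ceilDiv_mul {a b : ℕ} (hb : 0 < b) : a ≤ a ⌈/⌉ b * b := by
  rw [mul_comm]
  exact le_smul_ceilDiv hb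

theorem ceilDiv_mul_lt {a b : ℕ} (ha : 0 < a) : a ⌈/⌉ b * b < a + b := by
  have := Nat.div_mul_le_self (a + b - 1) b
  rw [Nat.ceilDiv_eq_add_pred_div]
  omega

/-! ### The layout of the matrices and the routes between input and home positions -/

/-- The parameters on which the layout depends: the order `n` of the matrix, the side `s` of the
mesh, and the side `m` of the subcube that holds the input.

The home position of the entry `(i, j)`, where it takes part in products, lies in a grid of side
`8 * s`; the input and output position is the cell that belongs to its processor. -/
structure Layout : Type where
  n : ℕ
  s : ℕ
  m : ℕ

namespace Layout

variable (L : Layout)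

/-- The number of residue classes into which rows and columns are divided. -/
def stride : ℕ := L.n ⌈/⌉ L.s

/-- The least multiple of `stride` that is at least `m`. Before they reach their home positions,
entries are spread by their column modulo this number. -/
def modulus : ℕ := L.stride * (L.m ⌈/⌉ L.stride)

/-- The number of layers used for each residue class of rows while routing. -/
def height : ℕ := L.n ⌈/⌉ L.modulus + L.stride

/-- The number of block products that are computed simultaneously for each block. -/
def batch : ℕ := 8 * L.s / (L.stride * L.stride)

/-- The number of multiplication rounds of a matrix product. -/
def batches : ℕ := L.stride ⌈/⌉ L.batch

/-- The number of sweeps of a matrix product: two for each multiplication round, and one that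
combines the results. -/
def period : ℕ := 2 * L.batches + 1

/-- The first plane of the input that contains a row `i` with `i / stride = x`. -/
def firstPlane (x : ℕ) : ℕ := x * L.stride * L.n / (L.m * L.m)

/-- The position of the entry `(i, j)` before the stage `st` of the routing, along axis `0`. -/
def coord0 (st i j : ℕ) : ℕ := if st < 2 then 8 * ((i * L.n + j) / (L.m * L.m)) else i / L.stride

/-- The position of the entry `(i, j)` before the stage `st` of the routing, along axis `1`. -/
def coord1 (st i j : ℕ) : ℕ :=
  if st < 3 then 8 * ((i * L.n + j) / L.m % L.m)
  else if st < 5 then i % L.stride * L.height + (j / L.modulus + j % L.stride)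
  else i % L.stride * L.stride + j % L.stride

/-- The position of the entry `(i, j)` before the stage `st` of the routing, along axis `2`. -/
def coord2 (st i j : ℕ) : ℕ :=
  if st < 1 then 8 * ((i * L.n + j) % L.m) else if st < 4 then j % L.modulus else j / L.stride

/-- The position of the entry `(i, j)` before the stage `st` of the routing. There are five stages,
so stage `0` starts at the input and `pos 5 i j` is the home position.

No position receives more than boundedly many entries: a line of the input has at most `modulus`
entries, which the stage `0` spreads by their columns; the stage `1` collects the rows of each row
block in one plane; the stage `2` separates these rows, so that the stages `3` and `4` can move
entries to their column blocks and to their layers without conflicts. -/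
def pos (st i j : ℕ) : Pos := ![L.coord0 st i j, L.coord1 st i j, L.coord2 st i j]

/-- The axis of the moves in the stage `st` of the routing. -/
def axis (st : ℕ) : Fin 3 := if st = 0 then 2 else if st = 1 then 0 else if st = 3 then 2 else 1

/-- Up to six entries pass through a position; this tells them apart. -/
def slot (i j : ℕ) : ℕ :=
  2 * ((i * L.n + j) / (L.m * L.m) - L.firstPlane (i / L.stride)) +
    (i - (i * L.n + j) / L.m * L.m / L.n)

/-- The line of the input that is met at a position, for the stages `0`, `1` and `2`. -/
def lineAt (st κ : ℕ) (p : Pos) : ℕ :=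
  (if st < 2 then p 0 / 8 else L.firstPlane (p 0) + κ / 2) * L.m + p 1 / 8

/-- The row index of the entry with slot `κ` at a position. -/
def rowAt (st κ : ℕ) (p : Pos) : ℕ :=
  if st < 1 then (L.lineAt st κ p * L.m + p 2 / 8) / L.n
  else if st < 3 then L.lineAt st κ p * L.m / L.n + κ % 2
  else if st < 5 then p 0 * L.stride + p 1 / L.height
  else p 0 * L.stride + p 1 / L.stride

/-- The column index of the entry with slot `κ` at a position. -/
def colAt (st κ : ℕ) (p : Pos) : ℕ :=
  if st < 1 then (L.lineAt st κ p * L.m + p 2 / 8) % L.n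
  else if st < 3 then
    -- The line holds `m ≤ modulus` entries, so the column is determined by its residue; adding
    -- `modulus - 1` times the start of the line amounts to subtracting that start.
    L.lineAt st κ p * L.m +
        (p 2 + L.rowAt st κ p * L.n + (L.modulus - 1) * (L.lineAt st κ p * L.m)) % L.modulus
      - L.rowAt st κ p * L.n
  else if st < 4 then (p 1 % L.height - p 2 % L.stride) * L.modulus + p 2
  else if st < 5 then p 2 * L.stride + (p 1 % L.height - p 2 / (L.modulus / L.stride))
  else p 2 * L.stride + p 1 % L.stride

/-- What the layout requires of the parameters. -/
structure Valid : Prop where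
  one_le : 1 ≤ L.n
  sq_le : L.n * L.n ≤ L.m * L.m * L.m
  le_n : L.m ≤ L.n
  le_s : L.m ≤ L.s

variable {L}

theorem stride_dvd_modulus : L.stride ∣ L.modulus := Dvd.intro _ rfl

theorem modulus_div_mul : L.modulus / L.stride * L.stride = L.modulus :=
  Nat.div_mul_cancel stride_dvd_modulus

theorem height_sub_stride : L.height - L.stride = L.n ⌈/⌉ L.modulus := Nat.add_sub_cancel _ _

theorem lineIndex_mul_add {i j : ℕ} :
    (i * L.n + j) / (L.m * L.m) * L.m + (i * L.n + j) / L.m % L.m = (i * L.n + j) / L.m := by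
  rw [← Nat.div_div_eq_div_mul]
  exact Nat.div_add_mod' _ _

namespace Valid

theorem m_pos (h : L.Valid) : 1 ≤ L.m := by
  by_contra hm
  have hm : L.m = 0 := by omega
  have hsq := h.sq_le
  have hn := h.one_le
  rw [hm] at hsq
  nlinarith

theorem s_pos (h : L.Valid) : 1 ≤ L.s := h.m_pos.trans h.le_s

theorem n_le (h : L.Valid) : L.n ≤ L.m * L.m := by
  by_contra! hc
  have hlt : L.m * L.m * (L.m * L.m) < L.n * L.n := Nat.mul_lt_mul_of_lt_of_lt hc hc
  have hsq := h.sq_le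
  have := Nat.mul_le_mul_left (L.m * L.m * L.m) h.m_pos
  nlinarith

theorem le_stride_mul (h : L.Valid) : L.n ≤ L.stride * L.s := le_ceilDiv_mul h.s_pos

theorem stride_mul_lt (h : L.Valid) : L.stride * L.s < L.n + L.s := ceilDiv_mul_lt h.one_le

theorem stride_pos (h : L.Valid) : 1 ≤ L.stride :=
  Nat.pos_of_mul_pos_right (h.one_le.trans h.le_stride_mul)

theorem m_le_modulus (h : L.Valid) : L.m ≤ L.modulus := by
  rw [modulus, mul_comm]
  exact le_ceilDiv_mul h.stride_pos

theorem modulus_lt (h : L.Valid) : L.modulus < L.m + L.stride := by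
  rw [modulus, mul_comm]
  exact ceilDiv_mul_lt h.m_pos

theorem modulus_pos (h : L.Valid) : 1 ≤ L.modulus := h.m_pos.trans h.m_le_modulus

theorem stride_le_m (h : L.Valid) : L.stride ≤ L.m := by
  by_contra! hc
  have hmul : (L.m + 1) * L.s ≤ L.stride * L.s := Nat.mul_le_mul_right _ hc
  have hn : L.n ≤ L.m * L.s := h.n_le.trans (Nat.mul_le_mul_left _ h.le_s)
  have := h.stride_mul_lt
  rw [Nat.succ_mul] at hmul
  omega

theorem modulus_le (h : L.Valid) : L.modulus ≤ 2 * L.s := by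
  have := h.modulus_lt
  have := h.stride_le_m
  have := h.le_s
  omega

theorem stride_mul_n_le (h : L.Valid) : L.stride * L.n ≤ 2 * (L.m * L.m) := by
  refine Nat.le_of_mul_le_mul_right ?_ h.s_pos
  calc L.stride * L.n * L.s = L.stride * L.s * L.n := by ring
    _ ≤ (L.n + L.s) * L.n := Nat.mul_le_mul_right _ h.stride_mul_lt.le
    _ = L.n * L.n + L.s * L.n := by ring
    _ ≤ L.m * L.m * L.s + L.s * (L.m * L.m) :=
      Nat.add_le_add (h.sq_le.trans (Nat.mul_le_mul_left _ h.le_s)) (Nat.mul_le_mul_left _ h.n_le)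
    _ = _ := by ring

theorem n_le_mul_modulus (h : L.Valid) : L.n ≤ (L.height - L.stride) * L.modulus := by
  rw [height_sub_stride]
  exact le_ceilDiv_mul h.modulus_pos

theorem stride_mul_m_le (h : L.Valid) : L.stride * L.m ≤ 2 * L.n := by
  obtain ⟨c, hc⟩ := Nat.exists_eq_add_of_le h.stride_pos
  have hlt := h.stride_mul_lt
  have hmul : c * L.m ≤ c * L.s := Nat.mul_le_mul_left _ h.le_s
  have := h.le_n
  rw [hc, add_mul, one_mul] at hlt ⊢
  omega

theorem height_sub_mul_m_le (h : L.Valid) : (L.height - L.stride) * L.m ≤ 2 * L.n := by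
  have hlt : (L.height - L.stride) * L.modulus < L.n + L.modulus := by
    rw [height_sub_stride]
    exact ceilDiv_mul_lt h.one_le
  have hpos : 1 ≤ L.height - L.stride :=
    Nat.pos_of_mul_pos_right (h.one_le.trans h.n_le_mul_modulus)
  obtain ⟨c, hc⟩ := Nat.exists_eq_add_of_le hpos
  have hmul : c * L.m ≤ c * L.modulus := Nat.mul_le_mul_left _ h.m_le_modulus
  have := h.le_n
  rw [hc, add_mul, one_mul] at hlt ⊢
  omega

theorem stride_mul_height_le (h : L.Valid) : L.stride * L.height ≤ 8 * L.s := by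
  have hheight : L.height * L.m ≤ 4 * L.n := by
    have hsplit : L.height = L.height - L.stride + L.stride := by rw [height_sub_stride, height]
    have := h.height_sub_mul_m_le
    have := h.stride_mul_m_le
    rw [hsplit, add_mul]
    omega
  refine le_trans ?_ (Nat.mul_le_mul_left _ h.le_s)
  refine Nat.le_of_mul_le_mul_right ?_ (Nat.mul_pos h.m_pos h.m_pos)
  calc L.stride * L.height * (L.m * L.m) = L.stride * L.m * (L.height * L.m) := by ring
    _ ≤ 2 * L.n * (4 * L.n) := Nat.mul_le_mul h.stride_mul_m_le hheight
    _ = 8 * (L.n * L.n) := by ring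
    _ ≤ 8 * (L.m * L.m * L.m) := Nat.mul_le_mul_left _ h.sq_le
    _ = _ := by ring

theorem stride_mul_self_le (h : L.Valid) : L.stride * L.stride ≤ 4 * L.s := by
  refine le_trans ?_ (Nat.mul_le_mul_left _ h.le_s)
  refine Nat.le_of_mul_le_mul_right ?_ (Nat.mul_pos h.m_pos h.m_pos)
  calc L.stride * L.stride * (L.m * L.m) = L.stride * L.m * (L.stride * L.m) := by ring
    _ ≤ 2 * L.n * (2 * L.n) := Nat.mul_le_mul h.stride_mul_m_le h.stride_mul_m_le
    _ = 4 * (L.n * L.n) := by ring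
    _ ≤ 4 * (L.m * L.m * L.m) := Nat.mul_le_mul_left _ h.sq_le
    _ = _ := by ring

theorem stride_mul_self_le' (h : L.Valid) : L.stride * L.stride ≤ 8 * L.s :=
  h.stride_mul_self_le.trans (by omega)

theorem two_le_batch (h : L.Valid) : 2 ≤ L.batch := by
  have := h.stride_mul_self_le
  rw [batch, Nat.le_div_iff_mul_le (Nat.mul_pos h.stride_pos h.stride_pos)]
  omega

theorem stride_le_batches_mul (h : L.Valid) : L.stride ≤ L.batches * L.batch := by
  rw [mul_comm]
  exact le_smul_ceilDiv (zero_lt_two.trans_le h.two_le_batch)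

theorem div_stride_lt (h : L.Valid) {i : ℕ} (hi : i < L.n) : i / L.stride < L.s := by
  rw [Nat.div_lt_iff_lt_mul h.stride_pos, mul_comm]
  exact hi.trans_le h.le_stride_mul

theorem index_lt (h : L.Valid) {i j : ℕ} (hi : i < L.n) (hj : j < L.n) :
    i * L.n + j < L.m * L.m * L.m := mul_add_lt_of_mul_le hi hj h.sq_le

theorem height_offset_lt (h : L.Valid) {j : ℕ} (hj : j < L.n) :
    j / L.modulus + j % L.stride < L.height := by
  have hdiv : j / L.modulus < L.height - L.stride := by
    rw [Nat.div_lt_iff_lt_mul h.modulus_pos]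
    exact hj.trans_le h.n_le_mul_modulus
  have hmod := Nat.mod_lt j h.stride_pos
  generalize j / L.modulus = x at *
  omega

theorem coord0_lt (h : L.Valid) (st : ℕ) {i j : ℕ} (hi : i < L.n) (hj : j < L.n) :
    L.coord0 st i j < 8 * L.s := by
  have := h.le_s
  have := h.div_stride_lt hi
  have : (i * L.n + j) / (L.m * L.m) < L.m := by
    rw [Nat.div_lt_iff_lt_mul (Nat.mul_pos h.m_pos h.m_pos), ← mul_assoc]
    exact h.index_lt hi hj
  rw [coord0]
  split_ifs <;> omega

theorem coord1_lt (h : L.Valid) (st : ℕ) {i j : ℕ} (hj : j < L.n) :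
    L.coord1 st i j < 8 * L.s := by
  have hi := Nat.mod_lt i h.stride_pos
  rw [coord1]
  split_ifs
  · have : (i * L.n + j) / L.m % L.m < L.m := Nat.mod_lt _ h.m_pos
    have := h.le_s
    omega
  · exact mul_add_lt_of_mul_le hi (h.height_offset_lt hj) h.stride_mul_height_le
  · exact mul_add_lt_of_mul_le hi (Nat.mod_lt j h.stride_pos) h.stride_mul_self_le'

theorem coord2_lt (h : L.Valid) (st : ℕ) {i j : ℕ} (hj : j < L.n) :
    L.coord2 st i j < 8 * L.s := by
  have := h.le_s
  have := h.div_stride_lt hj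
  have := h.modulus_le
  have : (i * L.n + j) % L.m < L.m := Nat.mod_lt _ h.m_pos
  have := Nat.mod_lt j h.modulus_pos
  rw [coord2]
  split_ifs <;> omega

theorem pos_lt (h : L.Valid) (st : ℕ) {i j : ℕ} (hi : i < L.n) (hj : j < L.n) (a : Fin 3) :
    L.pos st i j a < 8 * L.s := by
  fin_cases a
  · exact h.coord0_lt st hi hj
  · exact h.coord1_lt st hj
  · exact h.coord2_lt st hj

theorem rowOfLine_bounds (h : L.Valid) {i j : ℕ} (hj : j < L.n) :
    (i * L.n + j) / L.m * L.m / L.n ≤ i ∧ i ≤ (i * L.n + j) / L.m * L.m / L.n + 1 := by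
  have hle := Nat.div_mul_le_self (i * L.n + j) L.m
  have hlt := Nat.lt_div_mul_add (a := i * L.n + j) h.m_pos
  have := h.le_n
  generalize (i * L.n + j) / L.m * L.m = x at *
  constructor
  · rw [← Nat.lt_succ_iff, Nat.div_lt_iff_lt_mul h.one_le, Nat.succ_mul]
    omega
  · rcases i with _ | i
    · exact Nat.zero_le _
    · rw [Nat.add_le_add_iff_right, Nat.le_div_iff_mul_le h.one_le]
      rw [add_mul] at hlt
      omega

theorem firstPlane_bounds (h : L.Valid) {i j : ℕ} (hj : j < L.n) :
    L.firstPlane (i / L.stride) ≤ (i * L.n + j) / (L.m * L.m) ∧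
      (i * L.n + j) / (L.m * L.m) ≤ L.firstPlane (i / L.stride) + 2 := by
  have hmm : 0 < L.m * L.m := Nat.mul_pos h.m_pos h.m_pos
  constructor
  · refine Nat.div_le_div_right ?_
    calc i / L.stride * L.stride * L.n ≤ i * L.n :=
          Nat.mul_le_mul_right _ (Nat.div_mul_le_self i L.stride)
      _ ≤ _ := Nat.le_add_right _ _
  · rw [← Nat.lt_succ_iff, Nat.div_lt_iff_lt_mul hmm, firstPlane]
    have hplane := Nat.lt_div_mul_add (a := i / L.stride * L.stride * L.n) hmm
    have hrow : (i + 1) * L.n ≤ (i / L.stride * L.stride + L.stride) * L.n :=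
      Nat.mul_le_mul_right _ (Nat.lt_div_mul_add (a := i) h.stride_pos)
    have := h.stride_mul_n_le
    nlinarith

theorem slot_lt (h : L.Valid) {i j : ℕ} (hj : j < L.n) : L.slot i j < 6 := by
  have := h.firstPlane_bounds (i := i) hj
  have := h.rowOfLine_bounds (i := i) hj
  rw [slot]
  omega

theorem lineAt_pos (h : L.Valid) {st i j : ℕ} (hj : j < L.n) (hst : st < 3) :
    L.lineAt st (L.slot i j) (L.pos st i j) = (i * L.n + j) / L.m := by
  have := h.firstPlane_bounds (i := i) hj
  have := h.rowOfLine_bounds (i := i) hj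
  rw [← lineIndex_mul_add, lineAt, pos]
  simp only [coord0, coord1, hst, if_true, Matrix.cons_val_zero, Matrix.cons_val_one]
  rw [Nat.mul_div_cancel_left _ (by norm_num)]
  congr 2
  split_ifs
  · omega
  · rw [slot]
    omega

theorem rowAt_pos (h : L.Valid) {st i j : ℕ} (hj : j < L.n) :
    L.rowAt st (L.slot i j) (L.pos st i j) = i := by
  rw [rowAt]
  split_ifs with hst1 hst3 hst5
  · rw [h.lineAt_pos hj (by omega)]
    simp only [pos, coord2, hst1, if_true, Matrix.cons_val]
    rw [Nat.mul_div_cancel_left _ (by norm_num), Nat.div_add_mod', mul_add_div_of_lt hj]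
  · have := h.rowOfLine_bounds (i := i) hj
    rw [h.lineAt_pos hj hst3, slot]
    omega
  · simp only [pos, coord0, coord1, Matrix.cons_val_zero, Matrix.cons_val_one]
    rw [if_neg (by omega), if_neg hst3, if_pos hst5, mul_add_div_of_lt (h.height_offset_lt hj),
      Nat.div_add_mod']
  · simp only [pos, coord0, coord1, Matrix.cons_val_zero, Matrix.cons_val_one]
    rw [if_neg (by omega), if_neg hst3, if_neg hst5,
      mul_add_div_of_lt (Nat.mod_lt j h.stride_pos), Nat.div_add_mod']

theorem mod_eq_of_add_eq_add {M l N j r : ℕ} (hr : r < M) (e : l + r = N + j) :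
    (j % M + N + (M - 1) * l) % M = r := by
  obtain ⟨K, rfl⟩ : ∃ K, M = K + 1 := ⟨M - 1, by omega⟩
  rw [add_assoc, Nat.mod_add_mod, Nat.add_sub_cancel,
    show j + (N + K * l) = r + (K + 1) * l by linarith, Nat.add_mul_mod_self_left,
    Nat.mod_eq_of_lt hr]

theorem colAt_pos (h : L.Valid) {st i j : ℕ} (hj : j < L.n) :
    L.colAt st (L.slot i j) (L.pos st i j) = j := by
  rw [colAt]
  split_ifs with hst1 hst3 hst4 hst5
  · rw [h.lineAt_pos hj (by omega)]
    simp only [pos, coord2, hst1, if_true, Matrix.cons_val]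
    rw [Nat.mul_div_cancel_left _ (by norm_num), Nat.div_add_mod', Nat.mul_add_mod_self_right,
      Nat.mod_eq_of_lt hj]
  · rw [h.lineAt_pos hj hst3, h.rowAt_pos hj]
    simp only [pos, coord2, Matrix.cons_val]
    have hline := Nat.div_add_mod' (i * L.n + j) L.m
    have hlt := (Nat.mod_lt (i * L.n + j) h.m_pos).trans_le h.m_le_modulus
    rw [if_neg hst1, if_pos (by omega), mod_eq_of_add_eq_add hlt hline, hline]
    omega
  · simp only [pos, coord1, coord2, Matrix.cons_val]
    rw [if_neg hst1, if_pos hst4, if_neg hst3, if_pos (by omega), Nat.mul_add_mod_self_right,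
      Nat.mod_eq_of_lt (h.height_offset_lt hj), Nat.mod_mod_of_dvd _ stride_dvd_modulus,
      Nat.add_sub_cancel, Nat.div_add_mod']
  · simp only [pos, coord1, coord2, Matrix.cons_val]
    rw [if_neg hst1, if_neg hst4, if_neg hst3, if_pos hst5, Nat.mul_add_mod_self_right,
      Nat.mod_eq_of_lt (h.height_offset_lt hj), Nat.div_div_eq_div_mul,
      mul_comm L.stride (L.modulus / L.stride), modulus_div_mul, Nat.add_sub_cancel_left,
      Nat.div_add_mod']
  · simp only [pos, coord1, coord2, Matrix.cons_val]
    rw [if_neg hst1, if_neg hst4, if_neg hst3, if_neg hst5, Nat.mul_add_mod_self_right,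
      Nat.mod_mod, Nat.div_add_mod']

end Valid

theorem update_pos_succ {st : ℕ} (hst : st < 5) (i j : ℕ) :
    Function.update (L.pos (st + 1) i j) (axis st) (L.pos st i j (axis st)) = L.pos st i j := by
  interval_cases st <;> funext a <;> fin_cases a <;>
    simp [axis, pos, coord0, coord1, coord2, Function.update]

theorem update_pos {st : ℕ} (hst : st < 5) (i j : ℕ) :
    Function.update (L.pos st i j) (axis st) (L.pos (st + 1) i j (axis st)) =
      L.pos (st + 1) i j := by
  rw [← update_pos_succ hst i j, Function.update_idem, Function.update_eq_self]

end Layout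

/-! ### The computation of a cell -/

/-- The operations that distinguish the path problems: how the values of consecutive paths are
combined, whether large values are preferred, the values of missing edges and of empty paths, and
whether the input is an adjacency matrix. -/
structure PathAlgebra : Type where
  mul : WtOp
  maximize : Bool
  worst : WtConst
  unit : WtConst
  fromAdjacency : Bool

namespace PathAlgebra

variable (A : PathAlgebra)

/-- The value `x` is preferred to `y`. -/
def Better (x y : EReal) : Prop := if A.maximize then y < x else x < y

/-- The matrix entry at the beginning of the computation, made from an entry of the input. -/
def initialEntry (i j : ℕ) (x : Word) : Word :=
  open Classical in
  if i = j then ⟨A.unit.eval, 0⟩ else if A.fromAdjacency ∧ x.wt ≤ 0 then ⟨A.worst.eval, 0⟩ else x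

end PathAlgebra

section Consume

variable (A : PathAlgebra) (L : Layout)

/-- The effect of the `k`-th word of a sweep on a store, in the stage `st` of the routing of the
entries with slot `κ` from their input positions to their home positions. -/
def consumeIn (κ st : ℕ) (p : Pos) (k : ℕ) (src : Fin 3 → Word) (l : Store) : Store :=
  let i := L.rowAt (st + 1) κ p
  let j := L.colAt (st + 1) κ p
  let w := src (Layout.axis st)
  if k = L.pos st i j (Layout.axis st) then
    if st < 4 then { l with transit := w }
    else if L.slot i j = κ then { l with entry := A.initialEntry i j w }
    else l
  else l

/-- The counterpart of `consumeIn` for the way back, on which the stages are passed in descending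
order. -/
def consumeOut (κ st : ℕ) (p : Pos) (k : ℕ) (src : Fin 3 → Word) (l : Store) : Store :=
  let i := L.rowAt st κ p
  let j := L.colAt st κ p
  let w := src (Layout.axis st)
  if k = L.pos (st + 1) i j (Layout.axis st) then
    if 0 < st then { l with transit := w }
    else if L.slot i j = κ then { l with io := w }
    else l
  else l

/-- The residue class of the intermediate vertices that a layer treats in the multiplication round
`e`. -/
def midClass (e : ℕ) (p : Pos) : ℕ := e * L.batch + p 1 / (L.stride * L.stride)

/-- The effect of the `k`-th word of a sweep that brings the factors of block products into
position. -/
def consumeFetch (e : ℕ) (p : Pos) (k : ℕ) (src : Fin 3 → Word) (l : Store) : Store :=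
  open Classical in
  { l with
    fst := if k = p 1 % (L.stride * L.stride) / L.stride * L.stride + midClass L e p then src 1
      else l.fst
    snd := if k = midClass L e p * L.stride + p 1 % L.stride then src 1 else l.snd
    prod := if e = 0 then ⟨A.worst.eval, 0⟩ else l.prod }

/-- The effect of the `k`-th word of a sweep that computes block products. The number that is
recorded is the intermediate vertex plus `1`, since `0` stands for an edge. -/
def consumeMul (e : ℕ) (p : Pos) (k : ℕ) (src : Fin 3 → Word) (l : Store) : Store :=
  open Classical in
  let mid := k * L.stride + midClass L e p
  let x := A.mul.eval (src 2).wt (src 0).wt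
  if midClass L e p < L.stride ∧ mid < L.n ∧ A.Better x l.prod.wt then
    { l with prod := ⟨x, mid + 1⟩ }
  else l

/-- The effect of the `k`-th word of a sweep that combines the results of the layers. -/
def consumeReduce (p : Pos) (k : ℕ) (src : Fin 3 → Word) (l : Store) : Store :=
  open Classical in
  if k % (L.stride * L.stride) = p 1 ∧ A.Better (src 1).wt l.entry.wt then { l with entry := src 1 }
  else l

/-- The effect of the `k`-th word of the sweep number `f` of a matrix product. -/
def consumeProd (f : ℕ) (p : Pos) (k : ℕ) (src : Fin 3 → Word) (l : Store) : Store :=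
  if f = 2 * L.batches then consumeReduce A L p k src l
  else if f % 2 = 0 then consumeFetch A L (f / 2) p k src l
  else consumeMul A L (f / 2) p k src l

/-- The words that are sent in the sweep number `f` of a matrix product. -/
def loadProd (f : ℕ) (a : Fin 3) (l : Store) : Word :=
  if f = 2 * L.batches then l.prod else if f % 2 = 0 then l.entry
  else if a = 2 then l.fst else l.snd

/-- The effect of the `k`-th word of the sweep `ρ` of a computation with `q` matrix products: the
sweep `0` reads the input, the next `30` move the six slots home in five stages each, and the last
`30` move them back. -/
def consumeRound (q ρ : ℕ) (inp : EReal) (p : Pos) (k : ℕ) (src : Fin 3 → Word) (l : Store) :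
    Store :=
  if ρ = 0 then { l with io := ⟨inp, 0⟩ }
  else if ρ < 31 then consumeIn A L ((ρ - 1) / 5) ((ρ - 1) % 5) p k src l
  else if ρ < 31 + q * L.period then consumeProd A L ((ρ - 31) % L.period) p k src l
  else consumeOut L ((ρ - (31 + q * L.period)) / 5) (4 - (ρ - (31 + q * L.period)) % 5) p k src l

/-- The words that are sent in the sweep `ρ` of a computation with `q` matrix products. -/
def loadRound (q ρ : ℕ) (a : Fin 3) (l : Store) : Word :=
  if ρ < 31 then (if (ρ - 1) % 5 = 0 then l.io else l.transit)
  else if ρ < 31 + q * L.period then loadProd L ((ρ - 31) % L.period) a l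
  else (if (ρ - (31 + q * L.period)) % 5 = 0 then l.entry else l.transit)

/-- The number of sweeps of a computation with `q` matrix products. -/
def rounds (q : ℕ) : ℕ := 61 + q * L.period

/-- The new memory of a cell after the step `t`. -/
def cellNext (q t : ℕ) (inp : EReal) (p : Pos) (c : Cell) (up dn : Fin 3 → Word) : Cell :=
  sweepCell (8 * L.s) (t % (32 * L.s)) (loadRound L q (t / (32 * L.s)))
    (consumeRound A L q (t / (32 * L.s)) inp p) p c up dn

end Consume

/-! ### The computation of a cell is given by expressions -/

section Expressible

variable {a b : ℕ}

/-- A word-valued function of the view that is given by expressions. -/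
def IsWordExpr (f : View a b → Word) : Prop :=
  IsWtExpr (fun v => (f v).wt) ∧ IsNumExpr fun v => (f v).num

/-- A store-valued function of the view that is given by expressions. -/
structure IsStoreExpr (f : View a b → Store) : Prop where
  io : IsWordExpr fun v => (f v).io
  transit : IsWordExpr fun v => (f v).transit
  entry : IsWordExpr fun v => (f v).entry
  fst : IsWordExpr fun v => (f v).fst
  snd : IsWordExpr fun v => (f v).snd
  prod : IsWordExpr fun v => (f v).prod

/-- A cell-valued function of the view that is given by expressions. -/
structure IsCellExpr (f : View a b → Cell) : Prop where
  store : IsStoreExpr fun v => (f v).store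
  left : ∀ i, IsWordExpr fun v => (f v).left i
  right : ∀ i, IsWordExpr fun v => (f v).right i

/-- A layout-valued function of the view that is given by expressions. -/
structure IsLayoutExpr (L : View a b → Layout) : Prop where
  n : IsNumExpr fun v => (L v).n
  s : IsNumExpr fun v => (L v).s
  m : IsNumExpr fun v => (L v).m

/-- A position-valued function of the view that is given by expressions. -/
def IsPosExpr (p : View a b → Pos) : Prop := ∀ i, IsNumExpr fun v => p v i

theorem IsWordExpr.mk {f : View a b → EReal} {g : View a b → ℕ} (hf : IsWtExpr f)
    (hg : IsNumExpr g) : IsWordExpr fun v => ⟨f v, g v⟩ := ⟨hf, hg⟩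

theorem IsWordExpr.ite {p : View a b → Prop} [∀ v, Decidable (p v)] {f g : View a b → Word}
    (hp : IsTestable p) (hf : IsWordExpr f) (hg : IsWordExpr g) :
    IsWordExpr fun v => if p v then f v else g v := by
  unfold IsWordExpr
  simp only [apply_ite Word.wt, apply_ite Word.num]
  exact ⟨.ite hp hf.1 hg.1, .ite hp hf.2 hg.2⟩

theorem IsStoreExpr.ite {p : View a b → Prop} [∀ v, Decidable (p v)] {f g : View a b → Store}
    (hp : IsTestable p) (hf : IsStoreExpr f) (hg : IsStoreExpr g) :
    IsStoreExpr fun v => if p v then f v else g v := by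
  constructor
  · simpa only [apply_ite Store.io] using hf.io.ite hp hg.io
  · simpa only [apply_ite Store.transit] using hf.transit.ite hp hg.transit
  · simpa only [apply_ite Store.entry] using hf.entry.ite hp hg.entry
  · simpa only [apply_ite Store.fst] using hf.fst.ite hp hg.fst
  · simpa only [apply_ite Store.snd] using hf.snd.ite hp hg.snd
  · simpa only [apply_ite Store.prod] using hf.prod.ite hp hg.prod

section Axis

variable {st : View a b → ℕ}

theorem IsNumExpr.axis {f : View a b → Fin 3 → ℕ} (hst : IsNumExpr st)
    (hf : ∀ c, IsNumExpr fun v => f v c) : IsNumExpr fun v => f v (Layout.axis (st v)) := by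
  simp only [Layout.axis, apply_ite (f _)]
  exact .ite (.eq hst (.const 0)) (hf 2) (.ite (.eq hst (.const 1)) (hf 0)
    (.ite (.eq hst (.const 3)) (hf 2) (hf 1)))

theorem IsWordExpr.axis {f : View a b → Fin 3 → Word} (hst : IsNumExpr st)
    (hf : ∀ c, IsWordExpr fun v => f v c) : IsWordExpr fun v => f v (Layout.axis (st v)) := by
  simp only [Layout.axis, apply_ite (f _)]
  exact .ite (.eq hst (.const 0)) (hf 2) (.ite (.eq hst (.const 1)) (hf 0)
    (.ite (.eq hst (.const 3)) (hf 2) (hf 1)))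

end Axis

namespace IsLayoutExpr

variable {L : View a b → Layout} {i j st κ e : View a b → ℕ} {p : View a b → Pos}

theorem stride (hL : IsLayoutExpr L) : IsNumExpr fun v => (L v).stride :=
  .div (.sub (.add hL.n hL.s) (.const 1)) hL.s

theorem modulus (hL : IsLayoutExpr L) : IsNumExpr fun v => (L v).modulus :=
  .mul hL.stride (.div (.sub (.add hL.m hL.stride) (.const 1)) hL.stride)

theorem height (hL : IsLayoutExpr L) : IsNumExpr fun v => (L v).height :=
  .add (.div (.sub (.add hL.n hL.modulus) (.const 1)) hL.modulus) hL.stride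

theorem batch (hL : IsLayoutExpr L) : IsNumExpr fun v => (L v).batch :=
  .div (.mul (.const 8) hL.s) (.mul hL.stride hL.stride)

theorem batches (hL : IsLayoutExpr L) : IsNumExpr fun v => (L v).batches :=
  .div (.sub (.add hL.stride hL.batch) (.const 1)) hL.batch

theorem period (hL : IsLayoutExpr L) : IsNumExpr fun v => (L v).period :=
  .add (.mul (.const 2) hL.batches) (.const 1)

theorem firstPlane (hL : IsLayoutExpr L) (hi : IsNumExpr i) :
    IsNumExpr fun v => (L v).firstPlane (i v) :=
  .div (.mul (.mul hi hL.stride) hL.n) (.mul hL.m hL.m)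

theorem index (hL : IsLayoutExpr L) (hi : IsNumExpr i) (hj : IsNumExpr j) :
    IsNumExpr fun v => i v * (L v).n + j v := .add (.mul hi hL.n) hj

theorem coord0 (hL : IsLayoutExpr L) (hst : IsNumExpr st) (hi : IsNumExpr i) (hj : IsNumExpr j) :
    IsNumExpr fun v => (L v).coord0 (st v) (i v) (j v) :=
  .ite (.lt hst (.const 2)) (.mul (.const 8) (.div (hL.index hi hj) (.mul hL.m hL.m)))
    (.div hi hL.stride)

theorem coord1 (hL : IsLayoutExpr L) (hst : IsNumExpr st) (hi : IsNumExpr i) (hj : IsNumExpr j) :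
    IsNumExpr fun v => (L v).coord1 (st v) (i v) (j v) :=
  .ite (.lt hst (.const 3)) (.mul (.const 8) (.mod (.div (hL.index hi hj) hL.m) hL.m))
    (.ite (.lt hst (.const 5))
      (.add (.mul (.mod hi hL.stride) hL.height) (.add (.div hj hL.modulus) (.mod hj hL.stride)))
      (.add (.mul (.mod hi hL.stride) hL.stride) (.mod hj hL.stride)))

theorem coord2 (hL : IsLayoutExpr L) (hst : IsNumExpr st) (hi : IsNumExpr i) (hj : IsNumExpr j) :
    IsNumExpr fun v => (L v).coord2 (st v) (i v) (j v) :=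
  .ite (.lt hst (.const 1)) (.mul (.const 8) (.mod (hL.index hi hj) hL.m))
    (.ite (.lt hst (.const 4)) (.mod hj hL.modulus) (.div hj hL.stride))

theorem pos (hL : IsLayoutExpr L) (hst : IsNumExpr st) (hi : IsNumExpr i) (hj : IsNumExpr j) :
    IsPosExpr fun v => (L v).pos (st v) (i v) (j v) := by
  intro c
  fin_cases c
  · exact hL.coord0 hst hi hj
  · exact hL.coord1 hst hi hj
  · exact hL.coord2 hst hi hj

theorem slot (hL : IsLayoutExpr L) (hi : IsNumExpr i) (hj : IsNumExpr j) :
    IsNumExpr fun v => (L v).slot (i v) (j v) :=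
  .add (.mul (.const 2) (.sub (.div (hL.index hi hj) (.mul hL.m hL.m))
      (hL.firstPlane (.div hi hL.stride))))
    (.sub hi (.div (.mul (.div (hL.index hi hj) hL.m) hL.m) hL.n))

theorem lineAt (hL : IsLayoutExpr L) (hst : IsNumExpr st) (hκ : IsNumExpr κ) (hp : IsPosExpr p) :
    IsNumExpr fun v => (L v).lineAt (st v) (κ v) (p v) :=
  .add (.mul (.ite (.lt hst (.const 2)) (.div (hp 0) (.const 8))
    (.add (hL.firstPlane (hp 0)) (.div hκ (.const 2)))) hL.m) (.div (hp 1) (.const 8))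

theorem rowAt (hL : IsLayoutExpr L) (hst : IsNumExpr st) (hκ : IsNumExpr κ) (hp : IsPosExpr p) :
    IsNumExpr fun v => (L v).rowAt (st v) (κ v) (p v) :=
  .ite (.lt hst (.const 1)) (.div (.add (.mul (hL.lineAt hst hκ hp) hL.m)
      (.div (hp 2) (.const 8))) hL.n)
    (.ite (.lt hst (.const 3)) (.add (.div (.mul (hL.lineAt hst hκ hp) hL.m) hL.n)
      (.mod hκ (.const 2)))
    (.ite (.lt hst (.const 5)) (.add (.mul (hp 0) hL.stride) (.div (hp 1) hL.height))
      (.add (.mul (hp 0) hL.stride) (.div (hp 1) hL.stride))))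

theorem colAt (hL : IsLayoutExpr L) (hst : IsNumExpr st) (hκ : IsNumExpr κ) (hp : IsPosExpr p) :
    IsNumExpr fun v => (L v).colAt (st v) (κ v) (p v) :=
  .ite (.lt hst (.const 1)) (.mod (.add (.mul (hL.lineAt hst hκ hp) hL.m)
      (.div (hp 2) (.const 8))) hL.n)
    (.ite (.lt hst (.const 3)) (.sub (.add (.mul (hL.lineAt hst hκ hp) hL.m)
      (.mod (.add (.add (hp 2) (.mul (hL.rowAt hst hκ hp) hL.n))
        (.mul (.sub hL.modulus (.const 1)) (.mul (hL.lineAt hst hκ hp) hL.m))) hL.modulus))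
      (.mul (hL.rowAt hst hκ hp) hL.n))
    (.ite (.lt hst (.const 4))
      (.add (.mul (.sub (.mod (hp 1) hL.height) (.mod (hp 2) hL.stride)) hL.modulus) (hp 2))
    (.ite (.lt hst (.const 5)) (.add (.mul (hp 2) hL.stride)
      (.sub (.mod (hp 1) hL.height) (.div (hp 2) (.div hL.modulus hL.stride))))
      (.add (.mul (hp 2) hL.stride) (.mod (hp 1) hL.stride)))))

theorem midClass (hL : IsLayoutExpr L) (he : IsNumExpr e) (hp : IsPosExpr p) :
    IsNumExpr fun v => midClass (L v) (e v) (p v) :=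
  .add (.mul he hL.batch) (.div (hp 1) (.mul hL.stride hL.stride))

theorem rounds (hL : IsLayoutExpr L) (hi : IsNumExpr i) : IsNumExpr fun v => rounds (L v) (i v) :=
  .add (.const 61) (.mul hi hL.period)

end IsLayoutExpr

theorem IsTestable.better (A : PathAlgebra) {x y : View a b → EReal} (hx : IsWtExpr x)
    (hy : IsWtExpr y) : IsTestable fun v => A.Better (x v) (y v) := by
  unfold PathAlgebra.Better
  cases A.maximize
  · simpa using IsTestable.wt_lt hx hy
  · simpa using IsTestable.wt_lt hy hx

theorem IsWordExpr.initialEntry (A : PathAlgebra) {i j : View a b → ℕ} {x : View a b → Word}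
    (hi : IsNumExpr i) (hj : IsNumExpr j) (hx : IsWordExpr x) :
    IsWordExpr fun v => A.initialEntry (i v) (j v) (x v) := by
  unfold PathAlgebra.initialEntry
  classical
  exact .ite (.eq hi hj) (.mk (.const _) (.const 0))
    (.ite (.and (.const _) (.wt_le hx.1 .zero)) (.mk (.const _) (.const 0)) hx)

section Consume

variable {L : View a b → Layout} {κ st e f k q ρ : View a b → ℕ} {p : View a b → Pos}
  {src : View a b → Fin 3 → Word} {l : View a b → Store} {inp : View a b → EReal}

namespace IsStoreExpr

theorem consumeIn (A : PathAlgebra) (hL : IsLayoutExpr L) (hκ : IsNumExpr κ) (hst : IsNumExpr st)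
    (hp : IsPosExpr p) (hk : IsNumExpr k) (hs : ∀ c, IsWordExpr fun v => src v c)
    (hl : IsStoreExpr l) :
    IsStoreExpr fun v => consumeIn A (L v) (κ v) (st v) (p v) (k v) (src v) (l v) := by
  have hst' := hst.add (.const 1)
  have hi := hL.rowAt hst' hκ hp
  have hj := hL.colAt hst' hκ hp
  have hw := IsWordExpr.axis hst hs
  exact .ite (.eq hk (.axis hst (hL.pos hst hi hj)))
    (.ite (.lt hst (.const 4)) ⟨hl.io, hw, hl.entry, hl.fst, hl.snd, hl.prod⟩
      (.ite (.eq (hL.slot hi hj) hκ)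
        ⟨hl.io, hl.transit, .initialEntry A hi hj hw, hl.fst, hl.snd, hl.prod⟩ hl)) hl

theorem consumeOut (hL : IsLayoutExpr L) (hκ : IsNumExpr κ) (hst : IsNumExpr st)
    (hp : IsPosExpr p) (hk : IsNumExpr k) (hs : ∀ c, IsWordExpr fun v => src v c)
    (hl : IsStoreExpr l) :
    IsStoreExpr fun v => consumeOut (L v) (κ v) (st v) (p v) (k v) (src v) (l v) := by
  have hi := hL.rowAt hst hκ hp
  have hj := hL.colAt hst hκ hp
  have hw := IsWordExpr.axis hst hs
  exact .ite (.eq hk (.axis hst (hL.pos (hst.add (.const 1)) hi hj)))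
    (.ite (.lt (.const 0) hst) ⟨hl.io, hw, hl.entry, hl.fst, hl.snd, hl.prod⟩
      (.ite (.eq (hL.slot hi hj) hκ)
        ⟨hw, hl.transit, hl.entry, hl.fst, hl.snd, hl.prod⟩ hl)) hl

theorem consumeFetch (A : PathAlgebra) (hL : IsLayoutExpr L) (he : IsNumExpr e) (hp : IsPosExpr p)
    (hk : IsNumExpr k) (hs : ∀ c, IsWordExpr fun v => src v c) (hl : IsStoreExpr l) :
    IsStoreExpr fun v => consumeFetch A (L v) (e v) (p v) (k v) (src v) (l v) := by
  have hmid := hL.midClass he hp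
  have hrow := ((hp 1).mod (hL.stride.mul hL.stride)).div hL.stride
  have hcol := (hp 1).mod hL.stride
  exact ⟨hl.io, hl.transit, hl.entry,
    .ite (.eq hk ((hrow.mul hL.stride).add hmid)) (hs 1) hl.fst,
    .ite (.eq hk ((hmid.mul hL.stride).add hcol)) (hs 1) hl.snd,
    .ite (.eq he (.const 0)) (.mk (.const _) (.const 0)) hl.prod⟩

theorem consumeMul (A : PathAlgebra) (hL : IsLayoutExpr L) (he : IsNumExpr e) (hp : IsPosExpr p)
    (hk : IsNumExpr k) (hs : ∀ c, IsWordExpr fun v => src v c) (hl : IsStoreExpr l) :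
    IsStoreExpr fun v => consumeMul A (L v) (e v) (p v) (k v) (src v) (l v) := by
  classical
  have hclass := hL.midClass he hp
  have hmid := (hk.mul hL.stride).add hclass
  have hx : IsWtExpr fun v => A.mul.eval (src v 2).wt (src v 0).wt := .op _ (hs 2).1 (hs 0).1
  exact .ite (.and (.lt hclass hL.stride) (.and (.lt hmid hL.n) (.better A hx hl.prod.1)))
    ⟨hl.io, hl.transit, hl.entry, hl.fst, hl.snd, .mk hx (hmid.add (.const 1))⟩ hl

theorem consumeReduce (A : PathAlgebra) (hL : IsLayoutExpr L) (hp : IsPosExpr p)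
    (hk : IsNumExpr k) (hs : ∀ c, IsWordExpr fun v => src v c) (hl : IsStoreExpr l) :
    IsStoreExpr fun v => consumeReduce A (L v) (p v) (k v) (src v) (l v) := by
  classical
  exact .ite (.and (.eq (hk.mod (hL.stride.mul hL.stride)) (hp 1)) (.better A (hs 1).1 hl.entry.1))
    ⟨hl.io, hl.transit, hs 1, hl.fst, hl.snd, hl.prod⟩ hl

theorem consumeProd (A : PathAlgebra) (hL : IsLayoutExpr L) (hf : IsNumExpr f) (hp : IsPosExpr p)
    (hk : IsNumExpr k) (hs : ∀ c, IsWordExpr fun v => src v c) (hl : IsStoreExpr l) :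
    IsStoreExpr fun v => consumeProd A (L v) (f v) (p v) (k v) (src v) (l v) := by
  have he := hf.div (.const 2)
  exact .ite (.eq hf ((IsNumExpr.const 2).mul hL.batches)) (.consumeReduce A hL hp hk hs hl)
    (.ite (.eq (hf.mod (.const 2)) (.const 0)) (.consumeFetch A hL he hp hk hs hl)
      (.consumeMul A hL he hp hk hs hl))

theorem consumeRound (A : PathAlgebra) (hL : IsLayoutExpr L) (hq : IsNumExpr q)
    (hρ : IsNumExpr ρ) (hinp : IsWtExpr inp) (hp : IsPosExpr p) (hk : IsNumExpr k)
    (hs : ∀ c, IsWordExpr fun v => src v c) (hl : IsStoreExpr l) :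
    IsStoreExpr fun v => consumeRound A (L v) (q v) (ρ v) (inp v) (p v) (k v) (src v) (l v) := by
  have hin := hρ.sub (.const 1)
  have hend := (IsNumExpr.const 31).add (hq.mul hL.period)
  have hout := hρ.sub hend
  exact .ite (.eq hρ (.const 0))
      ⟨.mk hinp (.const 0), hl.transit, hl.entry, hl.fst, hl.snd, hl.prod⟩
    (.ite (.lt hρ (.const 31))
      (.consumeIn A hL (hin.div (.const 5)) (hin.mod (.const 5)) hp hk hs hl)
    (.ite (.lt hρ hend) (.consumeProd A hL ((hρ.sub (.const 31)).mod hL.period) hp hk hs hl)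
      (.consumeOut hL (hout.div (.const 5)) ((IsNumExpr.const 4).sub (hout.mod (.const 5))) hp hk
        hs hl)))

end IsStoreExpr

theorem IsWordExpr.loadProd (hL : IsLayoutExpr L) (hf : IsNumExpr f) (c : Fin 3)
    (hl : IsStoreExpr l) : IsWordExpr fun v => loadProd (L v) (f v) c (l v) :=
  .ite (.eq hf ((IsNumExpr.const 2).mul hL.batches)) hl.prod
    (.ite (.eq (hf.mod (.const 2)) (.const 0)) hl.entry (.ite (.const _) hl.fst hl.snd))

theorem IsWordExpr.loadRound (hL : IsLayoutExpr L) (hq : IsNumExpr q) (hρ : IsNumExpr ρ)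
    (c : Fin 3) (hl : IsStoreExpr l) :
    IsWordExpr fun v => loadRound (L v) (q v) (ρ v) c (l v) := by
  have hin := hρ.sub (.const 1)
  have hend := (IsNumExpr.const 31).add (hq.mul hL.period)
  have hout := hρ.sub hend
  exact .ite (.lt hρ (.const 31)) (.ite (.eq (hin.mod (.const 5)) (.const 0)) hl.io hl.transit)
    (.ite (.lt hρ hend) (.loadProd hL ((hρ.sub (.const 31)).mod hL.period) c hl)
      (.ite (.eq (hout.mod (.const 5)) (.const 0)) hl.entry hl.transit))

theorem IsCellExpr.cellNext (A : PathAlgebra) {t : View a b → ℕ} {c : View a b → Cell}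
    {up dn : View a b → Fin 3 → Word} (hL : IsLayoutExpr L) (hq : IsNumExpr q) (ht : IsNumExpr t)
    (hinp : IsWtExpr inp) (hp : IsPosExpr p) (hc : IsCellExpr c)
    (hup : ∀ i, IsWordExpr fun v => up v i) (hdn : ∀ i, IsWordExpr fun v => dn v i) :
    IsCellExpr fun v => cellNext A (L v) (q v) (t v) (inp v) (p v) (c v) (up v) (dn v) := by
  have hlen := (IsNumExpr.const 32).mul hL.s
  have hρ := ht.div hlen
  have hτ := ht.mod hlen
  have hsum : IsNumExpr fun v => (p v).sum := ((hp 0).add (hp 1)).add (hp 2)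
  have hstart := hsum.add (.const 2)
  exact {
    store := .ite (.and (.le hstart hτ) (.lt hτ (hstart.add ((IsNumExpr.const 8).mul hL.s))))
      (.consumeRound A hL hq hρ hinp hp (hτ.sub hstart) hc.right hc.store) hc.store
    left := fun i => .ite (.eq (hτ.add (hp i)) hsum) (.loadRound hL hq hρ i hc.store) (hup i)
    right := fun i => .ite (.eq (hp i) (.const 0)) (hc.left i) (hdn i) }

end Consume

end Expressible

/-! ### The program -/

/-- The names of the words of a cell: those of its store, and its two streams for each axis. -/
abbrev CellReg : Type := Fin 6 ⊕ Fin 3 ⊕ Fin 3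

namespace Cell

/-- The word of a cell with a given name. -/
def get (c : Cell) : CellReg → Word
  | .inl r => (![c.store.io, c.store.transit, c.store.entry, c.store.fst, c.store.snd,
      c.store.prod] : Fin 6 → Word) r
  | .inr (.inl a) => c.left a
  | .inr (.inr a) => c.right a

/-- The cell with given words. -/
def ofWords (f : CellReg → Word) : Cell where
  store := ⟨f (.inl 0), f (.inl 1), f (.inl 2), f (.inl 3), f (.inl 4), f (.inl 5)⟩
  left a := f (.inr (.inl a))
  right a := f (.inr (.inr a))

/-- The cell all of whose words are blank. -/
def blank : Cell := ofWords fun _ => Word.blank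

theorem ofWords_get (c : Cell) : ofWords c.get = c := rfl

theorem get_induction {C : Word → Prop} {c : Cell} (hio : C c.store.io)
    (htransit : C c.store.transit) (hentry : C c.store.entry) (hfst : C c.store.fst)
    (hsnd : C c.store.snd) (hprod : C c.store.prod) (hleft : ∀ a, C (c.left a))
    (hright : ∀ a, C (c.right a)) : ∀ r, C (c.get r)
  | .inl r => by
    fin_cases r
    exacts [hio, htransit, hentry, hfst, hsnd, hprod]
  | .inr (.inl a) => hleft a
  | .inr (.inr a) => hright a

theorem get_blank (r : CellReg) : blank.get r = Word.blank :=
  get_induction (C := (· = Word.blank)) rfl rfl rfl rfl rfl rfl (fun _ => rfl) (fun _ => rfl) r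

end Cell

/-- The place of a cell within its processor: each processor simulates `8 ^ 3` cells. -/
abbrev Offset : Type := Fin 3 → Fin 8

/-- The names of the words of the cells of a processor. -/
abbrev DataReg : Type := Offset × CellReg

/-- The number of words of the cells of a processor. -/
def dataCard : ℕ := Fintype.card DataReg

/-- The numbering of the words of the cells of a processor. -/
def dataEquiv : DataReg ≃ Fin dataCard := Fintype.equivFin DataReg

attribute [irreducible] dataCard dataEquiv

/-- The number registers of a processor: eleven scalar registers, followed by the numbers of the
words of its cells. The scalars from `7` on are the time, the side of the input cube, the number `q`
of matrix products, and `2 ^ q - 1`. -/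
def numIndex : Fin 11 ⊕ DataReg ≃ Fin (dataCard + 4 + 7) :=
  ((Equiv.refl _).sumCongr dataEquiv).trans (finSumFinEquiv.trans (finCongr (by omega)))

/-- The weight registers of a processor: that of the input and output, followed by the weights of
the words of its cells. -/
def wtIndex : Option DataReg ≃ Fin (dataCard + 1) :=
  dataEquiv.optionCongr.trans (finSuccEquiv _).symm

theorem val_numIndex_inl (r : Fin 11) : (numIndex (.inl r) : ℕ) = r := rfl

theorem le_val_numIndex_inr (i : DataReg) : 11 ≤ (numIndex (.inr i) : ℕ) := Nat.le_add_right _ _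

theorem wtIndex_none : wtIndex none = 0 := rfl

/-- The view of a processor that runs the program. -/
abbrev PView : Type := View (dataCard + 4 + 7) (dataCard + 1)

/-- A scalar register of the processor itself. -/
def scalar (r : Fin 11) (v : PView) : ℕ := (v none).num (numIndex (.inl r))

/-- A coordinate of the processor. -/
def viewCoord (a : Fin 3) (v : PView) : ℕ := scalar ⟨a + 2, by omega⟩ v

/-- The time. -/
def viewTime (v : PView) : ℕ := scalar 7 v

/-- The parameters of the layout in the view of a processor. -/
def viewLayout (v : PView) : Layout := ⟨scalar 0 v, scalar 1 v, scalar 8 v⟩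

/-- The number of matrix products in the view of a processor. -/
def viewProducts (v : PView) : ℕ := scalar 9 v

/-- The register that holds `2 ^ q - 1`, where `q` is the number of matrix products. -/
def viewPower (v : PView) : ℕ := scalar 10 v

/-- A word of a cell in the view of a processor. -/
def viewWord (src : Option Dir) (i : DataReg) (v : PView) : Word :=
  ⟨(v src).wt (wtIndex (some i)), (v src).num (numIndex (.inr i))⟩

/-- The position of a cell in the view of its processor. -/
def viewPos (o : Offset) (v : PView) : Pos := fun a => 8 * viewCoord a v + o a

/-- The input of a cell in the view of its processor. -/
def viewInput (o : Offset) (v : PView) : EReal :=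
  if o = 0 then (v none).wt (wtIndex none) else 0

/-- The word that comes to a cell from the next higher cell. -/
def viewUp (o : Offset) (v : PView) (a : Fin 3) : Word :=
  if h : (o a : ℕ) + 1 < 8 then
    viewWord none (Function.update o a ⟨o a + 1, h⟩, .inr (.inl a)) v
  else viewWord (some (a, true)) (Function.update o a 0, .inr (.inl a)) v

/-- The word that comes to a cell from the next lower cell. -/
def viewDown (o : Offset) (v : PView) (a : Fin 3) : Word :=
  if 0 < (o a : ℕ) then
    viewWord none (Function.update o a ⟨o a - 1, by omega⟩, .inr (.inr a)) v
  else viewWord (some (a, false)) (Function.update o a 7, .inr (.inr a)) v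

/-- The new memory of a cell in the view of its processor. -/
def viewNext (A : PathAlgebra) (o : Offset) (v : PView) : Cell :=
  cellNext A (viewLayout v) (viewProducts v) (viewTime v) (viewInput o v) (viewPos o v)
    (Cell.ofWords fun r => viewWord none (o, r) v) (viewUp o v) (viewDown o v)

/-- The time at which the output is written, in the view of a processor. -/
def viewEnd (v : PView) : ℕ := 32 * (viewLayout v).s * rounds (viewLayout v) (viewProducts v)

/-- The new values of the number registers. -/
def nextNum (A : PathAlgebra) : Fin 11 ⊕ DataReg → PView → ℕ
  | .inr (o, r), v => ((viewNext A o v).get r).num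
  | .inl 5, v => if viewEnd v ≤ viewTime v then 1 else 0
  | .inl 6, v => if viewEnd v ≤ viewTime v then (viewWord none (0, .inl 0) v).num else 0
  | .inl 7, v => viewTime v + 1
  | .inl 8, v =>
    if (viewLayout v).m * (viewLayout v).m * (viewLayout v).m < (viewLayout v).n * (viewLayout v).n
    then (viewLayout v).m + 1 else (viewLayout v).m
  | .inl 9, v =>
    if viewPower v + 1 < (viewLayout v).n then viewProducts v + 1 else viewProducts v
  | .inl 10, v => if viewPower v + 1 < (viewLayout v).n then 2 * viewPower v + 1 else viewPower v
  | .inl r, v => scalar r v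

/-- The new values of the weight registers. -/
def nextWt (A : PathAlgebra) : Option DataReg → PView → EReal
  | some (o, r), v => ((viewNext A o v).get r).wt
  | none, v =>
    if viewEnd v ≤ viewTime v then (viewWord none (0, .inl 0) v).wt else (v none).wt (wtIndex none)

theorem isNumExpr_scalar (r : Fin 11) : IsNumExpr (scalar r) := .reg none _

theorem isWordExpr_viewWord (src : Option Dir) (i : DataReg) : IsWordExpr (viewWord src i) :=
  ⟨.reg src _, .reg src _⟩

theorem isLayoutExpr_viewLayout : IsLayoutExpr viewLayout :=
  ⟨isNumExpr_scalar 0, isNumExpr_scalar 1, isNumExpr_scalar 8⟩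

theorem isTestable_ended : IsTestable fun v => viewEnd v ≤ viewTime v :=
  .le (.mul (.mul (.const 32) isLayoutExpr_viewLayout.s)
    (isLayoutExpr_viewLayout.rounds (isNumExpr_scalar 9))) (isNumExpr_scalar 7)

theorem isWtExpr_viewInput (o : Offset) : IsWtExpr (viewInput o) := by
  unfold viewInput
  split_ifs
  · exact .reg none _
  · exact .zero

theorem isWordExpr_viewUp (o : Offset) (a : Fin 3) : IsWordExpr fun v => viewUp o v a := by
  unfold viewUp
  split_ifs <;> exact isWordExpr_viewWord _ _

theorem isWordExpr_viewDown (o : Offset) (a : Fin 3) : IsWordExpr fun v => viewDown o v a := by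
  unfold viewDown
  split_ifs <;> exact isWordExpr_viewWord _ _

theorem isCellExpr_viewNext (A : PathAlgebra) (o : Offset) : IsCellExpr (viewNext A o) :=
  .cellNext A isLayoutExpr_viewLayout (isNumExpr_scalar 9) (isNumExpr_scalar 7)
    (isWtExpr_viewInput o) (fun _ => .add (.mul (.const 8) (isNumExpr_scalar _)) (.const _))
    ⟨⟨isWordExpr_viewWord _ _, isWordExpr_viewWord _ _, isWordExpr_viewWord _ _,
      isWordExpr_viewWord _ _, isWordExpr_viewWord _ _, isWordExpr_viewWord _ _⟩,
      fun _ => isWordExpr_viewWord _ _, fun _ => isWordExpr_viewWord _ _⟩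
    (isWordExpr_viewUp o) (isWordExpr_viewDown o)

theorem IsCellExpr.get {a b : ℕ} {f : View a b → Cell} (hf : IsCellExpr f) :
    ∀ r, IsWordExpr fun v => (f v).get r
  | .inl r => by
    fin_cases r
    exacts [hf.store.io, hf.store.transit, hf.store.entry, hf.store.fst, hf.store.snd,
      hf.store.prod]
  | .inr (.inl a) => hf.left a
  | .inr (.inr a) => hf.right a

theorem isNumExpr_nextNum (A : PathAlgebra) : ∀ i, IsNumExpr (nextNum A i)
  | .inr (o, r) => ((isCellExpr_viewNext A o).get r).2
  | .inl r => by
    have hL := isLayoutExpr_viewLayout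
    have hpow : IsTestable fun v => viewPower v + 1 < (viewLayout v).n :=
      .lt (.add (isNumExpr_scalar 10) (.const 1)) hL.n
    fin_cases r
    · exact isNumExpr_scalar 0
    · exact isNumExpr_scalar 1
    · exact isNumExpr_scalar 2
    · exact isNumExpr_scalar 3
    · exact isNumExpr_scalar 4
    · exact .ite isTestable_ended (.const 1) (.const 0)
    · exact .ite isTestable_ended (isWordExpr_viewWord _ _).2 (.const 0)
    · exact .add (isNumExpr_scalar 7) (.const 1)
    · exact .ite (.lt (.mul (.mul hL.m hL.m) hL.m) (.mul hL.n hL.n)) (.add hL.m (.const 1)) hL.m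
    · exact .ite hpow (.add (isNumExpr_scalar 9) (.const 1)) (isNumExpr_scalar 9)
    · exact .ite hpow (.add (.mul (.const 2) (isNumExpr_scalar 10)) (.const 1))
        (isNumExpr_scalar 10)

theorem isWtExpr_nextWt (A : PathAlgebra) : ∀ i, IsWtExpr (nextWt A i)
  | some (o, r) => ((isCellExpr_viewNext A o).get r).1
  | none => .ite isTestable_ended (isWordExpr_viewWord _ _).1 (.reg none _)

/-- The program for a path problem. -/
def pathProgram (A : PathAlgebra) : MeshProgram :=
  programOf 40 (fun r => isNumExpr_nextNum A (numIndex.symm r))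
    fun r => isWtExpr_nextWt A (wtIndex.symm r)

/-- The memories of the processors. -/
abbrev MeshState (s : ℕ) : Type := Proc s → LocalState (dataCard + 4 + 7) (dataCard + 1)

section Step

variable (A : PathAlgebra) {s : ℕ} (σ : MeshState s) (P : Proc s)

/-- One step of the program. -/
def pathStep : MeshState s := (pathProgram A).step σ

theorem pathStep_num (i : Fin 11 ⊕ DataReg) :
    (pathStep A σ P).num (numIndex i) =
      nextNum A i (meshView σ P) % (pathProgram A).wordSize s :=
  (programOf_step_num 40 _ _ σ P (numIndex i)).trans
    (congrArg (fun j => nextNum A j (meshView σ P) % _) (numIndex.symm_apply_apply i))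

theorem pathStep_wt (i : Option DataReg) :
    (pathStep A σ P).wt (wtIndex i) = nextWt A i (meshView σ P) :=
  (programOf_step_wt 40 _ _ σ P (wtIndex i)).trans
    (congrArg (fun j => nextWt A j (meshView σ P)) (wtIndex.symm_apply_apply i))

end Step

/-! ### The counters -/

/-- The side of the cube that holds the input. -/
def inputSide (n : ℕ) : ℕ := ⌈(n : ℝ) ^ (2 / 3 : ℝ)⌉₊

theorem lt_inputSide_iff {n k : ℕ} : k < inputSide n ↔ k * k * k < n * n := by
  have h0 : (0 : ℝ) ≤ (n : ℝ) ^ (2 / 3 : ℝ) := Real.rpow_nonneg (Nat.cast_nonneg n) _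
  have h3 : ((n : ℝ) ^ (2 / 3 : ℝ)) ^ 3 = (n : ℝ) ^ 2 := by
    rw [← Real.rpow_natCast, ← Real.rpow_mul (Nat.cast_nonneg n), ← Real.rpow_natCast]
    norm_num
  rw [inputSide, Nat.lt_ceil, ← pow_lt_pow_iff_left₀ (Nat.cast_nonneg k) h0 three_ne_zero, h3]
  norm_cast
  rw [show k ^ 3 = k * k * k by ring, sq]

theorem sq_le_inputSide (n : ℕ) : n * n ≤ inputSide n * inputSide n * inputSide n :=
  not_lt.1 fun h => lt_irrefl _ (lt_inputSide_iff.2 h)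

theorem inputSide_le (n : ℕ) : inputSide n ≤ n := by
  by_contra! h
  refine absurd (lt_inputSide_iff.1 h) (not_lt.2 ?_)
  rcases n.eq_zero_or_pos with rfl | hn
  · exact Nat.zero_le _
  · exact Nat.le_mul_of_pos_right _ hn

/-- The side of the input cube as far as it has been computed at time `t`. -/
def inputSideAt (n : ℕ) : ℕ → ℕ
  | 0 => 0
  | t + 1 =>
    if inputSideAt n t * inputSideAt n t * inputSideAt n t < n * n then inputSideAt n t + 1
    else inputSideAt n t

/-- The power of two, minus one, that has been reached at time `t`. -/
def powerAt (n : ℕ) : ℕ → ℕ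
  | 0 => 0
  | t + 1 => if powerAt n t + 1 < n then 2 * powerAt n t + 1 else powerAt n t

/-- The number of matrix products as far as it has been computed at time `t`. -/
def productsAt (n : ℕ) : ℕ → ℕ
  | 0 => 0
  | t + 1 => if powerAt n t + 1 < n then productsAt n t + 1 else productsAt n t

theorem inputSideAt_eq (n t : ℕ) : inputSideAt n t = min t (inputSide n) := by
  induction t with
  | zero => rw [inputSideAt, Nat.zero_min]
  | succ t ih =>
    simp only [inputSideAt, ← lt_inputSide_iff]
    split_ifs <;> omega

theorem powerAt_add_one (n t : ℕ) : powerAt n t + 1 = 2 ^ productsAt n t := by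
  induction t with
  | zero => rfl
  | succ t ih =>
    rw [powerAt, productsAt]
    split_ifs
    · rw [pow_succ, ← ih]
      ring
    · exact ih

theorem productsAt_eq (n t : ℕ) : productsAt n t = min t (Nat.clog 2 n) := by
  induction t with
  | zero => rw [productsAt, Nat.zero_min]
  | succ t ih =>
    simp only [productsAt, powerAt_add_one, ← Nat.lt_clog_iff_pow_lt one_lt_two]
    split_ifs <;> omega

theorem powerAt_le (n t : ℕ) : powerAt n t ≤ 2 * n := by
  induction t with
  | zero => exact Nat.zero_le _
  | succ t ih =>
    rw [powerAt]
    split_ifs <;> omega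

/-- The parameters of the layout as far as they have been computed at time `t`. -/
def layoutAt (n s t : ℕ) : Layout := ⟨n, s, inputSideAt n t⟩

/-! ### The memories of the cells -/

/-- The memories of the cells at time `t`. -/
def cellRun (A : PathAlgebra) (n s : ℕ) (inp : Pos → EReal) : ℕ → Pos → Cell
  | 0, _ => Cell.blank
  | t + 1, p =>
    cellNext A (layoutAt n s t) (productsAt n t) t (inp p) p (cellRun A n s inp t p)
      (upWord (8 * s) (cellRun A n s inp t) p) (downWord (cellRun A n s inp t) p)

/-- The numbers of all words of a store are at most `n`, so that reducing them to the word length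
does not change them. -/
structure Store.Bounded (n : ℕ) (l : Store) : Prop where
  io : l.io.num ≤ n
  transit : l.transit.num ≤ n
  entry : l.entry.num ≤ n
  fst : l.fst.num ≤ n
  snd : l.snd.num ≤ n
  prod : l.prod.num ≤ n

/-- The numbers of all words of a cell are at most `n`. -/
structure Cell.Bounded (n : ℕ) (c : Cell) : Prop where
  store : c.store.Bounded n
  left : ∀ a, (c.left a).num ≤ n
  right : ∀ a, (c.right a).num ≤ n

theorem Cell.Bounded.get {n : ℕ} {c : Cell} (h : c.Bounded n) (r : CellReg) : (c.get r).num ≤ n :=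
  Cell.get_induction (C := fun w => w.num ≤ n) h.store.io h.store.transit h.store.entry h.store.fst
    h.store.snd h.store.prod h.left h.right r

theorem PathAlgebra.initialEntry_num_le {A : PathAlgebra} {n i j : ℕ} {x : Word} (hx : x.num ≤ n) :
    (A.initialEntry i j x).num ≤ n := by
  unfold PathAlgebra.initialEntry
  split_ifs
  exacts [Nat.zero_le _, Nat.zero_le _, hx]

namespace Store.Bounded

variable {A : PathAlgebra} {L : Layout} {κ st f k q ρ n : ℕ} {p : Pos} {src : Fin 3 → Word}
  {l : Store} {inp : EReal}

theorem consumeIn (hl : l.Bounded n) (hs : ∀ i, (src i).num ≤ n) :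
    (consumeIn A L κ st p k src l).Bounded n := by
  simp only [_root_.consumeIn]
  split_ifs
  · exact { hl with transit := hs _ }
  · exact { hl with entry := PathAlgebra.initialEntry_num_le (hs _) }
  · exact hl
  · exact hl

theorem consumeOut (hl : l.Bounded n) (hs : ∀ i, (src i).num ≤ n) :
    (consumeOut L κ st p k src l).Bounded n := by
  simp only [_root_.consumeOut]
  split_ifs
  · exact { hl with transit := hs _ }
  · exact { hl with io := hs _ }
  · exact hl
  · exact hl

theorem consumeFetch {e : ℕ} (hl : l.Bounded n) (hs : ∀ i, (src i).num ≤ n) :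
    (consumeFetch A L e p k src l).Bounded n := by
  refine { hl with fst := ?_, snd := ?_, prod := ?_ } <;> simp only [_root_.consumeFetch] <;>
    split_ifs
  exacts [hs 1, hl.fst, hs 1, hl.snd, Nat.zero_le _, hl.prod]

theorem consumeMul {e : ℕ} (hl : l.Bounded L.n) : (consumeMul A L e p k src l).Bounded L.n := by
  simp only [_root_.consumeMul]
  split_ifs with h
  · exact { hl with prod := h.2.1 }
  · exact hl

theorem consumeReduce (hl : l.Bounded n) (hs : ∀ i, (src i).num ≤ n) :
    (consumeReduce A L p k src l).Bounded n := by
  unfold _root_.consumeReduce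
  split_ifs
  · exact { hl with entry := hs 1 }
  · exact hl

theorem consumeRound (hl : l.Bounded L.n) (hs : ∀ i, (src i).num ≤ L.n) :
    (consumeRound A L q ρ inp p k src l).Bounded L.n := by
  unfold _root_.consumeRound consumeProd
  split_ifs
  · exact { hl with io := Nat.zero_le _ }
  · exact hl.consumeIn hs
  · exact hl.consumeReduce hs
  · exact hl.consumeFetch hs
  · exact hl.consumeMul
  · exact hl.consumeOut hs

theorem loadRound (hl : l.Bounded n) (a : Fin 3) : (loadRound L q ρ a l).num ≤ n := by
  unfold _root_.loadRound loadProd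
  split_ifs
  exacts [hl.io, hl.transit, hl.prod, hl.entry, hl.fst, hl.snd, hl.entry, hl.transit]

end Store.Bounded

theorem cellRun_bounded (A : PathAlgebra) (n s : ℕ) (inp : Pos → EReal) (t : ℕ) (p : Pos) :
    (cellRun A n s inp t p).Bounded n := by
  induction t generalizing p with
  | zero =>
    have h0 : ∀ r, (Cell.blank.get r).num ≤ n := fun r => by
      rw [Cell.get_blank]
      exact Nat.zero_le _
    exact ⟨⟨h0 (.inl 0), h0 (.inl 1), h0 (.inl 2), h0 (.inl 3), h0 (.inl 4), h0 (.inl 5)⟩,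
      fun a => h0 (.inr (.inl a)), fun a => h0 (.inr (.inr a))⟩
  | succ t ih =>
    refine ⟨?_, fun a => ?_, fun a => ?_⟩ <;>
      simp only [cellRun, cellNext, sweepCell, upWord, downWord] <;> split_ifs
    · exact Store.Bounded.consumeRound (L := layoutAt n s t) (ih p).store (ih p).right
    · exact (ih p).store
    · exact (ih p).store.loadRound a
    · exact (ih _).left a
    · exact Nat.zero_le _
    · exact (ih p).left a
    · exact (ih _).right a
    · exact Nat.zero_le _

/-! ### The program simulates the cells -/

/-- The position of a cell of a processor. -/
def cellPos {s : ℕ} (P : Proc s) (o : Offset) : Pos := fun a => 8 * (P a : ℕ) + o a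

theorem cellPos_update {s : ℕ} (P : Proc s) (o : Offset) (a : Fin 3) (x : Fin s) (k : Fin 8) :
    cellPos (Function.update P a x) (Function.update o a k) =
      Function.update (cellPos P o) a (8 * (x : ℕ) + k) := by
  funext b
  rcases eq_or_ne b a with rfl | hb
  · simp only [cellPos, Function.update_self]
  · simp only [cellPos, Function.update_of_ne hb]

/-- The memories `σ` of the processors, before the output is written, agree with the memories of the
cells at time `t`. -/
structure Simulates (A : PathAlgebra) (n s : ℕ) (inp : Pos → EReal) (inp' : Proc s → EReal) (t : ℕ)
    (σ : MeshState s) : Prop where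
  layout : ∀ P, viewLayout (meshView σ P) = layoutAt n s t
  coord : ∀ P a, viewCoord a (meshView σ P) = P a
  flag : ∀ P, scalar 5 (meshView σ P) = 0
  time : ∀ P, viewTime (meshView σ P) = t
  products : ∀ P, viewProducts (meshView σ P) = productsAt n t
  power : ∀ P, viewPower (meshView σ P) = powerAt n t
  input : ∀ P, (σ P).wt (wtIndex none) = inp' P
  word : ∀ P i, viewWord none i (meshView σ P) = (cellRun A n s inp t (cellPos P i.1)).get i.2

namespace Simulates

variable {A : PathAlgebra} {n s : ℕ} {inp : Pos → EReal} {inp' : Proc s → EReal} {t : ℕ}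
  {σ : MeshState s}

theorem viewWord_some (h : Simulates A n s inp inp' t σ) {P Q : Proc s} {d : Dir}
    (hd : neighbor P d = some Q) (i : DataReg) :
    viewWord (some d) i (meshView σ P) = (cellRun A n s inp t (cellPos Q i.1)).get i.2 := by
  rw [← h.word Q i, viewWord]
  simp only [meshView, hd]
  rfl

theorem viewWord_some_of_none (σ : MeshState s) {P : Proc s} {d : Dir} (hd : neighbor P d = none)
    (i : DataReg) : viewWord (some d) i (meshView σ P) = Word.blank := by
  rw [viewWord]
  simp only [meshView, hd]
  rfl

theorem viewUp_eq (h : Simulates A n s inp inp' t σ) (P : Proc s) (o : Offset) :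
    viewUp o (meshView σ P) = upWord (8 * s) (cellRun A n s inp t) (cellPos P o) := by
  funext a
  have hpos : cellPos P o a = 8 * (P a : ℕ) + o a := rfl
  rw [viewUp, upWord, hpos]
  split_ifs with ho hp hp
  · rw [h.word, ← Function.update_eq_self a P, cellPos_update, Function.update_eq_self]
    rfl
  · have := (P a).2
    omega
  · have hs : (P a : ℕ) + 1 < s := by omega
    have hd : neighbor P (a, true) = some (Function.update P a ⟨P a + 1, hs⟩) := by
      simp [neighbor, hs]
    rw [h.viewWord_some hd, cellPos_update,
      show 8 * (P a : ℕ) + o a + 1 = 8 * (P a + 1) by omega]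
    rfl
  · have hs : ¬ (P a : ℕ) + 1 < s := by omega
    exact viewWord_some_of_none σ (by simp [neighbor, hs]) _

theorem viewDown_eq (h : Simulates A n s inp inp' t σ) (P : Proc s) (o : Offset) :
    viewDown o (meshView σ P) = downWord (cellRun A n s inp t) (cellPos P o) := by
  funext a
  have hpos : cellPos P o a = 8 * (P a : ℕ) + o a := rfl
  rw [viewDown, downWord, hpos]
  split_ifs with ho hp hp
  · rw [h.word, ← Function.update_eq_self a P, cellPos_update, Function.update_eq_self,
      Nat.add_sub_assoc ho]
    rfl
  · omega
  · have hs : 0 < (P a : ℕ) := by omega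
    have hd : neighbor P (a, false) = some (Function.update P a ⟨P a - 1, by omega⟩) := by
      simp [neighbor, hs]
    rw [h.viewWord_some hd, cellPos_update,
      show 8 * (P a : ℕ) + o a - 1 = 8 * (P a - 1) + 7 by omega]
    rfl
  · have hs : (P a : ℕ) = 0 := by omega
    exact viewWord_some_of_none σ (by simp [neighbor, hs]) _

theorem viewNext_eq (h : Simulates A n s inp inp' t σ)
    (hinp : ∀ P o, inp (cellPos P o) = if o = 0 then inp' P else 0) (P : Proc s) (o : Offset) :
    viewNext A o (meshView σ P) = cellRun A n s inp (t + 1) (cellPos P o) := by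
  have hpos : viewPos o (meshView σ P) = cellPos P o :=
    funext fun a => congrArg (8 * · + (o a : ℕ)) (h.coord P a)
  have hinput : viewInput o (meshView σ P) = inp (cellPos P o) := by
    rw [hinp, ← h.input P]
    rfl
  have hcell : (Cell.ofWords fun r => viewWord none (o, r) (meshView σ P)) =
      cellRun A n s inp t (cellPos P o) := by
    simp only [h.word]
    exact Cell.ofWords_get _
  rw [viewNext, h.layout, h.viewUp_eq, h.viewDown_eq, hpos, hinput, hcell, h.products, h.time]
  rfl

theorem viewEnd_eq (h : Simulates A n s inp inp' t σ) (P : Proc s) :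
    viewEnd (meshView σ P) = 32 * s * rounds (layoutAt n s t) (productsAt n t) := by
  rw [viewEnd, h.layout, h.products]
  rfl

theorem step (h : Simulates A n s inp inp' t σ)
    (hinp : ∀ P o, inp (cellPos P o) = if o = 0 then inp' P else 0)
    (hend : t < 32 * s * rounds (layoutAt n s t) (productsAt n t))
    (hn : 2 * n < (pathProgram A).wordSize s) (hs : s < (pathProgram A).wordSize s)
    (ht : t + 1 < (pathProgram A).wordSize s) :
    Simulates A n s inp inp' (t + 1) (pathStep A σ) := by
  have hend' : ∀ P, ¬ viewEnd (meshView σ P) ≤ viewTime (meshView σ P) := fun P => by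
    rw [h.viewEnd_eq, h.time]
    omega
  have hstep : ∀ {x : ℕ} (P i), nextNum A i (meshView σ P) = x → x < (pathProgram A).wordSize s →
      (pathStep A σ P).num (numIndex i) = x := fun P i hx hlt => by
    rw [pathStep_num, hx, Nat.mod_eq_of_lt hlt]
  have hside := inputSideAt_eq n (t + 1)
  have hproducts := productsAt_eq n (t + 1)
  have hpower := powerAt_le n (t + 1)
  refine ⟨fun P => ?_, fun P a => ?_, fun P => ?_, fun P => ?_, fun P => ?_, fun P => ?_,
    fun P => ?_, fun P i => ?_⟩
  · refine (Layout.mk.injEq ..).mpr ⟨hstep P (.inl 0) ?_ (by omega), hstep P (.inl 1) ?_ hs,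
      hstep P (.inl 8) ?_ (by omega)⟩
    · exact congrArg Layout.n (h.layout P)
    · exact congrArg Layout.s (h.layout P)
    · rw [nextNum, h.layout]
      rfl
  · have := (P a).2
    refine hstep P _ ((?_ : _ = viewCoord a (meshView σ P)).trans (h.coord P a)) (by omega)
    fin_cases a <;> rfl
  · exact hstep P (.inl 5) (if_neg (hend' P)) (by omega)
  · exact hstep P (.inl 7) (congrArg (· + 1) (h.time P)) ht
  · refine hstep P (.inl 9) ?_ (by omega)
    rw [nextNum, h.power, h.products, h.layout]
    rfl
  · refine hstep P (.inl 10) ?_ (by omega)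
    rw [nextNum, h.power, h.layout]
    rfl
  · rw [pathStep_wt, nextWt, if_neg (hend' P)]
    exact h.input P
  · have hword := congrArg (Cell.get · i.2) (h.viewNext_eq hinp P i.1)
    have hle := (cellRun_bounded A n s inp (t + 1) (cellPos P i.1)).get i.2
    exact Word.ext ((pathStep_wt A σ P (some i)).trans (congrArg Word.wt hword))
      (hstep P (.inr i) (congrArg Word.num hword) (by omega))

theorem last (h : Simulates A n s inp inp' t σ)
    (hend : 32 * s * rounds (layoutAt n s t) (productsAt n t) ≤ t)
    (hn : n < (pathProgram A).wordSize s) (hs : 1 < (pathProgram A).wordSize s) (P : Proc s) :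
    (pathStep A σ P).num (numIndex (.inl 5)) = 1 ∧
      (pathStep A σ P).num (numIndex (.inl 6)) =
        (cellRun A n s inp t (cellPos P 0)).store.io.num ∧
      (pathStep A σ P).wt 0 = (cellRun A n s inp t (cellPos P 0)).store.io.wt := by
  have hend' : viewEnd (meshView σ P) ≤ viewTime (meshView σ P) := by
    rwa [h.viewEnd_eq, h.time]
  refine ⟨?_, ?_, ?_⟩
  · rw [pathStep_num, nextNum, if_pos hend', Nat.mod_eq_of_lt hs]
  · rw [pathStep_num, nextNum, if_pos hend', h.word]
    exact Nat.mod_eq_of_lt (((cellRun_bounded A n s inp t _).get (.inl 0)).trans_lt hn)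
  · rw [← wtIndex_none, pathStep_wt, nextWt, if_pos hend', h.word]
    rfl

end Simulates

/-! ### The sweeps of a run -/

/-- `lam ρ p` is the store of the cell `p` before the sweep `ρ` of a computation with `q` matrix
products. -/
def IsRun (A : PathAlgebra) (L : Layout) (q : ℕ) (inp : Pos → EReal) (lam : ℕ → Pos → Store) :
    Prop :=
  ∀ ρ p, (∀ a, p a < 8 * L.s) →
    lam (ρ + 1) p = iter (fun k => consumeRound A L q ρ (inp p) p k
      fun a => loadRound L q ρ a (lam ρ (Function.update p a k))) (8 * L.s) (lam ρ p)

theorem isRun_cellRun (A : PathAlgebra) {n s m q : ℕ} (inp : Pos → EReal)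
    (hm : ∀ t, 32 * s ≤ t → inputSideAt n t = m) (hq : ∀ t, 32 * s ≤ t → productsAt n t = q) :
    IsRun A ⟨n, s, m⟩ q inp fun ρ p => (cellRun A n s inp (32 * s * ρ) p).store := by
  intro ρ p hp
  have hsweep : IsSweep (8 * s) (loadRound ⟨n, s, m⟩ q ρ)
      (fun p => consumeRound A ⟨n, s, m⟩ q ρ (inp p) p)
      fun τ => cellRun A n s inp (32 * s * ρ + τ) := by
    intro τ hτ p _
    have hdiv : (32 * s * ρ + τ) / (32 * s) = ρ := by
      rw [mul_comm, mul_add_div_of_lt (by omega)]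
    have hmod : (32 * s * ρ + τ) % (32 * s) = τ := by
      rw [Nat.mul_add_mod_self_left, Nat.mod_eq_of_lt (by omega)]
    change cellRun A n s inp (32 * s * ρ + τ + 1) p = _
    simp only [cellRun, cellNext, sweepStep, layoutAt, hdiv, hmod]
    -- The first sweep does not look at the counters, which are not final yet.
    rcases Nat.eq_zero_or_pos ρ with rfl | hρ
    · rfl
    · have hle : 32 * s ≤ 32 * s * ρ + τ :=
        (Nat.le_mul_of_pos_right _ hρ).trans (Nat.le_add_right _ _)
      rw [hm _ hle, hq _ hle]
  have hstore := hsweep.store_eq hp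
  rwa [show 32 * s * ρ + 4 * (8 * s) = 32 * s * (ρ + 1) by ring] at hstore

/-! ### Single stages of the routing -/

namespace Layout

variable {A : PathAlgebra} {L : Layout}

theorem rowAt_congr {st : ℕ} (h : st = 0 ∨ 3 ≤ st) (κ κ' : ℕ) (p : Pos) :
    L.rowAt st κ p = L.rowAt st κ' p := by
  rcases h with rfl | h
  · rfl
  · simp only [rowAt, if_neg (show ¬ st < 1 by omega), if_neg (show ¬ st < 3 by omega)]

theorem colAt_congr {st : ℕ} (h : st = 0 ∨ 3 ≤ st) (κ κ' : ℕ) (p : Pos) :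
    L.colAt st κ p = L.colAt st κ' p := by
  rcases h with rfl | h
  · rfl
  · simp only [colAt, if_neg (show ¬ st < 1 by omega), if_neg (show ¬ st < 3 by omega)]

namespace Valid

variable {i j κ st : ℕ} {src : ℕ → Fin 3 → Word} {l : Store}

theorem iter_consumeIn (hL : L.Valid) (hi : i < L.n) (hj : j < L.n) :
    iter (fun k => consumeIn A L (L.slot i j) st (L.pos (st + 1) i j) k (src k)) (8 * L.s) l =
      if st < 4 then { l with transit := src (L.pos st i j (axis st)) (axis st) }
      else { l with entry := A.initialEntry i j (src (L.pos st i j (axis st)) (axis st)) } := by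
  rw [iter_eq_ite (c := L.pos st i j (axis st)), if_pos (hL.pos_lt st hi hj _)]
  · simp only [consumeIn, hL.rowAt_pos hj, hL.colAt_pos hj, if_true]
  · intro k l hk
    simp only [consumeIn, hL.rowAt_pos hj, hL.colAt_pos hj, if_neg hk]

theorem iter_consumeOut (hL : L.Valid) (hi : i < L.n) (hj : j < L.n) :
    iter (fun k => consumeOut L (L.slot i j) st (L.pos st i j) k (src k)) (8 * L.s) l =
      if 0 < st then { l with transit := src (L.pos (st + 1) i j (axis st)) (axis st) }
      else { l with io := src (L.pos (st + 1) i j (axis st)) (axis st) } := by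
  rw [iter_eq_ite (c := L.pos (st + 1) i j (axis st)), if_pos (hL.pos_lt (st + 1) hi hj _)]
  · simp only [consumeOut, hL.rowAt_pos hj, hL.colAt_pos hj, if_true]
  · intro k l hk
    simp only [consumeOut, hL.rowAt_pos hj, hL.colAt_pos hj, if_neg hk]

theorem iter_consumeIn_home_of_ne (hL : L.Valid) (hj : j < L.n) (hκ : L.slot i j ≠ κ) :
    (iter (fun k => consumeIn A L κ 4 (L.pos 5 i j) k (src k)) (8 * L.s) l).entry = l.entry := by
  refine map_iter_of_forall_eq Store.entry (fun k l => ?_) _ _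
  simp only [consumeIn, rowAt_congr (st := 4 + 1) (.inr (by norm_num)) κ (L.slot i j),
    colAt_congr (st := 4 + 1) (.inr (by norm_num)) κ (L.slot i j), hL.rowAt_pos hj,
    hL.colAt_pos hj, lt_irrefl, if_false, if_neg hκ, ite_self]

theorem iter_consumeOut_input_of_ne (hL : L.Valid) (hj : j < L.n) (hκ : L.slot i j ≠ κ) :
    (iter (fun k => consumeOut L κ 0 (L.pos 0 i j) k (src k)) (8 * L.s) l).io = l.io := by
  refine map_iter_of_forall_eq Store.io (fun k l => ?_) _ _
  simp only [consumeOut, rowAt_congr (.inl rfl) κ (L.slot i j),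
    colAt_congr (.inl rfl) κ (L.slot i j), hL.rowAt_pos hj, hL.colAt_pos hj, lt_irrefl, if_false,
    if_neg hκ, ite_self]

end Valid

end Layout

theorem consumeIn_io {A : PathAlgebra} {L : Layout} {κ st k : ℕ} {p : Pos} {src : Fin 3 → Word}
    {l : Store} : (consumeIn A L κ st p k src l).io = l.io := by
  simp only [consumeIn]
  split_ifs <;> rfl

theorem consumeIn_entry {A : PathAlgebra} {L : Layout} {κ st k : ℕ} {p : Pos} {src : Fin 3 → Word}
    {l : Store} (hst : st < 4) : (consumeIn A L κ st p k src l).entry = l.entry := by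
  simp only [consumeIn, if_pos hst]
  split_ifs <;> rfl

theorem consumeOut_entry {L : Layout} {κ st k : ℕ} {p : Pos} {src : Fin 3 → Word} {l : Store} :
    (consumeOut L κ st p k src l).entry = l.entry := by
  simp only [consumeOut]
  split_ifs <;> rfl

theorem consumeOut_io {L : Layout} {κ st k : ℕ} {p : Pos} {src : Fin 3 → Word} {l : Store}
    (hst : 0 < st) : (consumeOut L κ st p k src l).io = l.io := by
  simp only [consumeOut, if_pos hst]
  split_ifs <;> rfl

namespace IsRun

variable {A : PathAlgebra} {L : Layout} {q : ℕ} {inp : Pos → EReal} {lam : ℕ → Pos → Store}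
  {p : Pos}

/-! ### Routing the input -/

theorem io_one (hr : IsRun A L q inp lam) (hL : L.Valid) (hp : ∀ a, p a < 8 * L.s) :
    (lam 1 p).io = ⟨inp p, 0⟩ := by
  obtain ⟨S, hS⟩ := Nat.exists_eq_add_of_le' (show 1 ≤ 8 * L.s by have := hL.s_pos; omega)
  rw [hr 0 p hp, hS]
  rfl

theorem in_step (hr : IsRun A L q inp lam) {κ st : ℕ} (hκ : κ < 6) (hst : st < 5)
    (hp : ∀ a, p a < 8 * L.s) :
    lam (1 + (5 * κ + st) + 1) p = iter (fun k => consumeIn A L κ st p k fun a =>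
      if st = 0 then (lam (1 + (5 * κ + st)) (Function.update p a k)).io
      else (lam (1 + (5 * κ + st)) (Function.update p a k)).transit) (8 * L.s)
      (lam (1 + (5 * κ + st)) p) := by
  rw [hr _ p hp]
  have hdiv : (1 + (5 * κ + st) - 1) / 5 = κ := by omega
  have hmod : (1 + (5 * κ + st) - 1) % 5 = st := by omega
  congr 1
  funext k l
  simp only [consumeRound, loadRound, if_neg (show ¬ 1 + (5 * κ + st) = 0 by omega),
    if_pos (show 1 + (5 * κ + st) < 31 by omega), hdiv, hmod]

theorem in_io (hr : IsRun A L q inp lam) (hL : L.Valid) {r : ℕ} (h : r ≤ 30)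
    (hp : ∀ a, p a < 8 * L.s) : (lam (1 + r) p).io = ⟨inp p, 0⟩ := by
  induction r with
  | zero => exact hr.io_one hL hp
  | succ r ih =>
    rw [← ih (by omega), ← add_assoc, show r = 5 * (r / 5) + r % 5 by omega,
      hr.in_step (by omega) (by omega) hp]
    exact map_iter_of_forall_eq Store.io (fun _ _ => consumeIn_io) _ _

theorem in_transit (hr : IsRun A L q inp lam) (hL : L.Valid) {i j : ℕ} (hi : i < L.n)
    (hj : j < L.n) {st : ℕ} (hst : st < 5) :
    (if st = 0 then (lam (1 + (5 * L.slot i j + st)) (L.pos st i j)).io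
      else (lam (1 + (5 * L.slot i j + st)) (L.pos st i j)).transit) = ⟨inp (L.pos 0 i j), 0⟩ := by
  have hκ := hL.slot_lt (i := i) hj
  induction st with
  | zero => exact hr.in_io hL (by omega) (hL.pos_lt 0 hi hj)
  | succ st ih =>
    rw [if_neg st.succ_ne_zero, ← add_assoc (5 * _), ← add_assoc 1,
      hr.in_step hκ (by omega) (hL.pos_lt (st + 1) hi hj), hL.iter_consumeIn hi hj,
      if_pos (by omega), Layout.update_pos_succ (by omega)]
    exact ih (by omega)

theorem in_entry_eq_of_ne (hr : IsRun A L q inp lam) (hL : L.Valid) {i j r : ℕ} (hi : i < L.n)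
    (hj : j < L.n) (hr30 : r < 30) (hne : r ≠ 5 * L.slot i j + 4) :
    (lam (1 + r + 1) (L.pos 5 i j)).entry = (lam (1 + r) (L.pos 5 i j)).entry := by
  rw [show r = 5 * (r / 5) + r % 5 by omega,
    hr.in_step (by omega) (by omega) (hL.pos_lt 5 hi hj)]
  rcases eq_or_ne (r % 5) 4 with h4 | h4
  · rw [h4]
    exact hL.iter_consumeIn_home_of_ne hj (by omega)
  · exact map_iter_of_forall_eq Store.entry (fun _ _ => consumeIn_entry (by omega)) _ _

theorem in_entry (hr : IsRun A L q inp lam) (hL : L.Valid) {i j : ℕ} (hi : i < L.n)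
    (hj : j < L.n) : (lam 31 (L.pos 5 i j)).entry = A.initialEntry i j ⟨inp (L.pos 0 i j), 0⟩ := by
  have hκ := hL.slot_lt (i := i) hj
  have harrive : ∀ r, 5 * L.slot i j + 5 ≤ r → r ≤ 30 →
      (lam (1 + r) (L.pos 5 i j)).entry = A.initialEntry i j ⟨inp (L.pos 0 i j), 0⟩ := by
    refine Nat.le_induction (fun _ => ?_) fun r hle ih h30 => ?_
    · rw [← hr.in_transit hL hi hj (st := 4) (by norm_num),
        show 1 + (5 * L.slot i j + 5) = 1 + (5 * L.slot i j + 4) + 1 by omega,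
        hr.in_step hκ (by norm_num) (hL.pos_lt 5 hi hj), hL.iter_consumeIn hi hj,
        if_neg (lt_irrefl 4), Layout.update_pos_succ (by norm_num)]
    · rw [← add_assoc, hr.in_entry_eq_of_ne hL hi hj (by omega) (by omega), ih (by omega)]
  exact harrive 30 (by omega) le_rfl

/-! ### Routing the output -/

theorem out_step (hr : IsRun A L q inp lam) {κ st : ℕ} (hst : st < 5) (hp : ∀ a, p a < 8 * L.s) :
    lam (31 + q * L.period + (5 * κ + (4 - st)) + 1) p =
      iter (fun k => consumeOut L κ st p k fun a =>
        if st = 4 then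
          (lam (31 + q * L.period + (5 * κ + (4 - st))) (Function.update p a k)).entry
        else (lam (31 + q * L.period + (5 * κ + (4 - st))) (Function.update p a k)).transit)
        (8 * L.s) (lam (31 + q * L.period + (5 * κ + (4 - st))) p) := by
  rw [hr _ p hp]
  have hsub : 31 + q * L.period + (5 * κ + (4 - st)) - (31 + q * L.period) = 5 * κ + (4 - st) :=
    Nat.add_sub_cancel_left ..
  have hdiv : (5 * κ + (4 - st)) / 5 = κ := by omega
  have hmod : 4 - (5 * κ + (4 - st)) % 5 = st := by omega
  have hfirst : (5 * κ + (4 - st)) % 5 = 0 ↔ st = 4 := by omega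
  congr 1
  funext k l
  simp only [consumeRound, loadRound, hsub, hdiv, hmod, hfirst,
    if_neg (show ¬ 31 + q * L.period + (5 * κ + (4 - st)) = 0 by omega),
    if_neg (show ¬ 31 + q * L.period + (5 * κ + (4 - st)) < 31 by omega),
    if_neg (show ¬ 31 + q * L.period + (5 * κ + (4 - st)) < 31 + q * L.period by omega)]

theorem out_entry (hr : IsRun A L q inp lam) (r : ℕ) (hp : ∀ a, p a < 8 * L.s) :
    (lam (31 + q * L.period + r) p).entry = (lam (31 + q * L.period) p).entry := by
  induction r with
  | zero => rfl
  | succ r ih =>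
    rw [← add_assoc, ← ih, show r = 5 * (r / 5) + (4 - (4 - r % 5)) by omega,
      hr.out_step (by omega) hp]
    exact map_iter_of_forall_eq Store.entry (fun _ _ => consumeOut_entry) _ _

theorem out_transit (hr : IsRun A L q inp lam) (hL : L.Valid) {i j : ℕ} (hi : i < L.n)
    (hj : j < L.n) {st : ℕ} (hst : st < 5) :
    (if st = 4 then
        (lam (31 + q * L.period + (5 * L.slot i j + (4 - st))) (L.pos (st + 1) i j)).entry
      else (lam (31 + q * L.period + (5 * L.slot i j + (4 - st))) (L.pos (st + 1) i j)).transit) =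
      (lam (31 + q * L.period) (L.pos 5 i j)).entry := by
  refine Nat.decreasingInduction' (n := 4) (P := fun st => (if st = 4 then
        (lam (31 + q * L.period + (5 * L.slot i j + (4 - st))) (L.pos (st + 1) i j)).entry
      else (lam (31 + q * L.period + (5 * L.slot i j + (4 - st))) (L.pos (st + 1) i j)).transit) =
      (lam (31 + q * L.period) (L.pos 5 i j)).entry) (fun st hst _ ih => ?_) (by omega)
      (hr.out_entry _ (hL.pos_lt 5 hi hj))
  rw [if_neg hst.ne, show 4 - st = 4 - (st + 1) + 1 by omega, ← add_assoc (5 * _),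
    ← add_assoc (31 + _), hr.out_step (by omega) (hL.pos_lt (st + 1) hi hj),
    hL.iter_consumeOut hi hj, if_pos st.succ_pos, Layout.update_pos (by omega)]
  exact ih

theorem out_io_eq_of_ne (hr : IsRun A L q inp lam) (hL : L.Valid) {i j r : ℕ} (hi : i < L.n)
    (hj : j < L.n) (hne : r ≠ 5 * L.slot i j + 4) :
    (lam (31 + q * L.period + r + 1) (L.pos 0 i j)).io =
      (lam (31 + q * L.period + r) (L.pos 0 i j)).io := by
  rw [show r = 5 * (r / 5) + (4 - (4 - r % 5)) by omega,
    hr.out_step (by omega) (hL.pos_lt 0 hi hj)]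
  rcases eq_or_ne (r % 5) 4 with h4 | h4
  · rw [h4]
    exact hL.iter_consumeOut_input_of_ne hj (by omega)
  · exact map_iter_of_forall_eq Store.io (fun _ _ => consumeOut_io (by omega)) _ _

theorem out_io (hr : IsRun A L q inp lam) (hL : L.Valid) {i j : ℕ} (hi : i < L.n)
    (hj : j < L.n) :
    (lam (rounds L q) (L.pos 0 i j)).io = (lam (31 + q * L.period) (L.pos 5 i j)).entry := by
  have hκ := hL.slot_lt (i := i) hj
  have harrive : ∀ r, 5 * L.slot i j + 5 ≤ r → (lam (31 + q * L.period + r) (L.pos 0 i j)).io =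
      (lam (31 + q * L.period) (L.pos 5 i j)).entry := by
    refine Nat.le_induction ?_ fun r hle ih => ?_
    · rw [← hr.out_transit hL hi hj (st := 0) (by norm_num),
        show 31 + q * L.period + (5 * L.slot i j + 5) =
          31 + q * L.period + (5 * L.slot i j + (4 - 0)) + 1 by omega,
        hr.out_step (by norm_num) (hL.pos_lt 0 hi hj), hL.iter_consumeOut hi hj,
        if_neg (lt_irrefl 0), Layout.update_pos (by norm_num)]
    · rw [← add_assoc, hr.out_io_eq_of_ne hL hi hj (by omega), ih]
  rw [← harrive 30 (by omega), rounds]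
  congr 2
  omega

end IsRun

/-! ### Best candidates -/

namespace PathAlgebra

variable {A : PathAlgebra}

namespace Better

theorem trans {x y z : EReal} (h : A.Better x y) (h' : A.Better y z) : A.Better x z := by
  unfold Better at *
  split_ifs at *
  · exact h'.trans h
  · exact h.trans h'

theorem irrefl (x : EReal) : ¬ A.Better x x := by
  unfold Better
  split_ifs <;> exact lt_irrefl x

theorem not_trans {x y z : EReal} (h : ¬ A.Better x y) (h' : ¬ A.Better y z) :
    ¬ A.Better x z := by
  unfold Better at *
  split_ifs at *
  · exact not_lt.2 ((not_lt.1 h).trans (not_lt.1 h'))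
  · exact not_lt.2 ((not_lt.1 h').trans (not_lt.1 h))

end Better

/-- The word `c` is the best of `c₀` and the words `x k` with `k ∈ I`, where `c₀` wins ties. -/
def IsBest {ι : Type*} (A : PathAlgebra) (c₀ : Word) (x : ι → Word) (I : Set ι) (c : Word) : Prop :=
  (c = c₀ ∨ ∃ k ∈ I, c = x k ∧ A.Better (x k).wt c₀.wt) ∧ ∀ k ∈ I, ¬ A.Better (x k).wt c.wt

namespace IsBest

variable {ι κ : Type*} {c₀ c d : Word} {x : ι → Word} {I J : Set ι}

theorem empty : A.IsBest c x ∅ c := ⟨.inl rfl, fun _ h => h.elim⟩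

theorem union (hc : A.IsBest c₀ x I c) (hd : A.IsBest c x J d) : A.IsBest c₀ x (I ∪ J) d := by
  obtain ⟨rfl | ⟨l, hl, rfl, hlc⟩, hJ⟩ := hd
  · exact ⟨hc.1.imp_right fun ⟨k, hk, h⟩ => ⟨k, .inl hk, h⟩, fun k hk => hk.elim (hc.2 k) (hJ k)⟩
  · have hI : ∀ k ∈ I, ¬ A.Better (x k).wt (x l).wt := fun k hk h => hc.2 k hk (h.trans hlc)
    refine ⟨.inr ⟨l, .inr hl, rfl, ?_⟩, fun k hk => hk.elim (hI k) (hJ k)⟩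
    rcases hc.1 with rfl | ⟨k, -, rfl, hk⟩
    · exact hlc
    · exact hlc.trans hk

theorem image {y : κ → Word} {g : ι → κ} (h : A.IsBest c₀ (fun k => y (g k)) I c) :
    A.IsBest c₀ y (g '' I) c :=
  ⟨h.1.imp_right fun ⟨k, hk, h⟩ => ⟨g k, ⟨k, hk, rfl⟩, h⟩, by rintro _ ⟨k, hk, rfl⟩; exact h.2 k hk⟩

theorem biUnion {w : Word} (hw : ∀ y, ¬ A.Better w.wt y) {y : κ → Word} {Z : Set κ}
    {K : κ → Set ι} (hy : ∀ z ∈ Z, A.IsBest w x (K z) (y z)) (h : A.IsBest c₀ y Z c) :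
    A.IsBest c₀ x (⋃ z ∈ Z, K z) c := by
  refine ⟨?_, fun k hk => ?_⟩
  · rcases h.1 with hc | ⟨z, hz, hcz, hb⟩
    · exact .inl hc
    rcases (hy z hz).1 with hyw | ⟨k, hk, hyk, -⟩
    · exact absurd (hyw ▸ hb) (hw _)
    · exact .inr ⟨k, Set.mem_biUnion hz hk, hcz.trans hyk, hyk ▸ hb⟩
  · obtain ⟨z, hz, hk⟩ := Set.mem_iUnion₂.1 hk
    exact Better.not_trans ((hy z hz).2 k hk) (h.2 z hz)

open Classical in
theorem ite_better (k : ι) :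
    A.IsBest c x {k} (if A.Better (x k).wt c.wt then x k else c) := by
  split_ifs with h
  · exact ⟨.inr ⟨k, rfl, rfl, h⟩, by rintro _ rfl; exact Better.irrefl _⟩
  · exact ⟨.inl rfl, by rintro _ rfl; exact h⟩

end IsBest

open Classical in
theorem isBest_iter {β : Type*} {f : ℕ → β → β} (π : β → Word) {x : ℕ → Word} {P : ℕ → Prop}
    {S : ℕ} (hf : ∀ k < S, ∀ l, π (f k l) = if P k ∧ A.Better (x k).wt (π l).wt then x k else π l)
    (l : β) : A.IsBest (π l) x {k | k < S ∧ P k} (π (iter f S l)) := by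
  induction S with
  | zero => simpa only [not_lt_zero, false_and, Set.ofPred_false, iter] using IsBest.empty
  | succ S ih =>
    have ih := ih fun k hk => hf k (by omega)
    rw [iter, hf S (by omega)]
    by_cases hP : P S
    · simp only [hP, true_and]
      convert ih.union (IsBest.ite_better S) using 1
      ext k
      simp only [Set.mem_ofPred_eq, Set.mem_union, Set.mem_singleton_iff, Nat.lt_succ_iff_lt_or_eq]
      constructor
      · rintro ⟨hk | hk, h⟩
        · exact .inl ⟨hk, h⟩
        · exact .inr hk
      · rintro (⟨hk, h⟩ | rfl)
        · exact ⟨.inl hk, h⟩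
        · exact ⟨.inr rfl, hP⟩
    · rw [if_neg fun h => hP h.1]
      convert ih using 1
      ext k
      refine and_congr_left fun hk => ⟨fun h => ?_, fun h => h.trans S.lt_succ_self⟩
      exact (Nat.lt_succ_iff_lt_or_eq.1 h).resolve_right fun h => hP (h ▸ hk)

end PathAlgebra

/-! ### The matrix products -/

/-- The matrix entry `(i, j)` after `φ` products. -/
def matrixEntry (L : Layout) (lam : ℕ → Pos → Store) (φ i j : ℕ) : Word :=
  (lam (31 + φ * L.period) (L.pos 5 i j)).entry

/-- The candidate for the entry `(i, j)` of the product number `φ` that comes from the intermediate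
vertex `k`. -/
def candidate (A : PathAlgebra) (L : Layout) (lam : ℕ → Pos → Store) (φ i j k : ℕ) : Word :=
  ⟨A.mul.eval (matrixEntry L lam φ i k).wt (matrixEntry L lam φ k j).wt, k + 1⟩

/-- The cell that computes a part of the entry `(i, j)` of a product in the layer `z`. -/
def layerPos (L : Layout) (i j z : ℕ) : Pos := ![i / L.stride, z, j / L.stride]

section Layer

variable {L : Layout} {i j z e k K : ℕ}

theorem Layout.Valid.batches_pos (hL : L.Valid) : 0 < L.batches :=
  Nat.pos_of_mul_pos_right (Nat.lt_of_lt_of_le hL.stride_pos hL.stride_le_batches_mul)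

theorem midClass_update {p : Pos} {b : Fin 3} (hb : b ≠ 1) :
    midClass L e (Function.update p b k) = midClass L e p := by
  rw [midClass, midClass, Function.update_of_ne hb.symm]

theorem layerPos_lt (hL : L.Valid) (hi : i < L.n) (hj : j < L.n) (hz : z < 8 * L.s) (a : Fin 3) :
    layerPos L i j z a < 8 * L.s := by
  fin_cases a
  · exact (hL.div_stride_lt hi).trans_le (Nat.le_mul_of_pos_left _ (by norm_num))
  · exact hz
  · exact (hL.div_stride_lt hj).trans_le (Nat.le_mul_of_pos_left _ (by norm_num))

theorem update_pos_five : Function.update (L.pos 5 i j) 1 z = layerPos L i j z := by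
  funext a
  fin_cases a <;> rfl

theorem update_layerPos_two (hK : K < L.stride) :
    Function.update (Function.update (layerPos L i j z) 2 k) 1 (i % L.stride * L.stride + K) =
      L.pos 5 i (k * L.stride + K) := by
  funext a
  fin_cases a
  · rfl
  · change i % L.stride * L.stride + K = i % L.stride * L.stride + (k * L.stride + K) % L.stride
    rw [Nat.mul_add_mod_self_right, Nat.mod_eq_of_lt hK]
  · exact (mul_add_div_of_lt hK).symm

theorem update_layerPos_zero (hK : K < L.stride) :
    Function.update (Function.update (layerPos L i j z) 0 k) 1 (K * L.stride + j % L.stride) =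
      L.pos 5 (k * L.stride + K) j := by
  funext a
  fin_cases a
  · exact (mul_add_div_of_lt hK).symm
  · change K * L.stride + j % L.stride = (k * L.stride + K) % L.stride * L.stride + j % L.stride
    rw [Nat.mul_add_mod_self_right, Nat.mod_eq_of_lt hK]
  · rfl

-- With `k % stride = e * batch + b`, the vertex `k` is treated by the batch `e` in the `b`-th layer
-- of the entry.
theorem exists_layer (hL : L.Valid) (i j k : ℕ) :
    ∃ z < 8 * L.s, z % (L.stride * L.stride) = i % L.stride * L.stride + j % L.stride ∧
      ∃ e < L.batches, k % L.stride = midClass L e (layerPos L i j z) := by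
  have hbatch : 0 < L.batch := zero_lt_two.trans_le hL.two_le_batch
  have hlt : i % L.stride * L.stride + j % L.stride < L.stride * L.stride :=
    mul_add_lt_of_mul_le (Nat.mod_lt i hL.stride_pos) (Nat.mod_lt j hL.stride_pos) le_rfl
  refine ⟨k % L.stride % L.batch * (L.stride * L.stride) +
    (i % L.stride * L.stride + j % L.stride), ?_, ?_, k % L.stride / L.batch, ?_, ?_⟩
  · exact mul_add_lt_of_mul_le (Nat.mod_lt _ hbatch) hlt (Nat.div_mul_le_self _ _)
  · rw [Nat.mul_add_mod_self_right, Nat.mod_eq_of_lt hlt]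
  · rw [Nat.div_lt_iff_lt_mul hbatch]
    exact (Nat.mod_lt k hL.stride_pos).trans_le hL.stride_le_batches_mul
  · change k % L.stride = k % L.stride / L.batch * L.batch + (_ + _) / (L.stride * L.stride)
    rw [mul_add_div_of_lt hlt, Nat.div_add_mod']

end Layer

open Classical in
theorem consumeMul_prod {A : PathAlgebra} {L : Layout} {e k : ℕ} {p : Pos} {src : Fin 3 → Word}
    {l : Store} {c : Word} (hc : midClass L e p < L.stride →
      ⟨A.mul.eval (src 2).wt (src 0).wt, k * L.stride + midClass L e p + 1⟩ = c) :
    (consumeMul A L e p k src l).prod =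
      if (midClass L e p < L.stride ∧ k * L.stride + midClass L e p < L.n) ∧
        A.Better c.wt l.prod.wt then c else l.prod := by
  by_cases hK : midClass L e p < L.stride
  · rw [← hc hK]
    simp only [consumeMul, and_assoc]
    split_ifs <;> rfl
  · simp only [consumeMul, hK, false_and, if_false]

open Classical in
theorem consumeReduce_entry {A : PathAlgebra} {L : Layout} {k : ℕ} {p : Pos} {src : Fin 3 → Word}
    {l : Store} : (consumeReduce A L p k src l).entry =
      if k % (L.stride * L.stride) = p 1 ∧ A.Better (src 1).wt l.entry.wt then src 1
      else l.entry := by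
  rw [consumeReduce]
  split_ifs <;> rfl

theorem iter_ite_eq {β : Type*} {S c : ℕ} (hc : c < S) (w : ℕ → β) (x : β) :
    iter (fun k x => if k = c then w k else x) S x = w c := by
  rw [iter_eq_ite (c := c) fun k x hk => if_neg hk, if_pos hc, if_pos rfl]

namespace IsRun

variable {A : PathAlgebra} {L : Layout} {q φ e : ℕ} {inp : Pos → EReal} {lam : ℕ → Pos → Store}
  {p : Pos}

theorem prod_step (hr : IsRun A L q inp lam) (hφ : φ < q) {f : ℕ} (hf : f ≤ 2 * L.batches)
    (hp : ∀ a, p a < 8 * L.s) :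
    lam (31 + φ * L.period + f + 1) p = iter (fun k => consumeProd A L f p k fun a =>
      loadProd L f a (lam (31 + φ * L.period + f) (Function.update p a k))) (8 * L.s)
      (lam (31 + φ * L.period + f) p) := by
  rw [hr _ p hp]
  have hperiod : f < L.period := Nat.lt_succ_of_le hf
  have hlast : φ * L.period + f < q * L.period := mul_add_lt_of_mul_le hφ hperiod le_rfl
  have hmod : (31 + φ * L.period + f - 31) % L.period = f := by
    rw [add_assoc, Nat.add_sub_cancel_left, Nat.mul_add_mod_self_right, Nat.mod_eq_of_lt hperiod]
  congr 1
  funext k l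
  simp only [consumeRound, loadRound, if_neg (show ¬ 31 + φ * L.period + f = 0 by omega),
    if_neg (show ¬ 31 + φ * L.period + f < 31 by omega),
    if_pos (show 31 + φ * L.period + f < 31 + q * L.period by omega), hmod]

theorem prod_entry (hr : IsRun A L q inp lam) (hφ : φ < q) {f : ℕ} (hf : f ≤ 2 * L.batches)
    (hp : ∀ a, p a < 8 * L.s) :
    (lam (31 + φ * L.period + f) p).entry = (lam (31 + φ * L.period) p).entry := by
  induction f with
  | zero => rfl
  | succ f ih =>
    rw [← add_assoc, ← ih (by omega), hr.prod_step hφ (by omega) hp]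
    refine map_iter_of_forall_eq Store.entry (fun k l => ?_) _ _
    rw [consumeProd, if_neg (by omega)]
    split_ifs
    · rfl
    · simp only [consumeMul]
      split_ifs <;> rfl

theorem fetch_step (hr : IsRun A L q inp lam) (hφ : φ < q) (he : e < L.batches)
    (hp : ∀ a, p a < 8 * L.s) :
    lam (31 + φ * L.period + 2 * e + 1) p = iter (fun k => consumeFetch A L e p k fun a =>
      (lam (31 + φ * L.period + 2 * e) (Function.update p a k)).entry) (8 * L.s)
      (lam (31 + φ * L.period + 2 * e) p) := by
  rw [hr.prod_step hφ (by omega) hp]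
  congr 1
  funext k l
  simp only [consumeProd, loadProd, if_neg (show ¬ 2 * e = 2 * L.batches by omega),
    if_pos (show 2 * e % 2 = 0 by omega), show 2 * e / 2 = e by omega]

theorem fetch_fst (hr : IsRun A L q inp lam) (hL : L.Valid) (hφ : φ < q) (he : e < L.batches)
    (hp : ∀ a, p a < 8 * L.s) (hK : midClass L e p < L.stride) :
    (lam (31 + φ * L.period + 2 * e + 1) p).fst = (lam (31 + φ * L.period) (Function.update p 1
      (p 1 % (L.stride * L.stride) / L.stride * L.stride + midClass L e p))).entry := by
  have hu := hL.stride_pos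
  have hI : p 1 % (L.stride * L.stride) / L.stride < L.stride := by
    rw [Nat.div_lt_iff_lt_mul hu]
    exact Nat.mod_lt _ (Nat.mul_pos hu hu)
  have hc : p 1 % (L.stride * L.stride) / L.stride * L.stride + midClass L e p < 8 * L.s :=
    mul_add_lt_of_mul_le hI hK hL.stride_mul_self_le'
  rw [hr.fetch_step hφ he hp, ← hr.prod_entry hφ (f := 2 * e) (by omega) (Pos.update_lt hp hc 1),
    ← iter_ite_eq hc fun k => (lam (31 + φ * L.period + 2 * e) (Function.update p 1 k)).entry]
  exact map_iter Store.fst (fun _ _ => rfl) _ _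

theorem fetch_snd (hr : IsRun A L q inp lam) (hL : L.Valid) (hφ : φ < q) (he : e < L.batches)
    (hp : ∀ a, p a < 8 * L.s) (hK : midClass L e p < L.stride) :
    (lam (31 + φ * L.period + 2 * e + 1) p).snd = (lam (31 + φ * L.period) (Function.update p 1
      (midClass L e p * L.stride + p 1 % L.stride))).entry := by
  have hc : midClass L e p * L.stride + p 1 % L.stride < 8 * L.s :=
    mul_add_lt_of_mul_le hK (Nat.mod_lt _ hL.stride_pos) hL.stride_mul_self_le'
  rw [hr.fetch_step hφ he hp, ← hr.prod_entry hφ (f := 2 * e) (by omega) (Pos.update_lt hp hc 1),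
    ← iter_ite_eq hc fun k => (lam (31 + φ * L.period + 2 * e) (Function.update p 1 k)).entry]
  exact map_iter Store.snd (fun _ _ => rfl) _ _

theorem fetch_prod (hr : IsRun A L q inp lam) (hL : L.Valid) (hφ : φ < q) (he : e < L.batches)
    (hp : ∀ a, p a < 8 * L.s) :
    (lam (31 + φ * L.period + 2 * e + 1) p).prod =
      if e = 0 then ⟨A.worst.eval, 0⟩ else (lam (31 + φ * L.period + 2 * e) p).prod := by
  rw [hr.fetch_step hφ he hp]
  split_ifs with h0
  · obtain ⟨S, hS⟩ := Nat.exists_eq_add_of_le' (show 1 ≤ 8 * L.s by have := hL.s_pos; omega)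
    simp only [hS, iter, consumeFetch, h0, if_true]
  · refine map_iter_of_forall_eq Store.prod (fun k l => ?_) _ _
    simp only [consumeFetch, if_neg h0]

theorem mul_step (hr : IsRun A L q inp lam) (hφ : φ < q) (he : e < L.batches)
    (hp : ∀ a, p a < 8 * L.s) :
    lam (31 + φ * L.period + 2 * (e + 1)) p = iter (fun k => consumeMul A L e p k fun a =>
      if a = 2 then (lam (31 + φ * L.period + 2 * e + 1) (Function.update p a k)).fst
      else (lam (31 + φ * L.period + 2 * e + 1) (Function.update p a k)).snd) (8 * L.s)
      (lam (31 + φ * L.period + 2 * e + 1) p) := by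
  rw [show 31 + φ * L.period + 2 * (e + 1) = 31 + φ * L.period + (2 * e + 1) + 1 by omega,
    hr.prod_step hφ (f := 2 * e + 1) (by omega) hp, ← add_assoc]
  congr 1
  funext k l
  simp only [consumeProd, loadProd, if_neg (show ¬ 2 * e + 1 = 2 * L.batches by omega),
    if_neg (show ¬ (2 * e + 1) % 2 = 0 by omega), show (2 * e + 1) / 2 = e by omega]

theorem reduce_step (hr : IsRun A L q inp lam) (hφ : φ < q) (hp : ∀ a, p a < 8 * L.s) :
    lam (31 + (φ + 1) * L.period) p = iter (fun k => consumeReduce A L p k fun a =>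
      (lam (31 + φ * L.period + 2 * L.batches) (Function.update p a k)).prod) (8 * L.s)
      (lam (31 + φ * L.period + 2 * L.batches) p) := by
  rw [show 31 + (φ + 1) * L.period = 31 + φ * L.period + 2 * L.batches + 1 by
    rw [Layout.period]; ring, hr.prod_step hφ le_rfl hp]
  congr 1
  funext k l
  simp only [consumeProd, loadProd, if_true]

section Layer

variable {i j z : ℕ}

theorem fetched_mul (hr : IsRun A L q inp lam) (hL : L.Valid) (hφ : φ < q) (he : e < L.batches)
    (hi : i < L.n) (hj : j < L.n) (hz : z < 8 * L.s)
    (hmod : z % (L.stride * L.stride) = i % L.stride * L.stride + j % L.stride) {k : ℕ}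
    (hk : k < 8 * L.s) (hK : midClass L e (layerPos L i j z) < L.stride) :
    A.mul.eval
      (lam (31 + φ * L.period + 2 * e + 1) (Function.update (layerPos L i j z) 2 k)).fst.wt
      (lam (31 + φ * L.period + 2 * e + 1) (Function.update (layerPos L i j z) 0 k)).snd.wt =
      (candidate A L lam φ i j (k * L.stride + midClass L e (layerPos L i j z))).wt := by
  have hp := layerPos_lt hL hi hj hz
  have hrow : z % (L.stride * L.stride) / L.stride = i % L.stride := by
    rw [hmod, mul_add_div_of_lt (Nat.mod_lt j hL.stride_pos)]
  have hcol : z % L.stride = j % L.stride := by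
    rw [← Nat.mod_mul_right_mod z L.stride L.stride, hmod, Nat.mul_add_mod_self_right, Nat.mod_mod]
  have hfst := hr.fetch_fst hL hφ he (Pos.update_lt hp hk 2) (by rwa [midClass_update (by decide)])
  have hsnd := hr.fetch_snd hL hφ he (Pos.update_lt hp hk 0) (by rwa [midClass_update (by decide)])
  rw [midClass_update (by decide), Function.update_of_ne (by decide),
    show layerPos L i j z 1 = z from rfl] at hfst hsnd
  rw [hrow, update_layerPos_two hK] at hfst
  rw [hcol, update_layerPos_zero hK] at hsnd
  rw [hfst, hsnd]
  rfl

theorem mul_isBest (hr : IsRun A L q inp lam) (hL : L.Valid) (hφ : φ < q) (he : e < L.batches)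
    (hi : i < L.n) (hj : j < L.n) (hz : z < 8 * L.s)
    (hmod : z % (L.stride * L.stride) = i % L.stride * L.stride + j % L.stride) :
    A.IsBest (lam (31 + φ * L.period + 2 * e + 1) (layerPos L i j z)).prod
      (candidate A L lam φ i j) {k | k < L.n ∧ k % L.stride = midClass L e (layerPos L i j z)}
      (lam (31 + φ * L.period + 2 * (e + 1)) (layerPos L i j z)).prod := by
  have hcell := layerPos_lt hL hi hj hz
  set K := midClass L e (layerPos L i j z)
  have hset : (fun k => k * L.stride + K) ''
      {k | k < 8 * L.s ∧ K < L.stride ∧ k * L.stride + K < L.n} =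
      {k | k < L.n ∧ k % L.stride = K} := by
    ext k
    constructor
    · rintro ⟨k, ⟨-, hKu, hk⟩, rfl⟩
      exact ⟨hk, by rw [Nat.mul_add_mod_self_right, Nat.mod_eq_of_lt hKu]⟩
    · rintro ⟨hk, hkK⟩
      have hdiv := hL.div_stride_lt hk
      have hsplit : k / L.stride * L.stride + K = k := by rw [← hkK, Nat.div_add_mod']
      exact ⟨k / L.stride, ⟨hdiv.trans_le (Nat.le_mul_of_pos_left _ (by norm_num)),
        hkK ▸ Nat.mod_lt _ hL.stride_pos, hsplit.trans_lt hk⟩, hsplit⟩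
  rw [← hset, hr.mul_step hφ he hcell]
  refine (PathAlgebra.isBest_iter Store.prod (fun k hk l => ?_) _).image
  convert consumeMul_prod (c := candidate A L lam φ i j (k * L.stride + K)) fun hKu => ?_
  exact Word.ext (hr.fetched_mul hL hφ he hi hj hz hmod hk hKu) rfl

theorem layer_isBest (hr : IsRun A L q inp lam) (hL : L.Valid) (hφ : φ < q) (he : e < L.batches)
    (hi : i < L.n) (hj : j < L.n) (hz : z < 8 * L.s)
    (hmod : z % (L.stride * L.stride) = i % L.stride * L.stride + j % L.stride) :
    A.IsBest ⟨A.worst.eval, 0⟩ (candidate A L lam φ i j)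
      {k | k < L.n ∧ ∃ e' ≤ e, k % L.stride = midClass L e' (layerPos L i j z)}
      (lam (31 + φ * L.period + 2 * (e + 1)) (layerPos L i j z)).prod := by
  have hcell := layerPos_lt hL hi hj hz
  induction e with
  | zero =>
    have hbest := hr.mul_isBest hL hφ he hi hj hz hmod
    rw [hr.fetch_prod hL hφ he hcell, if_pos rfl] at hbest
    simpa only [nonpos_iff_eq_zero, exists_eq_left] using hbest
  | succ e ih =>
    have hbest := hr.mul_isBest hL hφ he hi hj hz hmod
    rw [hr.fetch_prod hL hφ he hcell, if_neg e.succ_ne_zero] at hbest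
    convert (ih (by omega)).union hbest using 1
    ext k
    simp only [Set.mem_ofPred_eq, Set.mem_union, Nat.le_succ_iff, or_and_right, exists_or,
      exists_eq_left, and_or_left]

end Layer

theorem matrixEntry_succ_isBest (hr : IsRun A L q inp lam) (hL : L.Valid)
    (hworst : ∀ x, ¬ A.Better A.worst.eval x) (hφ : φ < q) {i j : ℕ} (hi : i < L.n)
    (hj : j < L.n) :
    A.IsBest (matrixEntry L lam φ i j) (candidate A L lam φ i j) {k | k < L.n}
      (matrixEntry L lam (φ + 1) i j) := by
  have hcell := hL.pos_lt 5 hi hj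
  have hreduce : A.IsBest (matrixEntry L lam φ i j)
      (fun z => (lam (31 + φ * L.period + 2 * L.batches) (layerPos L i j z)).prod)
      {z | z < 8 * L.s ∧ z % (L.stride * L.stride) = i % L.stride * L.stride + j % L.stride}
      (matrixEntry L lam (φ + 1) i j) := by
    rw [matrixEntry, matrixEntry, hr.reduce_step hφ hcell, ← hr.prod_entry hφ le_rfl hcell]
    refine PathAlgebra.isBest_iter Store.entry (fun z _ l => ?_) _
    rw [← update_pos_five]
    convert consumeReduce_entry
    rfl
  obtain ⟨E, hE⟩ := Nat.exists_eq_add_of_le' hL.batches_pos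
  have hbest := hreduce.biUnion hworst fun z hz =>
    hE ▸ hr.layer_isBest hL hφ (by omega) hi hj hz.1 hz.2
  convert hbest using 1
  ext k
  simp only [Set.mem_ofPred_eq, Set.mem_iUnion, exists_prop]
  refine ⟨fun hk => ?_, fun ⟨_, _, hk, _⟩ => hk⟩
  obtain ⟨z, hz, hzmod, e, he, hke⟩ := exists_layer hL i j k
  exact ⟨z, ⟨hz, hzmod⟩, hk, e, by omega, hke⟩

end IsRun

/-! ### The output of the program -/

theorem Layout.Valid.batches_le_stride {L : Layout} (h : L.Valid) : L.batches ≤ L.stride := by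
  have hbatch : 0 < L.batch := zero_lt_two.trans_le h.two_le_batch
  exact (ceilDiv_le_iff_le_mul hbatch).mpr (Nat.le_mul_of_pos_left _ hbatch)

theorem clog_two_le_two_mul {n s : ℕ} (hn : n ≤ s * s) : Nat.clog 2 n ≤ 2 * s :=
  Nat.clog_le_of_le_pow <| calc
    n ≤ s * s := hn
    _ ≤ 2 ^ s * 2 ^ s := Nat.mul_le_mul Nat.lt_two_pow_self.le Nat.lt_two_pow_self.le
    _ = 2 ^ (2 * s) := by rw [← pow_add, two_mul]

/-- The layout of the input of order `n` on the mesh of edge length `s`. -/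
def meshLayout (n s : ℕ) : Layout := ⟨n, s, inputSide n⟩

/-- The time at which the output is written. -/
def endTime (n s : ℕ) : ℕ := 32 * s * rounds (meshLayout n s) (Nat.clog 2 n)

/-- The matrix entry that a processor holds at the beginning. -/
def procInput {n s : ℕ} (X : Fin n → Fin n → EReal) (P : Proc s) : EReal :=
  (entryAt n P).elim 0 fun e => X e.1 e.2

open Classical in
/-- The matrix entry that a cell holds at the beginning: only the cell at the corner of the block
of its processor has one. -/
def cellInput {n : ℕ} (s : ℕ) (X : Fin n → Fin n → EReal) (p : Pos) : EReal :=
  if h : ∃ P : Proc s, cellPos P 0 = p then procInput X h.choose else 0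

/-- The memories after `t` steps of the path program on the input `X`. -/
def pathRun {n : ℕ} (A : PathAlgebra) (s : ℕ) (X : Fin n → Fin n → EReal) (t : ℕ) : MeshState s :=
  (pathProgram A).run s X t

section Output

variable {n s : ℕ}

theorem meshLayout_valid (hn : 1 ≤ n) (hs : inputSide n ≤ s) : (meshLayout n s).Valid :=
  ⟨hn, sq_le_inputSide n, inputSide_le n, hs⟩

theorem le_side_mul_side (hn : 1 ≤ n) (hs : inputSide n ≤ s) : n ≤ s * s :=
  (meshLayout_valid hn hs).n_le.trans (Nat.mul_le_mul hs hs)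

theorem thirtyTwo_mul_le_endTime (n s : ℕ) : 32 * s ≤ endTime n s :=
  Nat.le_mul_of_pos_right _ (by rw [rounds]; omega)

theorem endTime_le (hn : 1 ≤ n) (hs : inputSide n ≤ s) : endTime n s ≤ 4096 * s ^ 4 := by
  have hL := meshLayout_valid hn hs
  have hs1 : 1 ≤ s := hL.s_pos
  have hclog := clog_two_le_two_mul (le_side_mul_side hn hs)
  have hbatches := hL.batches_le_stride.trans (hL.stride_le_m.trans hs)
  have hrounds : rounds (meshLayout n s) (Nat.clog 2 n) ≤ 61 + 2 * s * (2 * s + 1) := by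
    rw [rounds, Layout.period]
    gcongr
  calc endTime n s ≤ 32 * s * (61 + 2 * s * (2 * s + 1)) := Nat.mul_le_mul_left _ hrounds
    _ = 1952 * s ^ 1 + 128 * s ^ 3 + 64 * s ^ 2 := by ring
    _ ≤ 1952 * s ^ 4 + 128 * s ^ 4 + 64 * s ^ 4 := by
        gcongr <;> norm_num
    _ ≤ 4096 * s ^ 4 := by omega

theorem mul_pow_lt_wordSize (A : PathAlgebra) (s : ℕ) :
    8192 * s ^ 4 < (pathProgram A).wordSize s := by
  have hs : s < 2 ^ (Nat.log 2 (s ^ 3) + 1) :=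
    (Nat.le_self_pow (by norm_num) s).trans_lt (Nat.lt_pow_succ_log_self one_lt_two _)
  have hbase : 2 ≤ 2 ^ (Nat.log 2 (s ^ 3) + 1) := Nat.le_self_pow (by omega) 2
  rw [MeshProgram.wordSize, show (pathProgram A).wordLen = 40 from rfl, mul_comm 40, pow_mul]
  generalize 2 ^ (Nat.log 2 (s ^ 3) + 1) = b at *
  calc 8192 * s ^ 4 < 8192 * b ^ 4 :=
        Nat.mul_lt_mul_of_pos_left (Nat.pow_lt_pow_left hs (by norm_num)) (by norm_num)
    _ = 2 ^ 13 * b ^ 4 := by norm_num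
    _ ≤ b ^ 13 * b ^ 4 := Nat.mul_le_mul_right _ (Nat.pow_le_pow_left hbase 13)
    _ = b ^ 17 := by rw [← pow_add]
    _ ≤ b ^ 40 := Nat.pow_le_pow_right (by omega) (by norm_num)

theorem endTime_lt_wordSize (A : PathAlgebra) (hn : 1 ≤ n) (hs : inputSide n ≤ s) :
    endTime n s < (pathProgram A).wordSize s :=
  (endTime_le hn hs).trans_lt (by have := mul_pow_lt_wordSize A s; omega)

theorem side_lt_wordSize (A : PathAlgebra) (s : ℕ) : s < (pathProgram A).wordSize s := by
  have := mul_pow_lt_wordSize A s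
  have := Nat.le_self_pow (show 4 ≠ 0 by norm_num) s
  omega

theorem two_mul_lt_wordSize (A : PathAlgebra) (hn : 1 ≤ n) (hs : inputSide n ≤ s) :
    2 * n < (pathProgram A).wordSize s := by
  have hpow : s * s ≤ s ^ 4 := by
    rw [show s ^ 4 = s * s * (s * s) by ring]
    exact Nat.le_mul_self _
  have := mul_pow_lt_wordSize A s
  have := le_side_mul_side hn hs
  omega

theorem inputSideAt_of_le (hs : inputSide n ≤ s) {t : ℕ} (ht : 32 * s ≤ t) :
    inputSideAt n t = inputSide n := by
  rw [inputSideAt_eq]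
  omega

theorem productsAt_of_le (hn : 1 ≤ n) (hs : inputSide n ≤ s) {t : ℕ} (ht : 32 * s ≤ t) :
    productsAt n t = Nat.clog 2 n := by
  have := clog_two_le_two_mul (le_side_mul_side hn hs)
  rw [productsAt_eq]
  omega

theorem mul_rounds_layoutAt (hn : 1 ≤ n) (hs : inputSide n ≤ s) {t : ℕ} (ht : 32 * s ≤ t) :
    32 * s * rounds (layoutAt n s t) (productsAt n t) = endTime n s := by
  rw [layoutAt, inputSideAt_of_le hs ht, productsAt_of_le hn hs ht, endTime, meshLayout]

theorem lt_mul_rounds_layoutAt (hn : 1 ≤ n) (hs : inputSide n ≤ s) {t : ℕ}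
    (ht : t < endTime n s) : t < 32 * s * rounds (layoutAt n s t) (productsAt n t) := by
  rcases lt_or_ge t (32 * s) with h | h
  · exact h.trans_le (Nat.le_mul_of_pos_right _ (by rw [rounds]; omega))
  · rwa [mul_rounds_layoutAt hn hs h]

theorem cellPos_inj {P Q : Proc s} {o o' : Offset} (h : cellPos P o = cellPos Q o') :
    P = Q ∧ o = o' := by
  have hcoord : ∀ a, 8 * (P a : ℕ) + o a = 8 * (Q a : ℕ) + o' a := congrFun h
  exact ⟨funext fun a => Fin.ext (by have := hcoord a; omega),
    funext fun a => Fin.ext (by have := hcoord a; omega)⟩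

theorem cellInput_cellPos (X : Fin n → Fin n → EReal) (P : Proc s) (o : Offset) :
    cellInput s X (cellPos P o) = if o = 0 then procInput X P else 0 := by
  rw [cellInput]
  split_ifs with h ho ho
  · rw [(cellPos_inj h.choose_spec).1]
  · exact absurd (cellPos_inj h.choose_spec).2.symm ho
  · exact absurd ⟨P, by rw [ho]⟩ h
  · rfl

theorem pathRun_succ (A : PathAlgebra) (X : Fin n → Fin n → EReal) (t : ℕ) :
    pathRun A s X (t + 1) = pathStep A (pathRun A s X t) :=
  Function.iterate_succ_apply' (pathProgram A).step t _

theorem init_num_eq_zero (Q : MeshProgram) (X : Fin n → Fin n → EReal) (P : Proc s)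
    (r : Fin (Q.numExtra + 7)) (hr : 5 ≤ (r : ℕ)) : (Q.init s X P).num r = 0 := by
  obtain ⟨k, hk⟩ := Nat.exists_eq_add_of_le' hr
  simp only [MeshProgram.init, hk]

theorem init_wt_zero (Q : MeshProgram) (X : Fin n → Fin n → EReal) (P : Proc s) :
    (Q.init s X P).wt 0 = procInput X P := by
  simp only [MeshProgram.init, procInput, if_true]
  cases entryAt n P <;> rfl

theorem init_wt_eq_zero (Q : MeshProgram) (X : Fin n → Fin n → EReal) (P : Proc s)
    {r : Fin (Q.wtExtra + 1)} (hr : r ≠ 0) : (Q.init s X P).wt r = 0 := if_neg hr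

theorem simulates_init (A : PathAlgebra) (X : Fin n → Fin n → EReal) :
    Simulates A n s (cellInput s X) (procInput X) 0 (pathRun A s X 0) := by
  have hnum : ∀ P i (k : ℕ), (numIndex i : ℕ) = k → 5 ≤ k →
      (pathRun A s X 0 P).num (numIndex i) = 0 :=
    fun P i k hi hk => init_num_eq_zero (pathProgram A) X P (numIndex i) (hi ▸ hk)
  have hscalar : ∀ P (r : Fin 11), 5 ≤ (r : ℕ) → scalar r (meshView (pathRun A s X 0) P) = 0 :=
    fun P r hr => hnum P _ r (val_numIndex_inl r) hr
  have hnum_val : ∀ P (r : Fin 11) (k : ℕ), (r : ℕ) = k → scalar r (meshView (pathRun A s X 0) P) =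
      match k with
      | 0 => n
      | 1 => s
      | 2 => P 0
      | 3 => P 1
      | 4 => P 2
      | _ => 0 := by
    rintro P r k rfl
    rw [← val_numIndex_inl r]
    rfl
  refine ⟨fun P => ?_, fun P a => ?_, fun P => hscalar P 5 le_rfl,
    fun P => hscalar P 7 (by decide), fun P => hscalar P 9 (by decide),
    fun P => hscalar P 10 (by decide), fun P => ?_, fun P i => ?_⟩
  · exact (Layout.mk.injEq ..).mpr ⟨hnum_val P 0 0 rfl, hnum_val P 1 1 rfl, hscalar P 8 (by decide)⟩
  · fin_cases a
    exacts [hnum_val P 2 2 rfl, hnum_val P 3 3 rfl, hnum_val P 4 4 rfl]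
  · rw [wtIndex_none]
    exact init_wt_zero (pathProgram A) X P
  · rw [show cellRun A n s (cellInput s X) 0 (cellPos P i.1) = Cell.blank from rfl, Cell.get_blank]
    have hwt : wtIndex (some i) ≠ 0 := by
      rw [← wtIndex_none]
      exact wtIndex.injective.ne (Option.some_ne_none i)
    refine Word.ext (init_wt_eq_zero (pathProgram A) X P hwt) (hnum P (.inr i) _ rfl ?_)
    exact (Nat.le_add_left 5 6).trans (le_val_numIndex_inr i)

theorem simulates_run (A : PathAlgebra) (hn : 1 ≤ n) (hs : inputSide n ≤ s)
    (X : Fin n → Fin n → EReal) (t : ℕ) (ht : t ≤ endTime n s) :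
    Simulates A n s (cellInput s X) (procInput X) t (pathRun A s X t) := by
  induction t with
  | zero => exact simulates_init A X
  | succ t ih =>
    rw [pathRun_succ]
    exact (ih (by omega)).step (cellInput_cellPos X) (lt_mul_rounds_layoutAt hn hs ht)
      (two_mul_lt_wordSize A hn hs) (side_lt_wordSize A s)
      (ht.trans_lt (endTime_lt_wordSize A hn hs))

theorem numIndex_inl_five : (5 : Fin (dataCard + 4 + 7)) = numIndex (.inl 5) :=
  Fin.ext ((Nat.mod_eq_of_lt (show 5 < dataCard + 4 + 7 by omega)).trans (val_numIndex_inl 5).symm)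

theorem numIndex_inl_six : (6 : Fin (dataCard + 4 + 7)) = numIndex (.inl 6) :=
  Fin.ext ((Nat.mod_eq_of_lt (show 6 < dataCard + 4 + 7 by omega)).trans (val_numIndex_inl 6).symm)

theorem outputs_of_cellRun (A : PathAlgebra) (hn : 1 ≤ n) (hs : inputSide n ≤ s)
    (X D : Fin n → Fin n → EReal) (mid : Fin n → Fin n → ℕ)
    (h : ∀ i j, ∃ P : Proc s, entryAt n P = some (i, j) ∧
      (cellRun A n s (cellInput s X) (endTime n s) (cellPos P 0)).store.io = ⟨D i j, mid i j⟩) :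
    (pathProgram A).Outputs s X (endTime n s + 1) D mid := by
  have hs1 : 1 ≤ s := (meshLayout_valid hn hs).s_pos
  have hword := two_mul_lt_wordSize A hn hs
  have hlast := (simulates_run A hn hs X (endTime n s) le_rfl).last
    (mul_rounds_layoutAt hn hs (thirtyTwo_mul_le_endTime n s)).le (by omega) (by omega)
  rw [← pathRun_succ] at hlast
  have hflag : ∀ t (P : Proc s), ((pathProgram A).run s X t P).num 5 =
      (pathRun A s X t P).num (numIndex (.inl 5)) :=
    fun t P => congrArg (pathRun A s X t P).num numIndex_inl_five
  refine ⟨⟨fun P => ?_, fun t ht hhalt => ?_⟩, fun i j => ?_⟩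
  · exact ne_of_eq_of_ne ((hflag _ P).trans (hlast P).1) one_ne_zero
  · exact hhalt (fun _ => ⟨0, hs1⟩)
      ((hflag _ _).trans ((simulates_run A hn hs X t (by omega)).flag _))
  · obtain ⟨P, hP, hio⟩ := h i j
    refine ⟨P, hP, (hlast P).2.2.trans (congrArg Word.wt hio), ?_⟩
    exact (congrArg (pathRun A s X _ P).num numIndex_inl_six).trans
      ((hlast P).2.1.trans (congrArg Word.num hio))

theorem exists_proc (hn : 1 ≤ n) (hs : inputSide n ≤ s) (i j : Fin n) :
    ∃ P : Proc s, entryAt n P = some (i, j) ∧ cellPos P 0 = (meshLayout n s).pos 0 i j := by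
  have hm : 1 ≤ inputSide n := (meshLayout_valid hn hs).m_pos
  obtain ⟨x, hx⟩ : ∃ x, x = (i : ℕ) * n + j := ⟨_, rfl⟩
  have hxlt : x < n * n := hx ▸ mul_add_lt_of_mul_le i.2 j.2 le_rfl
  have h0 : x / (inputSide n * inputSide n) < inputSide n := by
    rw [Nat.div_lt_iff_lt_mul (Nat.mul_pos hm hm), ← mul_assoc]
    exact hxlt.trans_le (sq_le_inputSide n)
  have h1 : x / inputSide n % inputSide n < inputSide n := Nat.mod_lt _ hm
  have h2 : x % inputSide n < inputSide n := Nat.mod_lt _ hm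
  have hdigits : (x / (inputSide n * inputSide n) * inputSide n + x / inputSide n % inputSide n) *
      inputSide n + x % inputSide n = x := by
    rw [← Nat.div_div_eq_div_mul, Nat.div_add_mod', Nat.div_add_mod']
  have hrow : x / n = i := by rw [hx, mul_add_div_of_lt j.2]
  have hcol : x % n = j := by rw [hx, Nat.mul_add_mod_self_right, Nat.mod_eq_of_lt j.2]
  refine ⟨![⟨_, h0.trans_le hs⟩, ⟨_, h1.trans_le hs⟩, ⟨_, h2.trans_le hs⟩], ?_, ?_⟩
  · refine (dif_pos ⟨⟨h0, h1, h2⟩, hdigits.trans_lt hxlt⟩).trans (congrArg some (Prod.ext ?_ ?_))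
    · exact Fin.ext ((congrArg (· / n) hdigits).trans hrow)
    · exact Fin.ext ((congrArg (· % n) hdigits).trans hcol)
  · subst hx
    funext a
    fin_cases a <;>
      simp [cellPos, Layout.pos, Layout.coord0, Layout.coord1, Layout.coord2, meshLayout]

theorem exists_entries (A : PathAlgebra) (hworst : ∀ x, ¬ A.Better A.worst.eval x) (hn : 1 ≤ n)
    (hs : inputSide n ≤ s) (X : Fin n → Fin n → EReal) :
    ∃ ent : ℕ → ℕ → ℕ → Word,
      (∀ i j : Fin n, ent 0 i j = A.initialEntry i j ⟨X i j, 0⟩) ∧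
      (∀ φ < Nat.clog 2 n, ∀ i < n, ∀ j < n,
        A.IsBest (ent φ i j) (fun k => ⟨A.mul.eval (ent φ i k).wt (ent φ k j).wt, k + 1⟩)
          {k | k < n} (ent (φ + 1) i j)) ∧
      (pathProgram A).Outputs s X (endTime n s + 1) (fun i j => (ent (Nat.clog 2 n) i j).wt)
        (fun i j => (ent (Nat.clog 2 n) i j).num) := by
  have hL := meshLayout_valid hn hs
  have hrun : IsRun A (meshLayout n s) (Nat.clog 2 n) (cellInput s X)
      fun ρ p => (cellRun A n s (cellInput s X) (32 * s * ρ) p).store :=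
    isRun_cellRun A (cellInput s X) (fun _ => inputSideAt_of_le hs)
      (fun _ => productsAt_of_le hn hs)
  refine ⟨matrixEntry (meshLayout n s) _, fun i j => ?_,
    fun φ hφ i hi j hj => hrun.matrixEntry_succ_isBest hL hworst hφ hi hj, ?_⟩
  · obtain ⟨P, hP, hpos⟩ := exists_proc hn hs i j
    have hentry := hrun.in_entry hL i.2 j.2
    rw [← hpos, cellInput_cellPos, if_pos rfl, procInput, hP] at hentry
    rw [matrixEntry, zero_mul, add_zero, hentry]
    rfl
  · refine outputs_of_cellRun A hn hs X _ _ fun i j => ?_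
    obtain ⟨P, hP, hpos⟩ := exists_proc hn hs i j
    exact ⟨P, hP, hpos ▸ hrun.out_io hL i.2 j.2⟩

end Output

/-! ### Optimal paths by repeated products -/

theorem WtOp.eval_assoc (op : WtOp) (x y z : EReal) :
    op.eval (op.eval x y) z = op.eval x (op.eval y z) := by
  cases op
  exacts [add_assoc x y z, inf_assoc x y z, sup_assoc x y z]

theorem WtOp.eval_mono (op : WtOp) {x x' y y' : EReal} (hx : x ≤ x') (hy : y ≤ y') :
    op.eval x y ≤ op.eval x' y' := by
  cases op
  exacts [add_le_add hx hy, inf_le_inf hx hy, sup_le_sup hx hy]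

namespace PathAlgebra

variable {A : PathAlgebra}

/-- The value `x` is at least as good as `y`. -/
def AsGood (A : PathAlgebra) (x y : EReal) : Prop := ¬ A.Better y x

theorem asGood_iff {x y : EReal} : A.AsGood x y ↔ if A.maximize then y ≤ x else x ≤ y := by
  unfold AsGood Better
  split_ifs <;> exact not_lt

namespace AsGood

theorem refl (x : EReal) : A.AsGood x x := Better.irrefl x

theorem trans {x y z : EReal} (h : A.AsGood x y) (h' : A.AsGood y z) : A.AsGood x z :=
  Better.not_trans h' h

theorem antisymm {x y : EReal} (h : A.AsGood x y) (h' : A.AsGood y x) : x = y := by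
  rw [asGood_iff] at *
  split_ifs at *
  exacts [le_antisymm h' h, le_antisymm h h']

theorem mul {x x' y y' : EReal} (hx : A.AsGood x x') (hy : A.AsGood y y') :
    A.AsGood (A.mul.eval x y) (A.mul.eval x' y') := by
  rw [asGood_iff] at *
  split_ifs at * <;> exact WtOp.eval_mono _ hx hy

end AsGood

end PathAlgebra

namespace DiPath

variable {n : ℕ} {G : WDigraph n}

/-- The number of edges of a path. -/
def edges : {i j : Fin n} → DiPath G i j → ℕ
  | _, _, nil _ => 0
  | _, _, cons _ _ p => p.edges + 1

/-- The vertices of a path, in order and with repetitions. -/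
def support : {i j : Fin n} → DiPath G i j → List (Fin n)
  | _, _, nil i => [i]
  | i, _, cons _ _ p => i :: p.support

/-- The value of a path in a path algebra: its length or its width in the two cases of interest. -/
def value (A : PathAlgebra) : {i j : Fin n} → DiPath G i j → EReal
  | _, _, nil _ => A.unit.eval
  | _, _, cons c _ p => A.mul.eval c (p.value A)

theorem length_support {i j : Fin n} (p : DiPath G i j) : p.support.length = p.edges + 1 := by
  induction p with
  | nil => rfl
  | cons c h p ih => simp [support, edges, ih]

theorem exists_append_of_mem_support {i j v : Fin n} (p : DiPath G i j) (hv : v ∈ p.support) :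
    ∃ (p₁ : DiPath G i v) (p₂ : DiPath G v j), p = p₁.append p₂ ∧ p₂.support <:+ p.support := by
  induction p with
  | nil i =>
    obtain rfl : v = i := by simpa [support] using hv
    exact ⟨nil v, nil v, rfl, List.suffix_refl _⟩
  | @cons i k j c h p ih =>
    rcases List.mem_cons.1 hv with rfl | hv'
    · exact ⟨nil v, cons c h p, rfl, List.suffix_refl _⟩
    · obtain ⟨p₁, p₂, rfl, hp⟩ := ih hv'
      exact ⟨cons c h p₁, p₂, rfl, hp.trans (List.suffix_cons _ _)⟩

theorem exists_append_of_edges_le {i j : Fin n} (p : DiPath G i j) {a b : ℕ}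
    (h : p.edges ≤ a + b) : ∃ (k : Fin n) (p₁ : DiPath G i k) (p₂ : DiPath G k j),
      p = p₁.append p₂ ∧ p₁.edges ≤ a ∧ p₂.edges ≤ b := by
  induction p generalizing a with
  | nil i => exact ⟨i, nil i, nil i, rfl, Nat.zero_le _, Nat.zero_le _⟩
  | @cons i k j c hc p ih =>
    rcases a with - | a
    · exact ⟨i, nil i, cons c hc p, rfl, Nat.zero_le _, by simpa using h⟩
    · obtain ⟨k', p₁, p₂, rfl, h₁, h₂⟩ := ih (a := a) (by simp only [edges] at h; omega)
      exact ⟨k', cons c hc p₁, p₂, rfl, Nat.succ_le_succ h₁, h₂⟩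

end DiPath

open DiPath

/-- The properties of a path algebra that make repeated products find the optimal paths in a
graph. -/
structure PathAlgebra.Suits (A : PathAlgebra) {n : ℕ} (G : WDigraph n) : Prop where
  unit_mul : ∀ x, A.mul.eval A.unit.eval x = x
  mul_unit : ∀ x, A.mul.eval x A.unit.eval = x
  worst_mul : ∀ {i j} (p : DiPath G i j), A.mul.eval A.worst.eval (p.value A) = A.worst.eval
  mul_worst : ∀ {i j} (p : DiPath G i j), A.mul.eval (p.value A) A.worst.eval = A.worst.eval
  worst_mul_worst : A.mul.eval A.worst.eval A.worst.eval = A.worst.eval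
  asGood_worst : ∀ x, A.AsGood x A.worst.eval
  unit_asGood : ∀ {i} (p : DiPath G i i), A.AsGood A.unit.eval (p.value A)
  value_ne_worst : ∀ {i j} (p : DiPath G i j), p.value A ≠ A.worst.eval

namespace PathAlgebra.Suits

variable {A : PathAlgebra} {n : ℕ} {G : WDigraph n}

theorem value_append (hA : A.Suits G) {i k j : Fin n} (p : DiPath G i k) (p' : DiPath G k j) :
    (p.append p').value A = A.mul.eval (p.value A) (p'.value A) := by
  induction p with
  | nil => exact (hA.unit_mul _).symm
  | cons c h p ih => rw [append, value, value, ih, WtOp.eval_assoc]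

theorem exists_nodup (hA : A.Suits G) {i j : Fin n} (p : DiPath G i j) :
    ∃ p' : DiPath G i j, p'.support.Nodup ∧ A.AsGood (p'.value A) (p.value A) := by
  induction p with
  | nil i => exact ⟨nil i, List.nodup_singleton i, .refl _⟩
  | @cons i k j c h p ih =>
    obtain ⟨p', hnodup, hp'⟩ := ih
    have hcons : A.AsGood ((cons c h p').value A) ((cons c h p).value A) := .mul (.refl _) hp'
    by_cases hi : i ∈ p'.support
    · obtain ⟨p₁, p₂, rfl, hsuffix⟩ := p'.exists_append_of_mem_support hi
      refine ⟨p₂, hnodup.sublist hsuffix.sublist, AsGood.trans ?_ hcons⟩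
      have hcycle := AsGood.mul (hA.unit_asGood (cons c h p₁)) (.refl (p₂.value A))
      rwa [hA.unit_mul, ← hA.value_append] at hcycle
    · exact ⟨cons c h p', List.nodup_cons.2 ⟨hi, hnodup⟩, hcons⟩

theorem exists_edges_lt (hA : A.Suits G) {i j : Fin n} (p : DiPath G i j) :
    ∃ p' : DiPath G i j, p'.edges < n ∧ A.AsGood (p'.value A) (p.value A) := by
  obtain ⟨p', hnodup, hp'⟩ := hA.exists_nodup p
  refine ⟨p', ?_, hp'⟩
  have := hnodup.length_le_card
  rwa [length_support, Fintype.card_fin] at this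

end PathAlgebra.Suits

/-- The matrices `M 0, …, M q` arise from the weight matrix of `G` by repeated squaring; each
entry keeps the intermediate vertex by which it was last improved. -/
structure IsClosure (A : PathAlgebra) {n : ℕ} (G : WDigraph n) (q : ℕ)
    (M : ℕ → Fin n → Fin n → Word) : Prop where
  diag : ∀ i, M 0 i i = ⟨A.unit.eval, 0⟩
  edge : ∀ i j, i ≠ j → M 0 i j = ⟨G.weightMatrix A.worst.eval i j, 0⟩
  step : ∀ φ < q, ∀ i j,
    A.IsBest (M φ i j) (fun k : Fin n => ⟨A.mul.eval (M φ i k).wt (M φ k j).wt, k + 1⟩) Set.univ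
      (M (φ + 1) i j)

/-- The table in `M` describes a path from `i` to `j` whose value is the entry of `M`. -/
def Describes (A : PathAlgebra) {n : ℕ} (G : WDigraph n) (M : Fin n → Fin n → Word)
    (i j : Fin n) : Prop :=
  ∃ p : DiPath G i j, FromTable (fun i j => (M i j).num) p ∧ p.value A = (M i j).wt

/-- A rank of pairs of vertices such that the two parts of an optimal path do not have larger
rank, and a part of the same rank is optimal. Parts of widest paths need not be widest paths. -/
def IsPathRank (A : PathAlgebra) {n : ℕ} (G : WDigraph n) (M : Fin n → Fin n → Word)
    (rank : Fin n → Fin n → ℕ) : Prop :=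
  ∀ ⦃i k j⦄ (p : DiPath G i k) (p' : DiPath G k j), (p.append p').value A = (M i j).wt →
    (rank i k < rank i j ∨ rank i k = rank i j ∧ p.value A = (M i k).wt) ∧
    (rank k j < rank i j ∨ rank k j = rank i j ∧ p'.value A = (M k j).wt)

namespace IsClosure

variable {A : PathAlgebra} {n : ℕ} {G : WDigraph n} {q : ℕ} {M : ℕ → Fin n → Fin n → Word}

theorem eq_worst_or_exists_value_eq (h : IsClosure A G q M) (hA : A.Suits G) {φ : ℕ} (hφ : φ ≤ q)
    (i j : Fin n) :
    (M φ i j).wt = A.worst.eval ∨ ∃ p : DiPath G i j, p.value A = (M φ i j).wt := by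
  induction φ generalizing i j with
  | zero =>
    by_cases hij : i = j
    · subst hij
      rw [h.diag]
      exact .inr ⟨nil i, rfl⟩
    · rw [h.edge i j hij, WDigraph.weightMatrix]
      rcases hG : G i j with - | c
      · exact .inl rfl
      · exact .inr ⟨cons c hG (nil j), hA.mul_unit _⟩
  | succ φ ih =>
    rcases (h.step φ hφ i j).1 with hkeep | ⟨k, -, hsplit, -⟩
    · rw [hkeep]
      exact ih (by omega) i j
    · rw [hsplit]
      rcases ih (by omega) i k with h₁ | ⟨p, h₁⟩ <;> rcases ih (by omega) k j with h₂ | ⟨p', h₂⟩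
      · exact .inl (by simp only [h₁, h₂, hA.worst_mul_worst])
      · exact .inl (by simp only [h₁, ← h₂, hA.worst_mul])
      · exact .inl (by simp only [← h₁, h₂, hA.mul_worst])
      · exact .inr ⟨p.append p', by rw [hA.value_append, h₁, h₂]⟩

theorem asGood_of_edges_le (h : IsClosure A G q M) (hA : A.Suits G) {φ : ℕ} (hφ : φ ≤ q)
    {i j : Fin n} (p : DiPath G i j) (hp : p.edges ≤ 2 ^ φ) :
    A.AsGood (M φ i j).wt (p.value A) := by
  induction φ generalizing i j with
  | zero =>
    rcases p with - | ⟨c, hc, - | ⟨c', hc', p⟩⟩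
    · rw [h.diag]
      exact .refl _
    · by_cases hij : i = j
      · subst hij
        rw [h.diag]
        exact hA.unit_asGood _
      · rw [h.edge i j hij, WDigraph.weightMatrix, hc, value, value, hA.mul_unit]
        exact .refl _
    · simp [edges] at hp
  | succ φ ih =>
    rw [pow_succ, mul_two] at hp
    obtain ⟨k, p₁, p₂, rfl, h₁, h₂⟩ := p.exists_append_of_edges_le hp
    rw [hA.value_append]
    exact PathAlgebra.AsGood.trans ((h.step φ hφ i j).2 k (Set.mem_univ k))
      (.mul (ih (by omega) p₁ h₁) (ih (by omega) p₂ h₂))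

theorem asGood_value (h : IsClosure A G q M) (hA : A.Suits G) (hq : n ≤ 2 ^ q)
    {i j : Fin n} (p : DiPath G i j) : A.AsGood (M q i j).wt (p.value A) := by
  obtain ⟨p', hedges, hp'⟩ := hA.exists_edges_lt p
  exact (h.asGood_of_edges_le hA le_rfl p' (by omega)).trans hp'

theorem ne_worst (h : IsClosure A G q M) (hA : A.Suits G) (hq : n ≤ 2 ^ q) {i j : Fin n}
    (p : DiPath G i j) : (M q i j).wt ≠ A.worst.eval := fun hworst =>
  hA.value_ne_worst p ((hA.asGood_worst _).antisymm (hworst ▸ h.asGood_value hA hq p))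

theorem eq_or_better (h : IsClosure A G q M) {φ ψ : ℕ} (hφ : φ ≤ ψ) (hψ : ψ ≤ q) (i j : Fin n) :
    M ψ i j = M φ i j ∨ A.Better (M ψ i j).wt (M φ i j).wt := by
  induction ψ, hφ using Nat.le_induction with
  | base => exact .inl rfl
  | succ ψ _ ih =>
    rcases (h.step ψ hψ i j).1 with hkeep | ⟨k, -, hsplit, hbetter⟩
    · rw [hkeep]
      exact ih (by omega)
    · right
      rw [hsplit]
      rcases ih (by omega) with hφψ | hφψ
      · rwa [← hφψ]
      · exact hbetter.trans hφψ

theorem eq_of_wt_eq (h : IsClosure A G q M) {φ : ℕ} (hφ : φ ≤ q) {i j : Fin n}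
    (hwt : (M φ i j).wt = (M q i j).wt) : M q i j = M φ i j :=
  (h.eq_or_better hφ le_rfl i j).resolve_right (by rw [hwt]; exact PathAlgebra.Better.irrefl _)

theorem describes_self (h : IsClosure A G q M) (hA : A.Suits G) (i : Fin n) :
    Describes A G (M q) i i := by
  refine ⟨nil i, .nil i, ?_⟩
  rcases h.eq_or_better (Nat.zero_le q) le_rfl i i with hdiag | hbetter
  · rw [hdiag, h.diag]
    rfl
  · rw [h.diag] at hbetter
    rcases h.eq_worst_or_exists_value_eq hA le_rfl i i with hworst | ⟨p, hp⟩
    · exact absurd (hworst ▸ hbetter) (hA.asGood_worst _)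
    · exact absurd (hp ▸ hbetter) (hA.unit_asGood p)

theorem describes_of_wt_zero (h : IsClosure A G q M) (hA : A.Suits G) {i j : Fin n}
    (hwt : (M 0 i j).wt = (M q i j).wt) (hworst : (M q i j).wt ≠ A.worst.eval) :
    Describes A G (M q) i j := by
  rcases eq_or_ne i j with rfl | hij
  · exact h.describes_self hA i
  have heq := h.eq_of_wt_eq (Nat.zero_le q) hwt
  rw [h.edge i j hij, WDigraph.weightMatrix] at heq
  rcases hG : G i j with - | c <;> rw [hG] at heq
  · exact absurd (congrArg Word.wt heq) hworst
  · exact ⟨cons c hG (nil j), .edge c hG hij (congrArg Word.num heq),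
      (hA.mul_unit _).trans (congrArg Word.wt heq).symm⟩

theorem exists_paths_of_mul_ne_worst (h : IsClosure A G q M) (hA : A.Suits G) {φ : ℕ} (hφ : φ ≤ q)
    {i k j : Fin n} (hworst : A.mul.eval (M φ i k).wt (M φ k j).wt ≠ A.worst.eval) :
    ∃ (p : DiPath G i k) (p' : DiPath G k j),
      p.value A = (M φ i k).wt ∧ p'.value A = (M φ k j).wt := by
  rcases h.eq_worst_or_exists_value_eq hA hφ i k with h₁ | ⟨p, h₁⟩ <;>
    rcases h.eq_worst_or_exists_value_eq hA hφ k j with h₂ | ⟨p', h₂⟩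
  · exact absurd (by rw [h₁, h₂, hA.worst_mul_worst]) hworst
  · exact absurd (by rw [h₁, ← h₂, hA.worst_mul]) hworst
  · exact absurd (by rw [← h₁, h₂, hA.mul_worst]) hworst
  · exact ⟨p, p', h₁, h₂⟩

theorem describes_of_split (h : IsClosure A G q M) (hA : A.Suits G) (hq : n ≤ 2 ^ q)
    {i k j : Fin n} (hnum : (M q i j).num = k + 1) {p : DiPath G i k}
    {p' : DiPath G k j} (hvalue : (p.append p').value A = (M q i j).wt)
    (h₁ : Describes A G (M q) i k) (h₂ : Describes A G (M q) k j) :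
    Describes A G (M q) i j := by
  rcases eq_or_ne i j with rfl | hij
  · exact h.describes_self hA i
  obtain ⟨r, hr, hvalue₁⟩ := h₁
  obtain ⟨r', hr', hvalue₂⟩ := h₂
  refine ⟨r.append r', .split hij hnum hr hr',
    PathAlgebra.AsGood.antisymm ?_ (h.asGood_value hA hq _)⟩
  rw [← hvalue, hA.value_append, hA.value_append, hvalue₁, hvalue₂]
  exact .mul (h.asGood_value hA hq p) (h.asGood_value hA hq p')

theorem describes_of_wt_eq (h : IsClosure A G q M) (hA : A.Suits G) (hq : n ≤ 2 ^ q)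
    {rank : Fin n → Fin n → ℕ} (hrank : IsPathRank A G (M q) rank) :
    ∀ (φ : ℕ) (i j : Fin n), φ ≤ q → (M φ i j).wt = (M q i j).wt →
      (M q i j).wt ≠ A.worst.eval → Describes A G (M q) i j
  | 0, _, _, _, hwt, hworst => h.describes_of_wt_zero hA hwt hworst
  | φ + 1, i, j, hφ, hwt, hworst => by
    rcases (h.step φ hφ i j).1 with hkeep | ⟨k, -, hsplit, -⟩
    · exact h.describes_of_wt_eq hA hq hrank φ i j (by omega) (by rw [← hwt, hkeep]) hworst
    have heq := (h.eq_of_wt_eq hφ hwt).trans hsplit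
    obtain ⟨p, p', hp, hp'⟩ := h.exists_paths_of_mul_ne_worst hA (φ := φ) (by omega)
      (congrArg Word.wt heq ▸ hworst)
    have hvalue : (p.append p').value A = (M q i j).wt := by
      rw [hA.value_append, hp, hp', heq]
    obtain ⟨hpart, hpart'⟩ := hrank p p' hvalue
    refine h.describes_of_split hA hq (congrArg Word.num heq) hvalue ?_ ?_
    · rcases hpart with _ | ⟨_, hopt⟩
      · exact h.describes_of_wt_eq hA hq hrank q i k le_rfl rfl (h.ne_worst hA hq p)
      · exact h.describes_of_wt_eq hA hq hrank φ i k (by omega) (hp ▸ hopt) (h.ne_worst hA hq p)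
    · rcases hpart' with _ | ⟨_, hopt⟩
      · exact h.describes_of_wt_eq hA hq hrank q k j le_rfl rfl (h.ne_worst hA hq p')
      · exact h.describes_of_wt_eq hA hq hrank φ k j (by omega) (hp' ▸ hopt) (h.ne_worst hA hq p')
termination_by φ i j => (rank i j, φ)
decreasing_by all_goals simp only [Prod.lex_def, true_and]; omega

theorem exists_fromTable (h : IsClosure A G q M) (hA : A.Suits G) (hq : n ≤ 2 ^ q)
    {rank : Fin n → Fin n → ℕ} (hrank : IsPathRank A G (M q) rank) (i j : Fin n) :
    (∃ p : DiPath G i j, FromTable (fun i j => (M q i j).num) p ∧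
      (∀ p' : DiPath G i j, A.AsGood (p.value A) (p'.value A)) ∧ (M q i j).wt = p.value A) ∨
    (IsEmpty (DiPath G i j) ∧ (M q i j).wt = A.worst.eval) := by
  by_cases hworst : (M q i j).wt = A.worst.eval
  · exact .inr ⟨⟨fun p => h.ne_worst hA hq p hworst⟩, hworst⟩
  · obtain ⟨p, hp, hvalue⟩ := h.describes_of_wt_eq hA hq hrank q i j le_rfl rfl hworst
    exact .inl ⟨p, hp, fun p' => hvalue ▸ h.asGood_value hA hq p', hvalue.symm⟩

end IsClosure

/-! ### Shortest paths -/

/-- The path algebra of shortest paths. -/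
def shortestPaths (fromAdjacency : Bool) : PathAlgebra := ⟨.add, false, .top, .zero, fromAdjacency⟩

section Shortest

variable {n : ℕ} {G : WDigraph n} {b : Bool}

theorem value_shortestPaths {i j : Fin n} (p : DiPath G i j) :
    p.value (shortestPaths b) = (p.length : EReal) := by
  induction p with
  | nil => exact EReal.coe_zero.symm
  | cons c h p ih =>
    rw [value, ih, DiPath.length, EReal.coe_add]
    rfl

theorem asGood_shortestPaths {x y : EReal} : (shortestPaths b).AsGood x y ↔ x ≤ y :=
  PathAlgebra.asGood_iff

theorem suits_shortestPaths (hG : G.NoNegativeCycle) : (shortestPaths b).Suits G where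
  unit_mul x := zero_add x
  mul_unit x := add_zero x
  worst_mul p := by
    rw [value_shortestPaths]
    exact EReal.top_add_coe _
  mul_worst p := by
    rw [value_shortestPaths]
    exact EReal.coe_add_top _
  worst_mul_worst := rfl
  asGood_worst x := asGood_shortestPaths.2 le_top
  unit_asGood p := by
    rw [asGood_shortestPaths, value_shortestPaths]
    exact EReal.coe_nonneg.2 (hG _ p)
  value_ne_worst p := by
    rw [value_shortestPaths]
    exact EReal.coe_ne_top _

theorem isPathRank_shortestPaths (hG : G.NoNegativeCycle) {q : ℕ} (hq : n ≤ 2 ^ q)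
    {M : ℕ → Fin n → Fin n → Word} (h : IsClosure (shortestPaths b) G q M) :
    IsPathRank (shortestPaths b) G (M q) fun _ _ => 0 := by
  have hA := suits_shortestPaths (b := b) hG
  have hmin : ∀ {i j} (p p' : DiPath G i j), p'.value (shortestPaths b) = (M q i j).wt →
      p'.length ≤ p.length := fun p p' hp' => by
    have := h.asGood_value hA hq p
    rw [← hp'] at this
    simpa only [asGood_shortestPaths, value_shortestPaths, EReal.coe_le_coe_iff] using this
  intro i k j p p' hvalue
  obtain ⟨r, hr⟩ := (h.eq_worst_or_exists_value_eq hA le_rfl i k).resolve_left (h.ne_worst hA hq p)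
  obtain ⟨r', hr'⟩ :=
    (h.eq_worst_or_exists_value_eq hA le_rfl k j).resolve_left (h.ne_worst hA hq p')
  have hle := hmin p r hr
  have hle' := hmin p' r' hr'
  have hsum : p.length + p'.length ≤ r.length + r'.length := by
    have := h.asGood_value hA hq (r.append r')
    rw [← hvalue, hA.value_append, hA.value_append] at this
    simp only [value_shortestPaths] at this
    exact EReal.coe_le_coe_iff.1 (by
      rw [EReal.coe_add, EReal.coe_add]
      exact asGood_shortestPaths.1 this)
  rw [← hr, ← hr']
  simp only [value_shortestPaths, EReal.coe_eq_coe_iff]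
  exact ⟨.inr ⟨trivial, by linarith⟩, .inr ⟨trivial, by linarith⟩⟩

theorem isAPSP_of_isClosure (hG : G.NoNegativeCycle) {q : ℕ} (hq : n ≤ 2 ^ q)
    {M : ℕ → Fin n → Fin n → Word} (h : IsClosure (shortestPaths b) G q M) :
    IsAPSP G (fun i j => (M q i j).wt) (fun i j => (M q i j).num) := fun i j => by
  have hpath := h.exists_fromTable (suits_shortestPaths hG) hq
    (isPathRank_shortestPaths hG hq h) i j
  change _ ∨ IsEmpty _ ∧ _ = ⊤ at hpath
  simpa only [asGood_shortestPaths, value_shortestPaths, EReal.coe_le_coe_iff] using hpath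

end Shortest

/-! ### Widest paths -/

/-- The path algebra of widest paths. -/
def widestPaths (fromAdjacency : Bool) : PathAlgebra := ⟨.min, true, .bot, .top, fromAdjacency⟩

section Widest

variable {n : ℕ} {G : WDigraph n} {b : Bool}

theorem value_widestPaths {i j : Fin n} (p : DiPath G i j) : p.value (widestPaths b) = p.width := by
  induction p with
  | nil => rfl
  | cons c h p ih =>
    rw [value, ih, DiPath.width]
    rfl

theorem asGood_widestPaths {x y : EReal} : (widestPaths b).AsGood x y ↔ y ≤ x :=
  PathAlgebra.asGood_iff

theorem DiPath.width_ne_bot {i j : Fin n} (p : DiPath G i j) : p.width ≠ ⊥ := by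
  induction p with
  | nil => exact top_ne_bot
  | cons c h p ih =>
    rw [width, ← bot_lt_iff_ne_bot, lt_inf_iff]
    exact ⟨EReal.bot_lt_coe c, bot_lt_iff_ne_bot.2 ih⟩

theorem suits_widestPaths (b : Bool) (G : WDigraph n) : (widestPaths b).Suits G where
  unit_mul x := top_inf_eq x
  mul_unit x := inf_top_eq x
  worst_mul p := bot_inf_eq _
  mul_worst p := inf_bot_eq _
  worst_mul_worst := inf_bot_eq _
  asGood_worst x := asGood_widestPaths.2 bot_le
  unit_asGood p := asGood_widestPaths.2 le_top
  value_ne_worst p := by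
    rw [value_widestPaths]
    exact p.width_ne_bot

theorem isPathRank_widestPaths {q : ℕ} (hq : n ≤ 2 ^ q) {M : ℕ → Fin n → Fin n → Word}
    (h : IsClosure (widestPaths b) G q M) :
    IsPathRank (widestPaths b) G (M q) fun i j =>
      {x : Fin n × Fin n | (M q i j).wt < (M q x.1 x.2).wt}.ncard := by
  have hwidth_le : ∀ {i j} (p : DiPath G i j), p.width ≤ (M q i j).wt := fun p => by
    simpa only [asGood_widestPaths, value_widestPaths] using
      h.asGood_value (suits_widestPaths b G) hq p
  have hpart : ∀ {a c i j : Fin n} (r : DiPath G a c), (M q i j).wt ≤ r.width →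
      {x : Fin n × Fin n | (M q a c).wt < (M q x.1 x.2).wt}.ncard <
          {x : Fin n × Fin n | (M q i j).wt < (M q x.1 x.2).wt}.ncard ∨
        {x : Fin n × Fin n | (M q a c).wt < (M q x.1 x.2).wt}.ncard =
          {x : Fin n × Fin n | (M q i j).wt < (M q x.1 x.2).wt}.ncard ∧
        r.width = (M q a c).wt := fun {a c i j} r hr => by
    rcases (hr.trans (hwidth_le r)).lt_or_eq with hlt | heq
    · exact .inl (Set.ncard_lt_ncard
        ⟨fun x => hlt.trans, fun hsub => lt_irrefl (M q a c).wt (hsub (a := (a, c)) hlt)⟩)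
    · exact .inr ⟨by rw [heq], (hwidth_le r).antisymm (heq ▸ hr)⟩
  intro i k j p p' hvalue
  rw [(suits_widestPaths b G).value_append, value_widestPaths, value_widestPaths] at hvalue
  rw [value_widestPaths, value_widestPaths]
  exact ⟨hpart p (hvalue ▸ inf_le_left), hpart p' (hvalue ▸ inf_le_right)⟩

theorem isAPBP_of_isClosure {q : ℕ} (hq : n ≤ 2 ^ q) {M : ℕ → Fin n → Fin n → Word}
    (h : IsClosure (widestPaths b) G q M) :
    IsAPBP G (fun i j => (M q i j).wt) (fun i j => (M q i j).num) := fun i j => by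
  have hpath := h.exists_fromTable (suits_widestPaths b G) hq (isPathRank_widestPaths hq h) i j
  change _ ∨ IsEmpty _ ∧ _ = ⊥ at hpath
  simpa only [asGood_widestPaths, value_widestPaths] using hpath

end Widest

/-! ### The program solves the path problems -/

/-- The running time on meshes of size `n ^ α`. An empty mesh has halted at time `0`. -/
def runTime (α : ℝ) (n : ℕ) : ℕ := if n = 0 then 0 else endTime n (meshSide α n) + 1

theorem exists_isClosure (A : PathAlgebra) {n s : ℕ} (hn : 1 ≤ n) (hs : inputSide n ≤ s)
    {G : WDigraph n} (hA : A.Suits G) (X : Fin n → Fin n → EReal)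
    (hX : ∀ i j : Fin n, i ≠ j →
      A.initialEntry i j ⟨X i j, 0⟩ = ⟨G.weightMatrix A.worst.eval i j, 0⟩) :
    ∃ M, IsClosure A G (Nat.clog 2 n) M ∧
      (pathProgram A).Outputs s X (endTime n s + 1) (fun i j => (M (Nat.clog 2 n) i j).wt)
        (fun i j => (M (Nat.clog 2 n) i j).num) := by
  obtain ⟨ent, hinit, hstep, houtputs⟩ := exists_entries A hA.asGood_worst hn hs X
  refine ⟨fun φ i j => ent φ i j, ⟨fun i => ?_, fun i j hij => ?_, fun φ hφ i j => ?_⟩, houtputs⟩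
  · rw [hinit, PathAlgebra.initialEntry, if_pos rfl]
  · rw [hinit, hX i j hij]
  · obtain ⟨horigin, hbest⟩ := hstep φ hφ i i.2 j j.2
    exact ⟨horigin.imp_right fun ⟨k, hk, h⟩ => ⟨⟨k, hk⟩, trivial, h⟩, fun k _ => hbest k k.2⟩

theorem initialEntry_weightMatrix {A : PathAlgebra} {n : ℕ} (hA : A.fromAdjacency = false)
    (G : WDigraph n) {i j : Fin n} (hij : i ≠ j) :
    A.initialEntry i j ⟨G.weightMatrix A.worst.eval i j, 0⟩ =
      ⟨G.weightMatrix A.worst.eval i j, 0⟩ := by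
  rw [PathAlgebra.initialEntry, if_neg (fun h => hij (Fin.ext h)), if_neg (by simp [hA])]

theorem initialEntry_adjacencyMatrix {A : PathAlgebra} {n : ℕ} (hA : A.fromAdjacency = true)
    (G : Digraph (Fin n)) {i j : Fin n} (hij : i ≠ j) :
    A.initialEntry i j ⟨adjacencyMatrix G i j, 0⟩ =
      ⟨(WDigraph.ofDigraph G).weightMatrix A.worst.eval i j, 0⟩ := by
  rw [PathAlgebra.initialEntry, if_neg (fun h => hij (Fin.ext h)), adjacencyMatrix,
    WDigraph.weightMatrix, WDigraph.ofDigraph]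
  by_cases h : G.Adj i j <;> simp [h, hA]

theorem ofDigraph_noNegativeCycle {n : ℕ} (G : Digraph (Fin n)) :
    (WDigraph.ofDigraph G).NoNegativeCycle := by
  have hlength : ∀ {i j : Fin n} (p : DiPath (WDigraph.ofDigraph G) i j), 0 ≤ p.length := by
    intro i j p
    induction p with
    | nil => exact le_rfl
    | cons c h p ih =>
      have hc : 0 ≤ c := by
        unfold WDigraph.ofDigraph at h
        split_ifs at h
        rw [← Option.some.inj h]
        exact zero_le_one
      exact add_nonneg hc ih
  exact fun i p => hlength p

theorem inputSide_le_meshSide {α : ℝ} (hα : 2 ≤ α) {n : ℕ} (hn : 1 ≤ n) :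
    inputSide n ≤ meshSide α n :=
  Nat.ceil_mono (Real.rpow_le_rpow_of_exponent_le (by exact_mod_cast hn) (by linarith))

theorem outputs_zero {α : ℝ} (hα : 2 ≤ α) (P : MeshProgram) (X D : Fin 0 → Fin 0 → EReal)
    (mid : Fin 0 → Fin 0 → ℕ) : P.Outputs (meshSide α 0) X 0 D mid := by
  have h : meshSide α 0 = 0 := by
    rw [meshSide, Nat.cast_zero, Real.zero_rpow (by linarith), Nat.ceil_zero]
  rw [h]
  exact ⟨⟨fun p => (p 0).elim0, fun t ht => absurd ht (Nat.not_lt_zero t)⟩, fun i => i.elim0⟩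

theorem exists_outputs {α : ℝ} (hα : 2 ≤ α) (A : PathAlgebra) {n : ℕ} {G : WDigraph n}
    (hA : A.Suits G) (X : Fin n → Fin n → EReal)
    (hX : ∀ i j : Fin n, i ≠ j →
      A.initialEntry i j ⟨X i j, 0⟩ = ⟨G.weightMatrix A.worst.eval i j, 0⟩)
    {Sol : (Fin n → Fin n → EReal) → (Fin n → Fin n → ℕ) → Prop}
    (hSol : ∀ q, n ≤ 2 ^ q → ∀ M, IsClosure A G q M →
      Sol (fun i j => (M q i j).wt) (fun i j => (M q i j).num)) :
    ∃ D mid, (pathProgram A).Outputs (meshSide α n) X (runTime α n) D mid ∧ Sol D mid := by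
  rcases Nat.eq_zero_or_pos n with rfl | hn
  · exact ⟨_, _, outputs_zero hα _ _ _ _, hSol 0 (Nat.zero_le _) (fun _ _ _ => Word.blank)
      ⟨fun i => i.elim0, fun i => i.elim0, fun _ _ i => i.elim0⟩⟩
  · obtain ⟨M, hM, houtputs⟩ := exists_isClosure A hn (inputSide_le_meshSide hα hn) hA X hX
    rw [runTime, if_neg (by omega)]
    exact ⟨_, _, houtputs, hSol _ (Nat.le_pow_clog one_lt_two n) M hM⟩

section Solves

variable {α : ℝ}

theorem solvesWeightedAPSP (hα : 2 ≤ α) :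
    SolvesWeightedAPSP α (pathProgram (shortestPaths false)) (runTime α) := fun _ G hG =>
  exists_outputs hα _ (suits_shortestPaths hG) _ (fun _ _ => initialEntry_weightMatrix rfl G)
    fun _ hq _ => isAPSP_of_isClosure hG hq

theorem solvesUnweightedAPSP (hα : 2 ≤ α) :
    SolvesUnweightedAPSP α (pathProgram (shortestPaths true)) (runTime α) := fun _ G =>
  exists_outputs hα _ (suits_shortestPaths (ofDigraph_noNegativeCycle G)) _
    (fun _ _ => initialEntry_adjacencyMatrix rfl G)
    fun _ hq _ => isAPSP_of_isClosure (ofDigraph_noNegativeCycle G) hq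

theorem solvesWeightedAPBP (hα : 2 ≤ α) :
    SolvesWeightedAPBP α (pathProgram (widestPaths false)) (runTime α) := fun _ G =>
  exists_outputs hα _ (suits_widestPaths false G) _ (fun _ _ => initialEntry_weightMatrix rfl G)
    fun _ hq _ => isAPBP_of_isClosure hq

theorem solvesUnweightedAPBP (hα : 2 ≤ α) :
    SolvesUnweightedAPBP α (pathProgram (widestPaths true)) (runTime α) := fun _ G =>
  exists_outputs hα _ (suits_widestPaths true _) _ (fun _ _ => initialEntry_adjacencyMatrix rfl G)
    fun _ hq _ => isAPBP_of_isClosure hq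

end Solves

/-! ### The running time -/

theorem Layout.Valid.stride_pow_le {L : Layout} (h : L.Valid) :
    L.stride ^ 3 ≤ 8 * (L.s * L.batches) := by
  have hbatch : L.batch * (L.stride * L.stride) ≤ 8 * L.s := Nat.div_mul_le_self _ _
  calc L.stride ^ 3 = L.stride * (L.stride * L.stride) := by ring
    _ ≤ L.batches * L.batch * (L.stride * L.stride) :=
      Nat.mul_le_mul_right _ h.stride_le_batches_mul
    _ = L.batches * (L.batch * (L.stride * L.stride)) := by ring
    _ ≤ L.batches * (8 * L.s) := Nat.mul_le_mul_left _ hbatch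
    _ = 8 * (L.s * L.batches) := by ring

theorem Layout.Valid.mul_batches_le {L : Layout} (h : L.Valid) :
    4 * (L.s * L.batches) ≤ L.stride ^ 3 + 4 * L.s := by
  have hsq : 0 < L.stride * L.stride := Nat.mul_pos h.stride_pos h.stride_pos
  have hbatch := h.two_le_batch
  have hbatches : L.batches * L.batch ≤ L.stride + L.batch := (ceilDiv_mul_lt h.stride_pos).le
  have hlt : 8 * L.s < L.stride * L.stride * (L.batch + 1) := Nat.lt_mul_div_succ (8 * L.s) hsq
  have hs : 4 * L.s ≤ L.stride * L.stride * L.batch := by nlinarith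
  refine Nat.le_of_mul_le_mul_right (c := L.batch) ?_ (by omega)
  calc 4 * (L.s * L.batches) * L.batch = 4 * L.s * (L.batches * L.batch) := by ring
    _ ≤ 4 * L.s * (L.stride + L.batch) := Nat.mul_le_mul_left _ hbatches
    _ = 4 * L.s * L.stride + 4 * L.s * L.batch := by ring
    _ ≤ L.stride * L.stride * L.batch * L.stride + 4 * L.s * L.batch :=
      Nat.add_le_add_right (Nat.mul_le_mul_right _ hs) _
    _ = (L.stride ^ 3 + 4 * L.s) * L.batch := by ring

theorem half_le_log {n : ℕ} (hn : 2 ≤ n) : 1 / 2 ≤ Real.log n := by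
  have := Real.log_two_gt_d9
  have : Real.log 2 ≤ Real.log n := Real.log_le_log two_pos (by exact_mod_cast hn)
  linarith

theorem log_le_clog (n : ℕ) : Real.log n ≤ Nat.clog 2 n := by
  have hlog : Real.log 2 ≤ 1 := (Real.log_le_sub_one_of_pos two_pos).trans (by norm_num)
  calc Real.log n ≤ Real.logb 2 n :=
        le_div_self (Real.log_natCast_nonneg n) (Real.log_pos one_lt_two) hlog
    _ ≤ Nat.clog 2 n := by
      rw [← Real.natCeil_logb_natCast, Nat.cast_ofNat]
      exact Nat.le_ceil _

theorem clog_le_log {n : ℕ} (hn : 2 ≤ n) : (Nat.clog 2 n : ℝ) ≤ 4 * Real.log n := by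
  have hlog2 := Real.log_two_gt_d9
  have hlog := half_le_log hn
  have hceil : (Nat.clog 2 n : ℝ) ≤ Real.log n / Real.log 2 + 1 := by
    have hlogb : 0 ≤ Real.logb 2 n := div_nonneg (by linarith) (by linarith)
    rw [← Real.natCeil_logb_natCast, Nat.cast_ofNat]
    exact (Nat.ceil_lt_add_one hlogb).le
  have hdiv : Real.log n / Real.log 2 ≤ 2 * Real.log n := by
    rw [div_le_iff₀ (by linarith)]
    nlinarith
  linarith

section RunTime

variable {α : ℝ} {n : ℕ}

theorem rpow_le_meshSide (α : ℝ) (n : ℕ) : (n : ℝ) ^ (α / 3) ≤ meshSide α n := Nat.le_ceil _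

theorem meshSide_le (hα : 2 ≤ α) (hn : 1 ≤ n) : (meshSide α n : ℝ) ≤ 2 * (n : ℝ) ^ (α / 3) :=
  Nat.ceil_le_two_mul <| by
    have := Real.one_le_rpow (x := n) (z := α / 3) (by exact_mod_cast hn) (by linarith)
    linarith

theorem rpow_mul_rpow_pow_three (hn : 1 ≤ n) :
    (n : ℝ) ^ (3 - α) * ((n : ℝ) ^ (α / 3)) ^ 3 = (n : ℝ) ^ 3 := by
  have hpos : (0 : ℝ) < n := by exact_mod_cast hn
  rw [← Real.rpow_natCast ((n : ℝ) ^ (α / 3)), ← Real.rpow_mul hpos.le, ← Real.rpow_add hpos,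
    ← Real.rpow_natCast (n : ℝ)]
  congr 1
  push_cast
  ring

theorem rpow_le_stride_pow (hα : 2 ≤ α) (hn : 1 ≤ n) :
    (n : ℝ) ^ (3 - α) ≤ 8 * ((meshLayout n (meshSide α n)).stride : ℝ) ^ 3 := by
  have hL := meshLayout_valid hn (inputSide_le_meshSide hα hn)
  have hx : (0 : ℝ) < (n : ℝ) ^ (α / 3) := Real.rpow_pos_of_pos (by exact_mod_cast hn) _
  have hmul : (n : ℝ) ≤ (meshLayout n (meshSide α n)).stride * meshSide α n := by
    exact_mod_cast hL.le_stride_mul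
  refine le_of_mul_le_mul_right ?_ (pow_pos hx 3)
  rw [rpow_mul_rpow_pow_three hn]
  calc (n : ℝ) ^ 3 ≤ ((meshLayout n (meshSide α n)).stride * (2 * (n : ℝ) ^ (α / 3))) ^ 3 := by
        refine pow_le_pow_left₀ n.cast_nonneg (hmul.trans ?_) 3
        exact mul_le_mul_of_nonneg_left (meshSide_le hα hn) (Nat.cast_nonneg _)
    _ = _ := by ring

theorem stride_pow_le_rpow (hα : 2 ≤ α) (hα' : α ≤ 3) (hn : 1 ≤ n) :
    ((meshLayout n (meshSide α n)).stride : ℝ) ^ 3 ≤ 8 * (n : ℝ) ^ (3 - α) := by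
  have hL := meshLayout_valid hn (inputSide_le_meshSide hα hn)
  have hn' : (1 : ℝ) ≤ n := by exact_mod_cast hn
  have hx : (0 : ℝ) < (n : ℝ) ^ (α / 3) := Real.rpow_pos_of_pos (by linarith) _
  have hxn : (n : ℝ) ^ (α / 3) ≤ n := by
    simpa using Real.rpow_le_rpow_of_exponent_le hn' (by linarith : α / 3 ≤ 1)
  have hmul : ((meshLayout n (meshSide α n)).stride : ℝ) * meshSide α n ≤ n + meshSide α n := by
    exact_mod_cast hL.stride_mul_lt.le
  have hstride : (1 : ℝ) ≤ (meshLayout n (meshSide α n)).stride := by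
    exact_mod_cast hL.stride_pos
  have hmul' : ((meshLayout n (meshSide α n)).stride : ℝ) * (n : ℝ) ^ (α / 3) ≤ 2 * n := by
    have := mul_le_mul_of_nonneg_left (rpow_le_meshSide α n) (sub_nonneg.2 hstride)
    linarith
  refine le_of_mul_le_mul_right ?_ (pow_pos hx 3)
  calc ((meshLayout n (meshSide α n)).stride : ℝ) ^ 3 * ((n : ℝ) ^ (α / 3)) ^ 3
      = (((meshLayout n (meshSide α n)).stride : ℝ) * (n : ℝ) ^ (α / 3)) ^ 3 := (mul_pow _ _ _).symm
    _ ≤ (2 * n) ^ 3 := pow_le_pow_left₀ (by positivity) hmul' 3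
    _ = 8 * (n : ℝ) ^ (3 - α) * ((n : ℝ) ^ (α / 3)) ^ 3 := by
      rw [mul_assoc, rpow_mul_rpow_pow_three hn]
      ring

theorem runTime_eq (hn : 1 ≤ n) : runTime α n = 32 * (61 * meshSide α n + Nat.clog 2 n *
    (2 * (meshSide α n * (meshLayout n (meshSide α n)).batches) + meshSide α n)) + 1 := by
  rw [runTime, if_neg (by omega), endTime, rounds, Layout.period]
  ring

theorem le_runTime (hα : 2 ≤ α) (hn : 1 ≤ n) :
    (n : ℝ) ^ (3 - α) * Real.log n ≤ runTime α n := by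
  have hL := meshLayout_valid hn (inputSide_le_meshSide hα hn)
  have hbatches : ((meshLayout n (meshSide α n)).stride : ℝ) ^ 3 ≤
      8 * (meshSide α n * (meshLayout n (meshSide α n)).batches) := by
    exact_mod_cast hL.stride_pow_le
  have hrpow := rpow_le_stride_pow hα hn
  calc (n : ℝ) ^ (3 - α) * Real.log n
      ≤ 64 * (meshSide α n * (meshLayout n (meshSide α n)).batches) * Nat.clog 2 n :=
        mul_le_mul (by linarith) (log_le_clog n) (Real.log_natCast_nonneg n) (by positivity)
    _ ≤ runTime α n := by
      rw [runTime_eq hn]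
      push_cast
      have : (0 : ℝ) ≤ Nat.clog 2 n * meshSide α n := by positivity
      linarith [(meshSide α n).cast_nonneg (α := ℝ)]

theorem runTime_le (hα : 2 ≤ α) (hα' : α ≤ 9 / 4) (hn : 2 ≤ n) :
    (runTime α n : ℝ) ≤ 10000 * ((n : ℝ) ^ (3 - α) * Real.log n) := by
  have hn1 : 1 ≤ n := by omega
  have hn1' : (1 : ℝ) ≤ n := by exact_mod_cast hn1
  have hL := meshLayout_valid hn1 (inputSide_le_meshSide hα hn1)
  have hbatches : 4 * ((meshSide α n : ℝ) * (meshLayout n (meshSide α n)).batches) ≤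
      ((meshLayout n (meshSide α n)).stride : ℝ) ^ 3 + 4 * meshSide α n := by
    exact_mod_cast hL.mul_batches_le
  have hstride := stride_pow_le_rpow hα (by linarith) hn1
  have hs : (meshSide α n : ℝ) ≤ 2 * (n : ℝ) ^ (3 - α) := by
    have := Real.rpow_le_rpow_of_exponent_le hn1' (by linarith : α / 3 ≤ 3 - α)
    linarith [meshSide_le hα hn1]
  have hlog := half_le_log hn
  have hy : (1 : ℝ) ≤ (n : ℝ) ^ (3 - α) := Real.one_le_rpow hn1' (by linarith)
  have hproducts : (Nat.clog 2 n : ℝ) *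
      (2 * (meshSide α n * (meshLayout n (meshSide α n)).batches) + meshSide α n) ≤
        4 * Real.log n * (10 * (n : ℝ) ^ (3 - α)) :=
    mul_le_mul (clog_le_log hn) (by linarith) (by positivity) (by linarith)
  have hrouting : (n : ℝ) ^ (3 - α) ≤ 2 * ((n : ℝ) ^ (3 - α) * Real.log n) := by nlinarith
  rw [runTime_eq hn1]
  push_cast
  linarith

theorem isTheta_runTime (hα : 2 ≤ α) (hα' : α ≤ 9 / 4) :
    Asymptotics.IsTheta Filter.atTop (fun n => (runTime α n : ℝ))
      (fun n : ℕ => (n : ℝ) ^ (3 - α) * Real.log (n : ℝ)) := by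
  have hnonneg : ∀ n : ℕ, 0 ≤ (n : ℝ) ^ (3 - α) * Real.log (n : ℝ) := fun n =>
    mul_nonneg (Real.rpow_nonneg (Nat.cast_nonneg n) _) (Real.log_natCast_nonneg n)
  constructor
  · refine Asymptotics.IsBigO.of_bound 10000 ?_
    filter_upwards [Filter.eventually_ge_atTop 2] with n hn
    rw [Real.norm_of_nonneg (hnonneg n), Real.norm_of_nonneg (Nat.cast_nonneg _)]
    exact runTime_le hα hα' hn
  · refine Asymptotics.IsBigO.of_bound 1 ?_
    filter_upwards [Filter.eventually_ge_atTop 1] with n hn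
    rw [Real.norm_of_nonneg (hnonneg n), Real.norm_of_nonneg (Nat.cast_nonneg _), one_mul]
    exact le_runTime hα hn

theorem pathProblemsSolvableInTheta (hα : 2 ≤ α) (hα' : α ≤ 9 / 4) :
    PathProblemsSolvableInTheta α (fun n : ℕ => (n : ℝ) ^ (3 - α) * Real.log (n : ℝ)) :=
  ⟨⟨_, _, solvesWeightedAPSP hα, isTheta_runTime hα hα'⟩,
    ⟨_, _, solvesUnweightedAPSP hα, isTheta_runTime hα hα'⟩,
    ⟨_, _, solvesWeightedAPBP hα, isTheta_runTime hα hα'⟩,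
    ⟨_, _, solvesUnweightedAPBP hα, isTheta_runTime hα hα'⟩⟩

end RunTime

end

theorem corollary1 :
    (∀ α : ℝ, 2 ≤ α → α ≤ 9 / 4 →
      PathProblemsSolvableInTheta α
        (fun n : ℕ => (n : ℝ) ^ (3 - α) * Real.log (n : ℝ))) ∧
    PathProblemsSolvableInTheta (9 / 4)
      (fun n : ℕ => (n : ℝ) ^ (3 / 4 : ℝ) * Real.log (n : ℝ)) := by
  refine ⟨fun α hα hα' => pathProblemsSolvableInTheta hα hα', ?_⟩
  have h := pathProblemsSolvableInTheta (α := 9 / 4) (by norm_num) le_rfl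
  rwa [show (3 - 9 / 4 : ℝ) = 3 / 4 by norm_num] at h
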